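/- **Theorem 4 (Self-similarity of hierarchical branching process).** *Setting.* Consider finite rooted planted binary trees without planar embedding in which every non-root vertex has zero or two offspring; $\phi$ is the empty tree (a root and no edges). *Pruning* $\mathcal R(T)$ removes the leaves of $T$ and their parental edges, and then suppresses the vertices of degree two, adding the lengths of the merged edges if edges carry positive lengths; $\mathcal R(\phi)=\phi$. The *order* of $T$ is the least $k\ge 0$ with $\mathcal R^k(T)=\phi$, and $\mathcal H_K$ is the set of trees of order $K$. The order of a non-root vertex $v$ is that of the subtree $T_v$ formed by $v$, its descendants and their parental edges. A *branch* is a maximal connected set of vertices of equal order with their parental edges; $T_v$ is a *complete subtree* if $v$ is the vertex of its branch closest to the root. $N_k$ is the number of branches of order $k$, and $N_{i,j}$, $i<j$, the number of instances when a branch of order $i$ merges with a branch of order $j$. For a probability measure on trees, $\mu_K$ is its conditional measure on $\mathcal H_K$ (for those $K\ge1$ with $\mathcal H_K$ of positive probability; the conditions below refer only to such orders), and $T_{i,j}[K]=\mathbf E_K(N_{i,j})/\mathbf E_K(N_j)$, $1\le i<j\le K$, where $\mathbf E_K$ is the expectation under $\mu_K$. All measures below give zero probability to $\phi$. A probability measure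 $\mu$ on combinatorial trees is * *mean self-similar* if the means $\mathbf E_K(N_j)$ are finite, $T_{i,j}[K]$ does not depend on $K$ (mean coordination), $T_{i,j}[K]$ depends on $i,j$ only through $j-i$ (Toeplitz property), and $T_{i,j}[K]=T^{\mathcal R}_{i,j}[K]$ for the coefficients $T^{\mathcal R}_{i,j}[K]$ computed from $\mathcal R(T)$ with $T\sim\mu_{K+1}$ (mean prune-invariance); it has Tokunaga coefficients $\{T_k\}$ if $T_{i,j}[K]=T_{j-i}$ for all $1\le i<j\le K$; * *coordinated* if for all $1\le K\le H$ a uniformly chosen complete subtree of order $K$ of a tree drawn from $\mu_H$ has law $\mu_K$; * *prune-invariant* if $\mathcal R(T)$, conditioned on $\mathcal R(T)\ne\phi$ (an event of positive probability), has law $\mu$ when $T\sim\mu$; * *combinatorially self-similar* if it is coordinated and prune-invariant. A probability measure $\eta$ on trees with edge lengths is *self-similar with scaling exponent* $\zeta>0$ if (i) it is coordinated in shapes and (iii) prune-invariant in shapes, in the above sense; (ii) it is coordinated in lengths: for $1\le K\le H$ and every shape $\tau$ of order $K$ of positive probability, a uniform random complete subtree of order $K$ of a tree of order $H$, given that its shape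 is $\tau$, has the same law of relative edge lengths (edge lengths divided by the total length) and a.s. the same conditional law of the total length given the relative edge lengths as a tree $T\sim\eta$ given that its shape is $\tau$; and (iv) it is prune-invariant in lengths: for every nonempty shape $\tau$ of positive probability, given that the shape of $\mathcal R(T)$ is $\tau$, the relative edge lengths of $\mathcal R(T)$ have the law of those of $T$ given that the shape of $T$ is $\tau$, and a.s. the conditional law of the total length of $\mathcal R(T)$ given its relative edge lengths $\bar x$ is that of $\zeta$ times the total length of $T$ given its shape $\tau$ and its relative edge lengths $\bar x$. *The process.* Let $\{p_K\}_{K\ge1}$ be a probability mass function, $T_k\ge0$ ($k\ge1$) and $\lambda_j>0$ ($j\ge1$). The *hierarchical branching process* $S=(\{T_k\},\{\lambda_j\},\{p_K\})$ starts with one branch of order $K$ with probability $p_K$. Independently of all others, every branch of order $j$ produces offspring branches of order $i$, $1\le i<j$, with rate $\lambda_jT_{j-i}$ and terminates with rate $\lambda_j$; at termination it splits into two branches of order $j-1$ if $j\ge2$, and leaves no offspring if $j=1$. Let $T=T[S]$ be the tree with edge lengths (and without embedding) generated by $S$. *Statement.* 1. The law of the combinatorial shape of $T$ is mean self-similar with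 Tokunaga coefficients $\{T_k\}$. 2. The law of the combinatorial shape of $T$ is combinatorially self-similar with Tokunaga coefficients $\{T_k\}$ if and only if there is $p\in(0,1)$ with $p_K=p(1-p)^{K-1}$ for all $K\ge1$. 3. For every $\zeta>0$, the law of $T$ is self-similar with scaling exponent $\zeta$ if and only if there are $p\in(0,1)$ and $\gamma>0$ with $p_K=p(1-p)^{K-1}$ for all $K\ge1$ and $\lambda_j=\gamma\zeta^{-j}$ for all $j\ge1$. -/

import Mathlib

open MeasureTheory ProbabilityTheory
open scoped ENNReal

namespace RandomTree

/-! ## Binary trees -/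

/-- Nonempty planted binary trees with a planar embedding.  The vertices of the inductive type are
the non-root vertices of the planted tree; each of them carries a label of its parental edge (the
edge that leads towards the root).  The root itself (of degree one, below the outermost
constructor) is implicit.  With `α = Unit` these are combinatorial trees. -/
inductive PlaneTree (α : Type) : Type
  | leaf (a : α) : PlaneTree α
  | node (a : α) (l r : PlaneTree α) : PlaneTree α

namespace PlaneTree

variable {α β : Type}

/-- Two embedded trees represent the same tree without embedding: they differ by exchanging the
two offspring of some vertices. -/
inductive Iso : PlaneTree α → PlaneTree α → Prop
  | leaf (a : α) : Iso (leaf a) (leaf a)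
  | node (a : α) {l r l' r' : PlaneTree α} : Iso l l' → Iso r r' → Iso (node a l r) (node a l' r')
  | swap (a : α) {l r l' r' : PlaneTree α} : Iso l r' → Iso r l' → Iso (node a l r) (node a l' r')

theorem Iso.refl : ∀ t : PlaneTree α, Iso t t
  | .leaf a => .leaf a
  | .node a l r => .node a (Iso.refl l) (Iso.refl r)

theorem Iso.symm {s t : PlaneTree α} (h : Iso s t) : Iso t s := by
  induction h with
  | leaf a => exact .leaf a
  | node a _ _ h1 h2 => exact .node a h1 h2
  | swap a _ _ h1 h2 => exact .swap a h2 h1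

theorem Iso.trans {s t u : PlaneTree α} (h : Iso s t) (h' : Iso t u) : Iso s u := by
  induction h generalizing u with
  | leaf a => exact h'
  | node a _ _ h1 h2 =>
    cases h' with
    | node _ k1 k2 => exact .node a (h1 k1) (h2 k2)
    | swap _ k1 k2 => exact .swap a (h1 k1) (h2 k2)
  | swap a _ _ h1 h2 =>
    cases h' with
    | node _ k1 k2 => exact .swap a (h1 k2) (h2 k1)
    | swap _ k1 k2 => exact .node a (h1 k2) (h2 k1)

instance isoSetoid (α : Type) : Setoid (PlaneTree α) where
  r := Iso
  iseqv := ⟨Iso.refl, Iso.symm, Iso.trans⟩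

/-- The cylinder sets: all trees of a given planar shape whose edge labels belong, edge by edge,
to given measurable sets. -/
inductive IsCylinder [MeasurableSpace α] : Set (PlaneTree α) → Prop
  | leaf (A : Set α) : MeasurableSet A → IsCylinder {t | ∃ a ∈ A, t = leaf a}
  | node (A : Set α) (L R : Set (PlaneTree α)) : MeasurableSet A → IsCylinder L → IsCylinder R →
      IsCylinder {t | ∃ a ∈ A, ∃ l ∈ L, ∃ r ∈ R, t = node a l r}

instance [MeasurableSpace α] : MeasurableSpace (PlaneTree α) :=
  MeasurableSpace.generateFrom {S | IsCylinder S}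

/-- Relabelling of the edges. -/
def map (f : α → β) : PlaneTree α → PlaneTree β
  | leaf a => leaf (f a)
  | node a l r => node (f a) (map f l) (map f r)

/-- Horton-Strahler order, by hierarchical counting. -/
def order : PlaneTree α → ℕ
  | leaf _ => 1
  | node _ l r => if order l = order r then order l + 1 else max (order l) (order r)

/-- Add `a` to the label of the edge next to the root. -/
def addRoot [Add α] (a : α) : PlaneTree α → PlaneTree α
  | leaf b => leaf (a + b)
  | node b l r => node (a + b) l r

/-- Pruning: the leaves and their parental edges are removed, and each vertex of degree two that
arises is suppressed, the labels of the two edges that it joins being added; `none` is the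
empty tree. -/
def prune [Add α] : PlaneTree α → Option (PlaneTree α)
  | leaf _ => none
  | node a l r =>
    match prune l, prune r with
    | none, none => some (leaf a)
    | some l', none => some (addRoot a l')
    | none, some r' => some (addRoot a r')
    | some l', some r' => some (node a l' r')

/-- The subtrees `T_v` of order `K` (the vertex `v`, all its descendants, and their parental edges)
such that `v` is the initial vertex of a branch, i.e. the order of `v` differs from that of its
parent.  Here `q` is the order of the parent of the outermost vertex (`0` for the root). -/
def completeSubtrees (K : ℕ) : ℕ → PlaneTree α → Multiset (PlaneTree α)
  | q, leaf a => if (leaf a).order = K ∧ q ≠ K then {leaf a} else 0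
  | q, node a l r =>
    (if (node a l r).order = K ∧ q ≠ K then {node a l r} else 0)
      + completeSubtrees K (node a l r).order l + completeSubtrees K (node a l r).order r

/-- Number of vertices whose two offspring have orders `i` and `j`; for `i < j` this is the number
of instances when a branch of order `i` merges with a branch of order `j`. -/
def sideBranchCount (i j : ℕ) : PlaneTree α → ℕ
  | leaf _ => 0
  | node _ l r =>
    (if (order l = i ∧ order r = j) ∨ (order l = j ∧ order r = i) then 1 else 0)
      + sideBranchCount i j l + sideBranchCount i j r

/-- Total length. -/
def length [Add α] : PlaneTree α → α
  | leaf a => a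
  | node a l r => a + (length l + length r)

/-! Invariance of these notions under a change of the embedding. -/

theorem Iso.map (f : α → β) {s t : PlaneTree α} (h : Iso s t) : Iso (s.map f) (t.map f) := by
  induction h with
  | leaf a => exact .leaf _
  | node a _ _ h1 h2 => exact .node _ h1 h2
  | swap a _ _ h1 h2 => exact .swap _ h1 h2

theorem Iso.order_eq {s t : PlaneTree α} (h : Iso s t) : s.order = t.order := by
  induction h with
  | leaf a => rfl
  | node a _ _ h1 h2 => simp only [order, h1, h2]
  | swap a _ _ h1 h2 => simp only [order, h1, h2]; split_ifs <;> omega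

theorem Iso.addRoot [Add α] (a : α) {s t : PlaneTree α} (h : Iso s t) :
    Iso (s.addRoot a) (t.addRoot a) := by
  cases h with
  | leaf b => exact .leaf _
  | node b h1 h2 => exact .node _ h1 h2
  | swap b h1 h2 => exact .swap _ h1 h2

theorem Iso.prune [Add α] {s t : PlaneTree α} (h : Iso s t) :
    Option.Rel Iso s.prune t.prune := by
  induction h with
  | leaf a => exact .none
  | @node a l r l' r' _ _ h1 h2 =>
    simp only [PlaneTree.prune]
    revert h1 h2
    cases l.prune <;> cases l'.prune <;> cases r.prune <;> cases r'.prune <;> intro h1 h2 <;>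
      cases h1 <;> cases h2 <;> constructor <;>
      first
        | exact .leaf _
        | (apply Iso.addRoot; assumption)
        | (apply Iso.node <;> assumption)
  | @swap a l r l' r' _ _ h1 h2 =>
    simp only [PlaneTree.prune]
    revert h1 h2
    cases l.prune <;> cases l'.prune <;> cases r.prune <;> cases r'.prune <;> intro h1 h2 <;>
      cases h1 <;> cases h2 <;> constructor <;>
      first
        | exact .leaf _
        | (apply Iso.addRoot; assumption)
        | (apply Iso.swap <;> assumption)

theorem Iso.completeSubtrees (K : ℕ) {s t : PlaneTree α} (h : Iso s t) : ∀ q : ℕ,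
    (s.completeSubtrees K q).map (Quotient.mk (isoSetoid α))
      = (t.completeSubtrees K q).map (Quotient.mk (isoSetoid α)) := by
  induction h with
  | leaf a => intro q; rfl
  | @node a l r l' r' hl hr h1 h2 =>
    intro q
    have hi : Iso (PlaneTree.node a l r) (PlaneTree.node a l' r') := .node a hl hr
    have hq : (Quotient.mk (isoSetoid α) (PlaneTree.node a l r)) = Quotient.mk _ (.node a l' r') :=
      Quotient.sound hi
    simp only [PlaneTree.completeSubtrees, Multiset.map_add, h1, h2, hi.order_eq]
    congr 2
    split_ifs <;> simp [hq]
  | @swap a l r l' r' hl hr h1 h2 =>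
    intro q
    have hi : Iso (PlaneTree.node a l r) (PlaneTree.node a l' r') := .swap a hl hr
    have hq : (Quotient.mk (isoSetoid α) (PlaneTree.node a l r)) = Quotient.mk _ (.node a l' r') :=
      Quotient.sound hi
    simp only [PlaneTree.completeSubtrees, Multiset.map_add, h1, h2, hi.order_eq]
    rw [add_right_comm]
    congr 2
    split_ifs <;> simp [hq]

theorem Iso.sideBranchCount_eq (i j : ℕ) {s t : PlaneTree α} (h : Iso s t) :
    s.sideBranchCount i j = t.sideBranchCount i j := by
  induction h with
  | leaf a => rfl
  | node a hl hr h1 h2 => simp only [sideBranchCount, h1, h2, hl.order_eq, hr.order_eq]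
  | swap a hl hr h1 h2 =>
    simp only [sideBranchCount, h1, h2, hl.order_eq, hr.order_eq]
    rw [add_right_comm]
    congr 3
    exact propext ⟨fun h => by tauto, fun h => by tauto⟩

theorem Iso.length_eq [AddCommSemigroup α] {s t : PlaneTree α} (h : Iso s t) :
    s.length = t.length := by
  induction h with
  | leaf a => rfl
  | node a _ _ h1 h2 => simp only [length, h1, h2]
  | swap a _ _ h1 h2 => simp only [length, h1, h2, add_comm]

end PlaneTree

/-- Finite rooted planted reduced binary trees without embedding, with labelled edges, including
the empty tree (`none`). -/
def BinTree (α : Type) : Type := Option (Quotient (PlaneTree.isoSetoid α))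

namespace BinTree

variable {α β : Type}

/-- The empty tree, a single root vertex without edges. -/
def empty : BinTree α := none

/-- Forget the embedding. -/
def ofPlane (t : PlaneTree α) : BinTree α := some (Quotient.mk _ t)

/-- A set of trees is measurable if the set of all embeddings of its nonempty members is. -/
instance [MeasurableSpace α] : MeasurableSpace (BinTree α) :=
  MeasurableSpace.map ofPlane inferInstance

/-- Relabelling of the edges. -/
def map (f : α → β) (t : BinTree α) : BinTree β :=
  t.elim empty (Quotient.lift (fun s => ofPlane (s.map f))
    (fun _ _ h => congrArg some (Quotient.sound (PlaneTree.Iso.map f h))))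

/-- Combinatorial shape. -/
def shape (t : BinTree α) : BinTree Unit := t.map fun _ => ()

/-- Horton-Strahler order; the empty tree has order zero. -/
def order (t : BinTree α) : ℕ :=
  t.elim 0 (Quotient.lift PlaneTree.order (fun _ _ h => PlaneTree.Iso.order_eq h))

/-- The pruning map; the empty tree is pruned to itself. -/
def prune [Add α] (t : BinTree α) : BinTree α :=
  t.elim empty (Quotient.lift (fun s => (s.prune).elim empty ofPlane) (fun a b h => by
    have hab := PlaneTree.Iso.prune h
    revert hab
    cases a.prune <;> cases b.prune <;> intro hab <;> cases hab
    · rfl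
    · rename_i h'
      exact congrArg some (Quotient.sound h')))

/-- The complete subtrees of order `K`, one for every branch of order `K`. -/
def completeSubtrees (K : ℕ) (t : BinTree α) : Multiset (BinTree α) :=
  t.elim 0 (fun u => (Quotient.lift
    (fun s : PlaneTree α => (s.completeSubtrees K 0).map (Quotient.mk (PlaneTree.isoSetoid α)))
    (fun _ _ h => PlaneTree.Iso.completeSubtrees K h 0) u).map some)

/-- Number `N_k` of branches of order `k`. -/
def branchCount (k : ℕ) (t : BinTree α) : ℕ := Multiset.card (t.completeSubtrees k)

/-- Number `N_{i,j}` of side-branches of order `{i, j}`, for `i < j`. -/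
def sideBranchCount (i j : ℕ) (t : BinTree α) : ℕ :=
  t.elim 0 (Quotient.lift (PlaneTree.sideBranchCount i j)
    (fun _ _ h => PlaneTree.Iso.sideBranchCount_eq i j h))

end BinTree

/-- Combinatorial trees. -/
abbrev Shape : Type := BinTree Unit

/-- Edge lengths are positive reals. -/
abbrev EdgeLength : Type := {x : ℝ // 0 < x}

/-- Trees with edge lengths. -/
abbrev LTree : Type := BinTree EdgeLength

/-- Total length of a tree. -/
def LTree.length (t : LTree) : ℝ :=
  t.elim 0 (Quotient.lift (fun s => ((PlaneTree.length s : EdgeLength) : ℝ))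
    (fun _ _ h => congrArg Subtype.val (PlaneTree.Iso.length_eq h)))

/-- The relative edge lengths of a tree: every edge length is divided by the total length.  The
result is kept as a tree (of total length one), so that no labelling of edges is needed. -/
noncomputable def LTree.relative (t : LTree) : LTree :=
  t.elim BinTree.empty (Quotient.lift
    (fun s => BinTree.ofPlane (s.map fun a => a * (PlaneTree.length s)⁻¹))
    (fun a b h => by
      have hl : a.length = b.length := PlaneTree.Iso.length_eq h
      simp only [hl]
      exact congrArg some (Quotient.sound (PlaneTree.Iso.map _ h))))

/-! The order is the number of prunings that it takes to eliminate the tree. -/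

theorem PlaneTree.order_pos {α : Type} (t : PlaneTree α) : 1 ≤ t.order := by
  induction t with
  | leaf a => exact le_rfl
  | node a l r hl hr => simp only [PlaneTree.order]; split_ifs <;> omega

theorem PlaneTree.order_addRoot {α : Type} [Add α] (a : α) (t : PlaneTree α) :
    (t.addRoot a).order = t.order := by
  cases t <;> rfl

theorem PlaneTree.order_prune {α : Type} [Add α] (t : PlaneTree α) :
    (t.prune).elim 0 PlaneTree.order = t.order - 1 := by
  induction t with
  | leaf a => rfl
  | node a l r hl hr =>
    have hl1 := l.order_pos
    have hr1 := r.order_pos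
    simp only [PlaneTree.prune, PlaneTree.order]
    revert hl hr
    cases l.prune with
    | none =>
      cases r.prune with
      | none =>
        intro hl hr
        simp only [Option.elim, PlaneTree.order] at *
        split_ifs <;> omega
      | some r' =>
        intro hl hr
        have := r'.order_pos
        simp only [Option.elim, PlaneTree.order_addRoot] at *
        split_ifs <;> omega
    | some l' =>
      have := l'.order_pos
      cases r.prune with
      | none =>
        intro hl hr
        simp only [Option.elim, PlaneTree.order_addRoot] at *
        split_ifs <;> omega
      | some r' =>
        have := r'.order_pos
        intro hl hr
        simp only [Option.elim, PlaneTree.order] at *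
        split_ifs <;> omega

theorem BinTree.order_prune {α : Type} [Add α] (t : BinTree α) :
    t.prune.order = t.order - 1 := by
  rcases t with _ | u
  · rfl
  · induction u using Quotient.inductionOn with
    | _ s =>
      have h := PlaneTree.order_prune s
      change BinTree.order ((s.prune).elim BinTree.empty BinTree.ofPlane) = s.order - 1
      rw [← h]
      cases s.prune <;> rfl

theorem BinTree.order_eq_zero {α : Type} (t : BinTree α) : t.order = 0 ↔ t = BinTree.empty := by
  rcases t with _ | u
  · exact ⟨fun _ => rfl, fun _ => rfl⟩
  · induction u using Quotient.inductionOn with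
    | _ s =>
      refine ⟨fun h => ?_, fun h => by cases h⟩
      have := PlaneTree.order_pos s
      change s.order = 0 at h
      omega

theorem BinTree.order_eq_sInf {α : Type} [Add α] (t : BinTree α) :
    t.order = sInf {k : ℕ | BinTree.prune^[k] t = BinTree.empty} := by
  have key : ∀ k : ℕ, (BinTree.prune^[k] t).order = t.order - k := by
    intro k
    induction k with
    | zero => rfl
    | succ k ih => rw [Function.iterate_succ_apply', BinTree.order_prune, ih]; omega
  have hs : {k : ℕ | BinTree.prune^[k] t = BinTree.empty} = Set.Ici t.order := by
    ext k
    simp only [Set.mem_ofPred_eq, Set.mem_Ici, ← BinTree.order_eq_zero, key k]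
    omega
  rw [hs, csInf_Ici]

noncomputable section

/-! ## Self-similarity of tree measures -/

variable {α : Type} [MeasurableSpace α]

/-- The subspace of trees of order `K`. -/
def ordEq (α : Type) (K : ℕ) : Set (BinTree α) := {t | t.order = K}

/-- The conditional measure on the trees of order `K`. -/
def condOrder (η : Measure (BinTree α)) (K : ℕ) : Measure (BinTree α) := η[|ordEq α K]

/-- The uniform probability measure on a nonempty finite multiset. -/
def uniformOn {X : Type} [MeasurableSpace X] (s : Multiset X) : Measure X :=
  (Multiset.card s : ℝ≥0∞)⁻¹ • (s.map Measure.dirac).sum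

/-- The law of a uniform random complete subtree of order `K` of a random tree of order `H`. -/
def subtreeLaw (η : Measure (BinTree α)) (K H : ℕ) : Measure (BinTree α) :=
  (condOrder η H).bind fun t => uniformOn (t.completeSubtrees K)

/-- Expected number of branches of order `k`. -/
def meanBranch (ν : Measure Shape) (k : ℕ) : ℝ≥0∞ := ∫⁻ t, (t.branchCount k : ℝ≥0∞) ∂ν

/-- Expected number of side-branches of order `{i, j}`. -/
def meanSideBranch (ν : Measure Shape) (i j : ℕ) : ℝ≥0∞ :=
  ∫⁻ t, (t.sideBranchCount i j : ℝ≥0∞) ∂ν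

/-- The Tokunaga coefficient `T_{i,j}` of a measure on the trees of a fixed order. -/
def tokunaga (ν : Measure Shape) (i j : ℕ) : ℝ≥0∞ := meanSideBranch ν i j / meanBranch ν j

/-- The average Horton numbers are finite.  (Here and below, a statement on the conditional measure
on the trees of order `K` is required for those `K` for which this measure is defined, that is,
for which trees of order `K` have positive probability.) -/
def FiniteMeans (μ : Measure Shape) : Prop :=
  ∀ K, 1 ≤ K → μ (ordEq Unit K) ≠ 0 → ∀ j, 1 ≤ j → j ≤ K → meanBranch (condOrder μ K) j ≠ ∞

/-- Mean coordination: `T_{i,j}[K]` does not depend on `K`. -/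
def MeanCoordinated (μ : Measure Shape) : Prop :=
  ∃ t : ℕ → ℕ → ℝ≥0∞, ∀ K, 2 ≤ K → μ (ordEq Unit K) ≠ 0 →
    ∀ i j, 1 ≤ i → i < j → j ≤ K → tokunaga (condOrder μ K) i j = t i j

/-- The Toeplitz property: `T_{i,j}[K]` depends on `i, j` through `j - i` only. -/
def Toeplitz (μ : Measure Shape) : Prop :=
  ∀ K, 2 ≤ K → μ (ordEq Unit K) ≠ 0 →
    ∃ t : ℕ → ℝ≥0∞, ∀ i j, 1 ≤ i → i < j → j ≤ K → tokunaga (condOrder μ K) i j = t (j - i)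

/-- Mean prune-invariance: the Tokunaga coefficients of order `K` do not change if they are computed
from pruned trees of order `K + 1`. -/
def MeanPruneInvariant (μ : Measure Shape) : Prop :=
  ∀ K, 2 ≤ K → μ (ordEq Unit K) ≠ 0 → μ (ordEq Unit (K + 1)) ≠ 0 →
    ∀ i j, 1 ≤ i → i < j → j ≤ K →
      tokunaga (condOrder μ K) i j = tokunaga ((condOrder μ (K + 1)).map BinTree.prune) i j

/-- Mean self-similarity: mean coordination together with the Toeplitz property, respectively with
mean prune-invariance; all of them are required. -/
def IsMeanSelfSimilar (μ : Measure Shape) : Prop :=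
  IsProbabilityMeasure μ ∧ μ {BinTree.empty} = 0 ∧ FiniteMeans μ ∧
    MeanCoordinated μ ∧ Toeplitz μ ∧ MeanPruneInvariant μ

/-- The Tokunaga coefficients are `T_{i,j}[K] = T_{j-i}`. -/
def HasTokunagaCoefficients (μ : Measure Shape) (T : ℕ → ℝ) : Prop :=
  ∀ K, 2 ≤ K → μ (ordEq Unit K) ≠ 0 →
    ∀ i j, 1 ≤ i → i < j → j ≤ K → tokunaga (condOrder μ K) i j = ENNReal.ofReal (T (j - i))

/-- Coordination of a measure on combinatorial trees. -/
def Coordinated (μ : Measure Shape) : Prop :=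
  ∀ K H, 1 ≤ K → K ≤ H → μ (ordEq Unit K) ≠ 0 → μ (ordEq Unit H) ≠ 0 →
    ∀ τ : Shape, τ.order = K → subtreeLaw μ K H {τ} = condOrder μ K {τ}

/-- Prune-invariance: conditioned on being nonempty, the pruned tree has the original law. -/
def PruneInvariant (μ : Measure Shape) : Prop :=
  ∀ τ : Shape, (μ.map BinTree.prune)[|{BinTree.empty}ᶜ] {τ} = μ {τ}

/-- Combinatorial self-similarity with respect to pruning. -/
def IsCombSelfSimilar (μ : Measure Shape) : Prop :=
  IsProbabilityMeasure μ ∧ μ {BinTree.empty} = 0 ∧ Coordinated μ ∧ PruneInvariant μ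

/-- A tree measure conditioned on the shape `τ`. -/
def condShape (η : Measure LTree) (τ : Shape) : Measure LTree := η[|BinTree.shape ⁻¹' {τ}]

/-- The law of the relative edge lengths given the shape `τ`. -/
def relativeLaw (η : Measure LTree) (τ : Shape) : Measure LTree :=
  (condShape η τ).map LTree.relative

instance (η : Measure LTree) (τ : Shape) : IsFiniteMeasure (condShape η τ) := by
  unfold condShape; infer_instance

/-- The conditional law of the total length given the shape `τ` and the relative edge lengths. -/
def lengthLaw (η : Measure LTree) (τ : Shape) : Kernel LTree ℝ :=
  condDistrib LTree.length LTree.relative (condShape η τ)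

/-- Coordination in shapes of a measure on trees with edge lengths. -/
def CoordinatedInShapes (η : Measure LTree) : Prop :=
  ∀ K H, 1 ≤ K → K ≤ H → η (ordEq EdgeLength K) ≠ 0 → η (ordEq EdgeLength H) ≠ 0 →
    ∀ τ : Shape, τ.order = K →
      (subtreeLaw η K H).map BinTree.shape {τ} = (condOrder η K).map BinTree.shape {τ}

/-- Coordination in lengths. -/
def CoordinatedInLengths (η : Measure LTree) : Prop :=
  ∀ K H, 1 ≤ K → K ≤ H → η (ordEq EdgeLength K) ≠ 0 → η (ordEq EdgeLength H) ≠ 0 →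
    ∀ τ : Shape, τ.order = K → η.map BinTree.shape {τ} ≠ 0 →
      relativeLaw (subtreeLaw η K H) τ = relativeLaw η τ ∧
      ∀ᵐ x ∂(relativeLaw η τ), lengthLaw (subtreeLaw η K H) τ x = lengthLaw η τ x

/-- Prune-invariance in lengths with scaling exponent `ζ`: pruning keeps the law of the relative
edge lengths and multiplies the total length by `ζ` (in law). -/
def PruneInvariantInLengths (η : Measure LTree) (ζ : ℝ) : Prop :=
  ∀ τ : Shape, τ ≠ BinTree.empty → η.map BinTree.shape {τ} ≠ 0 →
    relativeLaw (η.map BinTree.prune) τ = relativeLaw η τ ∧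
    ∀ᵐ x ∂(relativeLaw η τ),
      lengthLaw (η.map BinTree.prune) τ x = (lengthLaw η τ x).map (fun l => ζ * l)

/-- Self-similarity with respect to pruning of a measure on trees with edge lengths, with scaling
exponent `ζ`. -/
def IsSelfSimilar (η : Measure LTree) (ζ : ℝ) : Prop :=
  IsProbabilityMeasure η ∧ η {BinTree.empty} = 0 ∧ CoordinatedInShapes η ∧ CoordinatedInLengths η ∧
    PruneInvariant (η.map BinTree.shape) ∧ 0 < ζ ∧ PruneInvariantInLengths η ζ

/-! ## The hierarchical branching process

Each individual is a segment of a branch between two consecutive events, i.e. an edge of the tree.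
A branch of order `j` terminates with rate `lam j`, and it produces an offspring of order `i`,
`1 ≤ i < j`, with rate `lam j * T (j - i)`.  Hence the time until the next event is exponential
with the total rate, and independently the event is chosen with probability proportional to its
rate. -/

/-- Total rate of the events in a branch of order `j`. -/
def totalRate (T lam : ℕ → ℝ) (j : ℕ) : ℝ :=
  lam j + ∑ i ∈ Finset.Ico 1 j, lam j * T (j - i)

/-- The time until the next event in a branch of order `j`. -/
def waitLaw (T lam : ℕ → ℝ) (j : ℕ) : Measure EdgeLength :=
  (expMeasure (totalRate T lam j)).comap Subtype.val

/-- Join two independent random trees at the end of an independent random edge. -/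
def joinLaw (e : Measure EdgeLength) (l r : Measure (PlaneTree EdgeLength)) :
    Measure (PlaneTree EdgeLength) :=
  (e.prod (l.prod r)).map fun x => PlaneTree.node x.1 x.2.1 x.2.2

/-- The law of the tree that is generated from a given instant by a branch of order `j`, restricted
to the event that its embedded shape is `s`.  The tree is embedded as follows: if a side-branch is
produced, then the branch itself continues to the left and its offspring is on the right.
A branch of order one terminates without offspring; a branch of order `j ≥ 2` that terminates
splits into two branches of order `j - 1`. -/
def historyLaw (T lam : ℕ → ℝ) : PlaneTree Unit → ℕ → Measure (PlaneTree EdgeLength)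
  | .leaf _, j => if j = 1 then (waitLaw T lam 1).map PlaneTree.leaf else 0
  | .node _ l r, j =>
    if 2 ≤ j then
      ENNReal.ofReal (lam j / totalRate T lam j) •
          joinLaw (waitLaw T lam j) (historyLaw T lam l (j - 1)) (historyLaw T lam r (j - 1))
        + ∑ i ∈ Finset.Ico 1 j, ENNReal.ofReal (lam j * T (j - i) / totalRate T lam j) •
            joinLaw (waitLaw T lam j) (historyLaw T lam l j) (historyLaw T lam r i)
    else 0

/-- The law of the embedded tree that starts with a root branch of order `j`. -/
def branchLaw (T lam : ℕ → ℝ) (j : ℕ) : Measure (PlaneTree EdgeLength) :=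
  Measure.sum fun s : PlaneTree Unit => historyLaw T lam s j

/-- The law of the tree `T[S]` generated by the hierarchical branching process `S` with Tokunaga
coefficients `T k`, termination rates `lam j` and initial distribution `p K`, for `k, j, K ≥ 1`. -/
def hbpLaw (T lam p : ℕ → ℝ) : Measure LTree :=
  Measure.sum fun K : ℕ => ENNReal.ofReal (p (K + 1)) •
    (branchLaw T lam (K + 1)).map BinTree.ofPlane

/-- The law of the combinatorial part of `T[S]`. -/
def hbpShapeLaw (T lam p : ℕ → ℝ) : Measure Shape := (hbpLaw T lam p).map BinTree.shape

end

end RandomTree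

/-! Let `ν j` be the law of the tree grown from a branch of order `j`. Splitting at the first event
gives `ν j = termProb T j • graft (w j) (ν (j-1) ⊗ ν (j-1)) + ∑ i<j, sideProb T i j • graft (w j) (ν
j ⊗ ν i)`, where `w j` is the law of an edge of order `j`. Since `ν j` occurs on both sides this is
not a recursion on `j`, but given the lower orders it is an affine equation for `ν j`. The
side-branch terms contract mass by the factor `sideTotal T j < 1`, because termination has positive
probability, so a finite solution is unique. `BranchFamily` records these equations for arbitrary
edge labels, which covers trees with lengths and, with labels in `Unit`, shapes. Almost every
identity below is proved by showing that two finite quantities solve the same affine equation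
(`eq_of_affine`, `measure_eq_of_affine`).

Means: a branch of order `j` has a mean number `x` of side-branches of order `i` with `x = sideProb
T i j + sideTotal T j * x`, hence `x = T (j-i)`. In trees of higher order both counts are additive
over the two subtrees, so the ratio persists (`lintegral_sideBranchCount`).

Coordination holds for every `p`. The random denominator `N` in a uniform choice is removed by `1/N
= ∫₀^∞ exp(-x N) dx`; it then suffices to treat the multiplicative weights `z^N`, under which the
first-event equations stay affine (`lintegral_pow_mul_sum`, `lintegral_uniform_completeSubtrees`).

Pruning: in a branch of order `j+1` the births of order-one branches become invisible and the edges
around them merge. A geometric sum of exponential edges is exponential, with exactly the total rate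
of a branch of order `j` whose termination rate is `lam (j+1)`. Thus pruning turns `ν (j+1)` into
the law of order `j` with shifted rates (`BranchFamily.map_pruned`, `waitLaw_succ`). On shapes rates
are irrelevant, so pruning only replaces the weights `p K` by `p (K+1) / (1 - p 1)`, and these agree
with `p K` exactly for geometric `p`.

Lengths: multiplying all edges by `ζ` divides all rates by `ζ`, so `lam (j+1) = lam j / ζ` is
sufficient. For necessity, the Laplace transform of the total length is computed on perfect binary
trees: there no side-branch occurs, the transform is a product over edges, and comparing consecutive
orders isolates the waiting time of one order (`rate_succ_of_pruneInvariantInLengths`). -/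

namespace RandomTree

namespace PlaneTree

variable {α β : Type}

/-! ## Measurability on planar trees -/

/-- An injective code of planar shapes by natural numbers. -/
def code : PlaneTree Unit → ℕ
  | leaf _ => 0
  | node _ l r => Nat.pair (code l) (code r) + 1

theorem code_injective : Function.Injective code := by
  intro s
  induction s with
  | leaf a =>
    intro t h
    cases t with
    | leaf b => rfl
    | node b l r => simp [code] at h
  | node a l r hl hr =>
    intro t h
    cases t with
    | leaf b => simp [code] at h
    | node b l' r' =>
      simp only [code, Nat.add_right_cancel_iff, Nat.pair_eq_pair] at h
      rw [hl h.1, hr h.2]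

/-- Countability lets measurable sets of labelled trees be assembled from their pieces of fixed
planar shape. -/
instance : Countable (PlaneTree Unit) := code_injective.countable

instance [Inhabited α] : Inhabited (PlaneTree α) := ⟨leaf default⟩

/-- The planar shape. -/
def skeleton (t : PlaneTree α) : PlaneTree Unit := t.map fun _ => ()

theorem order_map (f : α → β) (t : PlaneTree α) : (t.map f).order = t.order := by
  induction t with
  | leaf a => rfl
  | node a l r hl hr => simp only [map, order, hl, hr]

theorem order_skeleton (t : PlaneTree α) : t.skeleton.order = t.order := order_map _ t

variable [MeasurableSpace α]

theorem isCylinder_skeleton (s : PlaneTree Unit) :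
    IsCylinder {t : PlaneTree α | t.skeleton = s} := by
  induction s with
  | leaf u =>
    convert IsCylinder.leaf (α := α) Set.univ MeasurableSet.univ using 1
    ext t
    cases t <;> simp [skeleton, map]
  | node u l r hl hr =>
    convert IsCylinder.node (α := α) Set.univ _ _ MeasurableSet.univ hl hr using 1
    ext t
    cases t <;> simp [skeleton, map]

theorem IsCylinder.measurableSet {S : Set (PlaneTree α)}
    (h : IsCylinder S) : MeasurableSet S :=
  MeasurableSpace.measurableSet_generateFrom h

theorem measurableSet_skeleton (s : PlaneTree Unit) :
    MeasurableSet {t : PlaneTree α | t.skeleton = s} := (isCylinder_skeleton s).measurableSet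

theorem measurable_leaf : Measurable (leaf : α → PlaneTree α) := by
  refine measurable_generateFrom ?_
  rintro _ (⟨A, hA⟩ | ⟨A, L, R, hA, hL, hR⟩)
  · convert hA using 1
    ext a
    simp
  · convert MeasurableSet.empty using 1
    ext a
    simp

theorem measurable_node :
    Measurable fun x : α × PlaneTree α × PlaneTree α => node x.1 x.2.1 x.2.2 := by
  refine measurable_generateFrom ?_
  rintro _ (⟨A, hA⟩ | ⟨A, L, R, hA, hL, hR⟩)
  · convert MeasurableSet.empty using 1
    ext a
    simp
  · convert hA.prod (hL.measurableSet.prod hR.measurableSet) using 1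
    ext ⟨a, l, r⟩
    simp

/-- Whether the tree is a single edge. -/
def isLeaf : PlaneTree α → Prop
  | leaf _ => True
  | node _ _ _ => False

/-- The label of the edge next to the root. -/
def label : PlaneTree α → α
  | leaf a => a
  | node a _ _ => a

/-- The left subtree of a node. -/
def left : PlaneTree α → PlaneTree α
  | leaf a => leaf a
  | node _ l _ => l

/-- The right subtree of a node. -/
def right : PlaneTree α → PlaneTree α
  | leaf a => leaf a
  | node _ _ r => r

theorem measurableSet_leaf_image {A : Set α} (hA : MeasurableSet A) :
    MeasurableSet {t : PlaneTree α | ∃ a ∈ A, t = leaf a} := (IsCylinder.leaf A hA).measurableSet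

theorem measurableSet_node_image {A : Set α} {L R : Set (PlaneTree α)} (hA : MeasurableSet A)
    (hL : IsCylinder L) (hR : IsCylinder R) :
    MeasurableSet {t : PlaneTree α | ∃ a ∈ A, ∃ l ∈ L, ∃ r ∈ R, t = node a l r} :=
  (IsCylinder.node A L R hA hL hR).measurableSet

theorem measurableSet_isLeaf : MeasurableSet {t : PlaneTree α | t.isLeaf} := by
  convert measurableSet_leaf_image (α := α) MeasurableSet.univ using 1
  ext t
  cases t <;> simp [isLeaf]

theorem measurable_label : Measurable (label : PlaneTree α → α) := by
  intro A hA
  -- Cylinders prescribe the whole shape, so a condition on the root edge alone is a countable union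
  -- over the shapes of the two subtrees.
  have : label ⁻¹' A = {t : PlaneTree α | ∃ a ∈ A, t = leaf a} ∪
      ⋃ s : PlaneTree Unit, ⋃ s' : PlaneTree Unit, {t : PlaneTree α | ∃ a ∈ A,
        ∃ l ∈ {t : PlaneTree α | t.skeleton = s}, ∃ r ∈ {t : PlaneTree α | t.skeleton = s'},
          t = node a l r} := by
    ext t
    cases t <;> simp [label]
  rw [this]
  exact (measurableSet_leaf_image hA).union (.iUnion fun s => .iUnion fun s' =>
    measurableSet_node_image hA (isCylinder_skeleton s) (isCylinder_skeleton s'))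

theorem measurable_left : Measurable (left : PlaneTree α → PlaneTree α) := by
  refine measurable_generateFrom ?_
  intro S hS
  -- The first piece accounts for the leaves, which `left` maps to themselves.
  have : left ⁻¹' S = (S ∩ {t | t.isLeaf}) ∪
      ⋃ s' : PlaneTree Unit, {t : PlaneTree α | ∃ a ∈ Set.univ,
        ∃ l ∈ S, ∃ r ∈ {t : PlaneTree α | t.skeleton = s'}, t = node a l r} := by
    ext t
    cases t <;> simp [left, isLeaf]
  rw [this]
  exact ((IsCylinder.measurableSet hS).inter measurableSet_isLeaf).union (.iUnion fun s' =>
    measurableSet_node_image .univ hS (isCylinder_skeleton s'))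

theorem measurable_right : Measurable (right : PlaneTree α → PlaneTree α) := by
  refine measurable_generateFrom ?_
  intro S hS
  have : right ⁻¹' S = (S ∩ {t | t.isLeaf}) ∪
      ⋃ s' : PlaneTree Unit, {t : PlaneTree α | ∃ a ∈ Set.univ,
        ∃ l ∈ {t : PlaneTree α | t.skeleton = s'}, ∃ r ∈ S, t = node a l r} := by
    ext t
    cases t <;> simp [right, isLeaf]
  rw [this]
  exact ((IsCylinder.measurableSet hS).inter measurableSet_isLeaf).union (.iUnion fun s' =>
    measurableSet_node_image .univ (isCylinder_skeleton s') hS)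

/-- The constructors have measurable inverses `label`, `left` and `right`, so the two cases can be
glued along `isLeaf`. -/
theorem measurable_of_leaf_of_node {Y : Type*} [MeasurableSpace Y] {f : PlaneTree α → Y}
    (h1 : Measurable fun a => f (leaf a))
    (h2 : Measurable fun x : α × PlaneTree α × PlaneTree α => f (node x.1 x.2.1 x.2.2)) :
    Measurable f := by
  classical
  have : f = fun t => if t.isLeaf then f (leaf t.label) else
      f (node t.label t.left t.right) := by
    funext t
    cases t <;> simp [isLeaf, label, left, right]
  rw [this]
  exact Measurable.ite measurableSet_isLeaf (h1.comp measurable_label)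
    (h2.comp (measurable_label.prodMk (measurable_left.prodMk measurable_right)))

/-- Measurability of functions that are defined by recursion: on the trees with given planar
shapes of the two subtrees, the values at a node are obtained from those at the subtrees. -/
theorem measurable_of_rec {ι Y : Type*} [MeasurableSpace Y] [Nonempty Y]
    (f : ι → PlaneTree α → Y) (h1 : ∀ q, Measurable fun a => f q (leaf a))
    (h2 : ∀ q s s', ∃ q' q'', ∃ g : α × (PlaneTree α × Y) × (PlaneTree α × Y) → Y, Measurable g ∧
      ∀ a l r, l.skeleton = s → r.skeleton = s' →
        f q (node a l r) = g (a, (l, f q' l), (r, f q'' r))) (q : ι) : Measurable (f q) := by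
  classical
  obtain ⟨y⟩ := ‹Nonempty Y›
  -- Replacing the function by a constant off the shape `s` allows an induction on `s` with the
  -- parameter `q` free; the countably many shapes are glued afterwards.
  have key : ∀ s q, Measurable fun t => if t.skeleton = s then f q t else y := by
    intro s
    induction s with
    | leaf u =>
      intro q
      refine measurable_of_leaf_of_node ?_ ?_
      · simpa [skeleton, map] using h1 q
      · simp [skeleton, map]
    | node u s s' hs hs' =>
      intro q
      refine measurable_of_leaf_of_node (by simp [skeleton, map]) ?_
      obtain ⟨q', q'', g, hg, h⟩ := h2 q s s'
      have : (fun x : α × PlaneTree α × PlaneTree α =>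
          if (node x.1 x.2.1 x.2.2).skeleton = node u s s' then f q (node x.1 x.2.1 x.2.2) else y) =
          fun x => if x.2.1.skeleton = s ∧ x.2.2.skeleton = s' then
            g (x.1, (x.2.1, if x.2.1.skeleton = s then f q' x.2.1 else y),
              (x.2.2, if x.2.2.skeleton = s' then f q'' x.2.2 else y)) else y := by
        funext x
        have : (node x.1 x.2.1 x.2.2).skeleton = node u s s' ↔
            x.2.1.skeleton = s ∧ x.2.2.skeleton = s' := by
          simp [skeleton, map]
        by_cases hx : x.2.1.skeleton = s ∧ x.2.2.skeleton = s'
        · rw [if_pos (this.2 hx), if_pos hx, if_pos hx.1, if_pos hx.2]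
          exact h _ _ _ hx.1 hx.2
        · rw [if_neg (mt this.1 hx), if_neg hx]
      rw [this]
      refine Measurable.ite ?_ ?_ measurable_const
      · exact ((measurableSet_skeleton s).preimage (measurable_fst.comp measurable_snd)).inter
          ((measurableSet_skeleton s').preimage (measurable_snd.comp measurable_snd))
      · exact hg.comp (measurable_fst.prodMk
          (((measurable_fst.comp measurable_snd).prodMk
            ((hs q').comp (measurable_fst.comp measurable_snd))).prodMk
          ((measurable_snd.comp measurable_snd).prodMk
            ((hs' q'').comp (measurable_snd.comp measurable_snd)))))
  intro B hB
  have : f q ⁻¹' B = ⋃ s : PlaneTree Unit, {t : PlaneTree α | t.skeleton = s} ∩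
      (fun t => if t.skeleton = s then f q t else y) ⁻¹' B := by
    ext t
    simp
  rw [this]
  exact .iUnion fun s => (measurableSet_skeleton s).inter (key s q hB)

instance : MeasurableSingletonClass (PlaneTree Unit) := ⟨fun s => by
  convert measurableSet_skeleton (α := Unit) s using 1
  ext t
  have : t.skeleton = t := by
    clear s
    induction t with
    | leaf a => rfl
    | node a l r hl hr => simp only [skeleton, map] at *; rw [hl, hr]
  simp [this]⟩

theorem measurable_skeleton : Measurable (skeleton : PlaneTree α → PlaneTree Unit) :=
  measurable_to_countable' fun s => measurableSet_skeleton s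

theorem measurable_order : Measurable (order : PlaneTree α → ℕ) := by
  have : (order : PlaneTree α → ℕ) = order ∘ skeleton := by
    funext t
    exact (order_skeleton t).symm
  rw [this]
  exact (measurable_of_countable _).comp measurable_skeleton

/-- The extra parameter is needed for relative lengths, where the relabelling divides by the total
length and so varies with the tree. -/
theorem measurable_map_prod {γ : Type*} [MeasurableSpace β] [MeasurableSpace γ] {f : α × γ → β}
    (hf : Measurable f) :
    Measurable fun x : PlaneTree α × γ => x.1.map fun a => f (a, x.2) := by
  have hl : Measurable fun x : PlaneTree α × γ => f (x.1.label, x.2) :=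
    hf.comp ((measurable_label.comp measurable_fst).prodMk measurable_snd)
  have h1 : MeasurableSet {x : PlaneTree α × γ | x.1.isLeaf} :=
    measurableSet_isLeaf.preimage measurable_fst
  refine measurable_generateFrom fun S hS => ?_
  induction hS with
  | leaf A hA =>
    convert h1.inter (hl hA) using 1
    ext ⟨t, c⟩
    cases t <;> simp [map, isLeaf, label]
  | node A L R hA _ _ hL hR =>
    convert h1.compl.inter ((hl hA).inter
      ((hL.preimage ((measurable_left.comp measurable_fst).prodMk measurable_snd)).inter
      (hR.preimage ((measurable_right.comp measurable_fst).prodMk measurable_snd)))) using 1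
    ext ⟨t, c⟩
    cases t <;> simp [map, isLeaf, label, left, right]

theorem measurable_map [MeasurableSpace β] {f : α → β} (hf : Measurable f) :
    Measurable (map f : PlaneTree α → PlaneTree β) :=
  (measurable_map_prod (hf.comp measurable_fst)).comp (measurable_id.prodMk
    (measurable_const (a := ())))

theorem measurable_length [Nonempty α] [Add α] [MeasurableAdd₂ α] :
    Measurable (length : PlaneTree α → α) := by
  refine measurable_of_rec (ι := Unit) (fun _ => length) (fun _ => measurable_id)
      (fun _ s s' => ⟨(), (), fun x => x.1 + (x.2.1.2 + x.2.2.2), ?_, fun a l r _ _ => rfl⟩) ()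
  fun_prop

theorem measurable_addRoot [Add α] [MeasurableAdd₂ α] :
    Measurable fun x : α × PlaneTree α => x.2.addRoot x.1 := by
  classical
  have : (fun x : α × PlaneTree α => x.2.addRoot x.1) =
      fun x => (if x.2.isLeaf then leaf (x.1 + x.2.label) else
        node (x.1 + x.2.label) x.2.left x.2.right : PlaneTree α) := by
    funext ⟨a, t⟩
    cases t <;> simp [isLeaf, label, left, right, addRoot]
  rw [this]
  have h : Measurable fun x : α × PlaneTree α => x.1 + x.2.label :=
    measurable_fst.add (measurable_label.comp measurable_snd)
  exact Measurable.ite (measurableSet_isLeaf.preimage measurable_snd) (measurable_leaf.comp h)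
    (measurable_node.comp (h.prodMk ((measurable_left.comp measurable_snd).prodMk
      (measurable_right.comp measurable_snd))))

end PlaneTree

namespace PlaneTree

variable {α β : Type}

/-! ## Pruning, complete subtrees and their measurability -/

/-- The number of edges. -/
def size : PlaneTree α → ℕ
  | leaf _ => 1
  | node _ l r => 1 + size l + size r

/-- The pruned tree, with the tree itself as the value for trees of order one. -/
def pruned [Add α] (t : PlaneTree α) : PlaneTree α := t.prune.getD t

theorem prune_eq_none [Add α] {t : PlaneTree α} (h : t.order = 1) : t.prune = none := by
  have h1 := t.order_prune
  revert h1
  cases t.prune with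
  | none => intro; rfl
  | some s =>
    intro h1
    have := s.order_pos
    simp only [Option.elim] at h1
    omega

theorem prune_eq_some [Add α] {t : PlaneTree α} (h : 2 ≤ t.order) : t.prune = some t.pruned := by
  have h1 := t.order_prune
  unfold pruned
  revert h1
  cases t.prune with
  | none => intro h1; simp only [Option.elim] at h1; omega
  | some s => intro; rfl

section pruned

variable [Add α] (a : α) {l r : PlaneTree α}

theorem pruned_node_one_one (hl : l.order = 1) (hr : r.order = 1) :
    (node a l r).pruned = leaf a := by
  simp [pruned, prune, prune_eq_none hl, prune_eq_none hr]

theorem pruned_node_left (hl : 2 ≤ l.order) (hr : r.order = 1) :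
    (node a l r).pruned = l.pruned.addRoot a := by
  have h := prune_eq_some hl
  rw [pruned, prune, prune_eq_none hr, h]
  rfl

theorem pruned_node_right (hl : l.order = 1) (hr : 2 ≤ r.order) :
    (node a l r).pruned = r.pruned.addRoot a := by
  have h := prune_eq_some hr
  rw [pruned, prune, prune_eq_none hl, h]
  rfl

theorem pruned_node (hl : 2 ≤ l.order) (hr : 2 ≤ r.order) :
    (node a l r).pruned = node a l.pruned r.pruned := by
  have h := prune_eq_some hl
  have h' := prune_eq_some hr
  rw [pruned, prune, h, h']
  rfl

end pruned

theorem order_le_left (a : α) (l r : PlaneTree α) : l.order ≤ (node a l r).order := by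
  simp only [order]
  split_ifs <;> omega

theorem order_le_right (a : α) (l r : PlaneTree α) : r.order ≤ (node a l r).order := by
  simp only [order]
  split_ifs <;> omega

theorem completeSubtrees_leaf_pos {K q : ℕ} (h : 1 = K ∧ q ≠ K) (a : α) :
    (leaf a).completeSubtrees K q = {leaf a} := if_pos h

theorem completeSubtrees_leaf_neg {K q : ℕ} (h : ¬(1 = K ∧ q ≠ K)) (a : α) :
    (leaf a).completeSubtrees K q = 0 := if_neg h

theorem completeSubtrees_of_lt {K : ℕ} {t : PlaneTree α} (h : t.order < K) (q : ℕ) :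
    t.completeSubtrees K q = 0 := by
  induction t generalizing q with
  | leaf a => simp [completeSubtrees, h.ne]
  | node a l r hl hr =>
    simp [completeSubtrees, h.ne, hl ((order_le_left a l r).trans_lt h),
      hr ((order_le_right a l r).trans_lt h)]

/-- Every vertex of order `K` in such a tree only continues the branch of the parent, so none of
them starts a new branch. -/
theorem completeSubtrees_of_le {K : ℕ} {t : PlaneTree α} (h : t.order ≤ K) :
    t.completeSubtrees K K = 0 := by
  induction t with
  | leaf a => simp [completeSubtrees]
  | node a l r hl hr =>
    rcases h.lt_or_eq with h | h
    · exact completeSubtrees_of_lt h K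
    · simp [completeSubtrees, h, hl (h ▸ order_le_left a l r), hr (h ▸ order_le_right a l r)]

theorem completeSubtrees_of_eq {K q : ℕ} {t : PlaneTree α} (h : t.order = K) (hq : q ≠ K) :
    t.completeSubtrees K q = {t} := by
  cases t with
  | leaf a => simp [completeSubtrees, h, hq]
  | node a l r =>
    simp [completeSubtrees, h, hq, completeSubtrees_of_le (h ▸ order_le_left a l r),
      completeSubtrees_of_le (h ▸ order_le_right a l r)]

/-- The order of the parent enters only at the outermost vertex, and only through whether it equals
`K`. -/
theorem completeSubtrees_congr {K q q' : ℕ} (hq : q ≠ K) (hq' : q' ≠ K) (t : PlaneTree α) :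
    t.completeSubtrees K q = t.completeSubtrees K q' := by
  cases t <;> simp [completeSubtrees, hq, hq']

/-- This additivity is what turns branch counts into solutions of the first-event equations. -/
theorem completeSubtrees_node {K : ℕ} (hK : 1 ≤ K) {a : α} {l r : PlaneTree α}
    (h : (node a l r).order ≠ K) :
    (node a l r).completeSubtrees K 0 = l.completeSubtrees K 0 + r.completeSubtrees K 0 := by
  simp only [completeSubtrees, h, false_and, if_false, zero_add]
  rw [completeSubtrees_congr h (by omega : 0 ≠ K) l, completeSubtrees_congr h (by omega : 0 ≠ K) r]

theorem card_completeSubtrees_pos {K : ℕ} (hK : 1 ≤ K) {t : PlaneTree α} (h : K ≤ t.order) :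
    0 < Multiset.card (t.completeSubtrees K 0) := by
  induction t with
  | leaf a =>
    rw [completeSubtrees_of_eq (t := leaf a) (le_antisymm hK h) (by omega)]
    simp
  | node a l r hl hr =>
    by_cases h1 : (node a l r).order = K
    · rw [completeSubtrees_of_eq h1 (by omega)]
      simp
    · rw [completeSubtrees_node hK h1, Multiset.card_add]
      by_cases h2 : K ≤ l.order
      · have := hl h2
        omega
      · have : K ≤ r.order := by
          simp only [order] at h h1
          split_ifs at h h1 <;> omega
        have := hr this
        omega

/-- The number of edges dominates every count used below, so its finite mean makes all the
expectations finite. -/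
theorem card_completeSubtrees_le_size (K q : ℕ) (t : PlaneTree α) :
    Multiset.card (t.completeSubtrees K q) ≤ t.size := by
  induction t generalizing q with
  | leaf a => simp only [completeSubtrees, size]; split_ifs <;> simp
  | node a l r hl hr =>
    simp only [completeSubtrees, size, Multiset.card_add]
    have := hl (node a l r).order
    have := hr (node a l r).order
    split_ifs <;> simp <;> omega

theorem sideBranchCount_le_size (i j : ℕ) (t : PlaneTree α) : t.sideBranchCount i j ≤ t.size := by
  induction t with
  | leaf a => simp [sideBranchCount, size]
  | node a l r hl hr =>
    simp only [sideBranchCount, size]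
    split_ifs <;> omega

theorem sideBranchCount_of_lt {i j : ℕ} {t : PlaneTree α} (h : t.order < j) :
    t.sideBranchCount i j = 0 := by
  induction t with
  | leaf a => rfl
  | node a l r hl hr =>
    have h1 := order_le_left a l r
    have h2 := order_le_right a l r
    rw [sideBranchCount, hl (by omega), hr (by omega), if_neg (by omega)]

theorem length_map [Add α] [Add β] (f : α → β) (hf : ∀ a b, f (a + b) = f a + f b)
    (t : PlaneTree α) : (t.map f).length = f t.length := by
  induction t with
  | leaf a => rfl
  | node a l r hl hr => simp only [map, length, hf, hl, hr]

theorem map_map {γ : Type} (f : α → β) (g : β → γ) (t : PlaneTree α) :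
    (t.map f).map g = t.map (g ∘ f) := by
  induction t with
  | leaf a => rfl
  | node a l r hl hr => simp only [map, hl, hr, Function.comp]

variable [MeasurableSpace α]

theorem measurable_size : Measurable (size : PlaneTree α → ℕ) := by
  refine measurable_of_rec (ι := Unit) (fun _ => size) (fun _ => measurable_const)
      (fun _ s s' => ⟨(), (), fun x => 1 + x.2.1.2 + x.2.2.2, ?_, fun a l r _ _ => rfl⟩) ()
  fun_prop

theorem measurable_sideBranchCount (i j : ℕ) :
    Measurable (sideBranchCount i j : PlaneTree α → ℕ) := by
  refine measurable_of_rec (ι := Unit) (fun _ => sideBranchCount i j) (fun _ => measurable_const)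
      (fun _ s s' => ⟨(), (), fun x => (if (s.order = i ∧ s'.order = j) ∨
        (s.order = j ∧ s'.order = i) then 1 else 0) + x.2.1.2 + x.2.2.2, ?_, ?_⟩) ()
  · fun_prop
  · rintro a l r rfl rfl
    simp only [order_skeleton]
    rfl

/-- The multiset of subtrees is tested against functions, which avoids a σ-algebra on multisets. The
recursion changes `q` to the order of the current vertex, and that order depends only on the shape.
-/
theorem measurable_sum_completeSubtrees {g : PlaneTree α → ℝ≥0∞} (hg : Measurable g) (K q : ℕ) :
    Measurable fun t : PlaneTree α => ((t.completeSubtrees K q).map g).sum := by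
  refine measurable_of_rec (fun q (t : PlaneTree α) => ((t.completeSubtrees K q).map g).sum) ?_ ?_ q
  · intro q
    by_cases h : 1 = K ∧ q ≠ K
    · simp only [completeSubtrees_leaf_pos h, Multiset.map_singleton, Multiset.sum_singleton]
      exact hg.comp measurable_leaf
    · simp only [completeSubtrees_leaf_neg h, Multiset.map_zero, Multiset.sum_zero]
      exact measurable_const
  · intro q s s'
    refine ⟨(node () s s').order, (node () s s').order, fun x =>
      (if (node () s s').order = K ∧ q ≠ K then g (node x.1 x.2.1.1 x.2.2.1) else 0)
        + x.2.1.2 + x.2.2.2, ?_, ?_⟩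
    · have hn : Measurable fun x : α × (PlaneTree α × ℝ≥0∞) × (PlaneTree α × ℝ≥0∞) =>
          node x.1 x.2.1.1 x.2.2.1 := measurable_node.comp (measurable_fst.prodMk
        ((measurable_fst.comp (measurable_fst.comp measurable_snd)).prodMk
        (measurable_fst.comp (measurable_snd.comp measurable_snd))))
      have hn' := hg.comp hn
      split_ifs
      · exact (hn'.add (by fun_prop)).add (by fun_prop)
      · fun_prop
    · rintro a l r rfl rfl
      have : (node () l.skeleton r.skeleton).order = (node a l r).order := by
        simp only [order, order_skeleton]
      rw [this]
      simp only [completeSubtrees, Multiset.map_add, Multiset.sum_add]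
      split_ifs <;> simp

theorem measurable_card_completeSubtrees (K q : ℕ) :
    Measurable fun t : PlaneTree α => Multiset.card (t.completeSubtrees K q) := by
  refine measurable_of_rec (fun q (t : PlaneTree α) => Multiset.card (t.completeSubtrees K q))
    ?_ ?_ q
  · intro q
    by_cases h : 1 = K ∧ q ≠ K
    · simp only [completeSubtrees_leaf_pos h, Multiset.card_singleton]
      exact measurable_const
    · simp only [completeSubtrees_leaf_neg h, Multiset.card_zero]
      exact measurable_const
  · intro q s s'
    refine ⟨(node () s s').order, (node () s s').order, fun x =>
      (if (node () s s').order = K ∧ q ≠ K then 1 else 0) + x.2.1.2 + x.2.2.2, ?_, ?_⟩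
    · fun_prop
    · rintro a l r rfl rfl
      have : (node () l.skeleton r.skeleton).order = (node a l r).order := by
        simp only [order, order_skeleton]
      rw [this]
      simp only [completeSubtrees, Multiset.card_add]
      split_ifs <;> simp

theorem measurable_pruned [Add α] [MeasurableAdd₂ α] :
    Measurable (pruned : PlaneTree α → PlaneTree α) := by
  -- `measurable_of_rec` needs a nonempty target. In the main case, which of the four pruning rules
  -- applies is decided by the shapes of the two subtrees.
  cases isEmpty_or_nonempty (PlaneTree α) with
  | inl h => exact measurable_of_empty _
  | inr h =>
  refine measurable_of_rec (ι := Unit) (fun _ => pruned) (fun _ => measurable_leaf)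
      (fun _ s s' => ⟨(), (), ?_⟩) ()
  have m1 : Measurable fun x : α × (PlaneTree α × PlaneTree α) × (PlaneTree α × PlaneTree α) =>
    x.2.1.2 := by fun_prop
  have m2 : Measurable fun x : α × (PlaneTree α × PlaneTree α) × (PlaneTree α × PlaneTree α) =>
    x.2.2.2 := by fun_prop
  have hs := s.order_pos
  have hs' := s'.order_pos
  rcases hs.lt_or_eq with h | h <;> rcases hs'.lt_or_eq with h' | h'
  · refine ⟨fun x => node x.1 x.2.1.2 x.2.2.2, measurable_node.comp
      (measurable_fst.prodMk (m1.prodMk m2)), ?_⟩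
    rintro a l r rfl rfl
    rw [order_skeleton] at h h'
    exact pruned_node a h h'
  · refine ⟨fun x => x.2.1.2.addRoot x.1, measurable_addRoot.comp (measurable_fst.prodMk m1), ?_⟩
    rintro a l r rfl rfl
    rw [order_skeleton] at h h'
    exact pruned_node_left a h h'.symm
  · refine ⟨fun x => x.2.2.2.addRoot x.1, measurable_addRoot.comp (measurable_fst.prodMk m2), ?_⟩
    rintro a l r rfl rfl
    rw [order_skeleton] at h h'
    exact pruned_node_right a h.symm h'
  · refine ⟨fun x => leaf x.1, measurable_leaf.comp measurable_fst, ?_⟩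
    rintro a l r rfl rfl
    rw [order_skeleton] at h h'
    exact pruned_node_one_one a h.symm h'.symm

end PlaneTree

/-! ## Measurability on trees without embedding -/

namespace BinTree

variable {α β : Type}

theorem ofPlane_ne_empty (t : PlaneTree α) : ofPlane t ≠ empty := by
  intro h
  cases h

theorem ofPlane_surjective {t : BinTree α} (h : t ≠ empty) : ∃ s, ofPlane s = t := by
  rcases t with _ | u
  · exact absurd rfl h
  · obtain ⟨s, rfl⟩ := Quotient.exists_rep u
    exact ⟨s, rfl⟩

theorem prune_ofPlane [Add α] (t : PlaneTree α) :
    (ofPlane t).prune = t.prune.elim empty ofPlane := rfl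

theorem prune_ofPlane_of_one [Add α] {t : PlaneTree α} (h : t.order = 1) :
    (ofPlane t).prune = empty := by
  rw [prune_ofPlane, PlaneTree.prune_eq_none h]
  rfl

theorem prune_ofPlane_of_two_le [Add α] {t : PlaneTree α} (h : 2 ≤ t.order) :
    (ofPlane t).prune = ofPlane t.pruned := by
  rw [prune_ofPlane, PlaneTree.prune_eq_some h]
  rfl

theorem completeSubtrees_ofPlane (K : ℕ) (t : PlaneTree α) :
    (ofPlane t).completeSubtrees K = (t.completeSubtrees K 0).map ofPlane := by
  change ((t.completeSubtrees K 0).map _).map some = _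
  rw [Multiset.map_map]
  rfl

theorem order_shape (t : BinTree α) : t.shape.order = t.order := by
  by_cases h : t = empty
  · subst h
    rfl
  · obtain ⟨s, rfl⟩ := ofPlane_surjective h
    exact PlaneTree.order_map _ s

variable [MeasurableSpace α] [MeasurableSpace β]

theorem measurable_ofPlane : Measurable (ofPlane : PlaneTree α → BinTree α) := fun _ h => h

theorem measurable_of_ofPlane {Y : Type*} [MeasurableSpace Y] {f : BinTree α → Y}
    (h : Measurable fun t => f (ofPlane t)) : Measurable f := fun _ hB => h hB

theorem measurable_map {f : α → β} (hf : Measurable f) :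
    Measurable (map f : BinTree α → BinTree β) :=
  measurable_of_ofPlane (measurable_ofPlane.comp (PlaneTree.measurable_map hf))

theorem measurable_shape : Measurable (shape : BinTree α → Shape) :=
  measurable_map measurable_const

theorem measurable_order : Measurable (order : BinTree α → ℕ) :=
  measurable_of_ofPlane PlaneTree.measurable_order

instance : DiscreteMeasurableSpace Shape := ⟨fun S => by
  have : MeasurableSet (ofPlane ⁻¹' S : Set (PlaneTree Unit)) := .of_discrete
  exact this⟩

instance : Countable Shape := by
  have : Function.Surjective
      (fun o : Option (PlaneTree Unit) => (o.elim empty ofPlane : Shape)) := by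
    intro t
    by_cases h : t = empty
    · exact ⟨none, h.symm⟩
    · obtain ⟨s, hs⟩ := ofPlane_surjective h
      exact ⟨some s, hs⟩
  exact this.countable

theorem measurableSet_ordEq (K : ℕ) : MeasurableSet (ordEq α K) :=
  measurable_order (measurableSet_singleton K)

theorem measurableSet_empty : MeasurableSet {(empty : BinTree α)} := by
  have : MeasurableSet (ofPlane ⁻¹' {(empty : BinTree α)}) := by
    convert MeasurableSet.empty
    ext t
    exact ⟨fun h => (ofPlane_ne_empty t h).elim, fun h => h.elim⟩
  exact this

theorem measurable_prune [Add α] [MeasurableAdd₂ α] :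
    Measurable (prune : BinTree α → BinTree α) := by
  classical
  refine measurable_of_ofPlane ?_
  have : (fun t : PlaneTree α => (ofPlane t).prune) =
      fun t => if t.order = 1 then empty else ofPlane t.pruned := by
    funext t
    have := t.order_pos
    split_ifs with h
    · exact prune_ofPlane_of_one h
    · exact prune_ofPlane_of_two_le (by omega)
  rw [this]
  exact Measurable.ite (PlaneTree.measurable_order (measurableSet_singleton 1)) measurable_const
    (measurable_ofPlane.comp PlaneTree.measurable_pruned)

theorem uniformOn_apply {X : Type} [MeasurableSpace X] (s : Multiset X) {B : Set X}
    (hB : MeasurableSet B) :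
    uniformOn s B = (Multiset.card s : ℝ≥0∞)⁻¹ * (s.map (B.indicator 1)).sum := by
  unfold uniformOn
  rw [Measure.smul_apply, smul_eq_mul]
  congr 1
  induction s using Multiset.induction with
  | empty => simp
  | cons a s ih => simp [ih, Measure.dirac_apply' _ hB]

/-- This makes the uniform choice of a subtree a measurable family of measures, so that the `bind`
in `subtreeLaw` can be evaluated. -/
theorem measurable_uniformOn_completeSubtrees (K : ℕ) :
    Measurable fun t : BinTree α => uniformOn (t.completeSubtrees K) := by
  refine measurable_of_ofPlane (Measure.measurable_of_measurable_coe _ fun B hB => ?_)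
  simp only [uniformOn_apply _ hB, completeSubtrees_ofPlane, Multiset.map_map, Multiset.card_map]
  refine Measurable.mul ?_ (PlaneTree.measurable_sum_completeSubtrees
    ((measurable_one.indicator hB).comp measurable_ofPlane) K 0)
  exact ((measurable_of_countable _).comp (PlaneTree.measurable_card_completeSubtrees K 0)).inv

end BinTree

instance : MeasurableAdd₂ EdgeLength :=
  ⟨((measurable_subtype_coe.comp measurable_fst).add
    (measurable_subtype_coe.comp measurable_snd)).subtype_mk⟩

instance : Nonempty EdgeLength := ⟨⟨1, one_pos⟩⟩

theorem LTree.measurable_length : Measurable LTree.length :=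
  BinTree.measurable_of_ofPlane (measurable_subtype_coe.comp PlaneTree.measurable_length)

theorem measurable_edgeLength_mul_inv :
    Measurable fun x : EdgeLength × EdgeLength => x.1 * x.2⁻¹ := by
  refine Measurable.subtype_mk (f := fun x : EdgeLength × EdgeLength => (x.1 : ℝ) * (x.2 : ℝ)⁻¹) ?_
  fun_prop

theorem LTree.measurable_relative : Measurable LTree.relative := by
  refine BinTree.measurable_of_ofPlane (BinTree.measurable_ofPlane.comp ?_)
  exact (PlaneTree.measurable_map_prod measurable_edgeLength_mul_inv).comp
    (measurable_id.prodMk PlaneTree.measurable_length)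

/-! ## Affine equations with a contraction -/

/-- Finiteness cannot be dropped: `∞` also solves the equation as soon as `θ ≠ 0`. -/
theorem eq_of_affine {x y c θ : ℝ≥0∞} (hθ : θ < 1) (hx : x ≠ ∞) (hy : y ≠ ∞)
    (h : x = c + θ * x) (h' : y = c + θ * y) : x = y := by
  have hc : c ≠ ∞ := ne_top_of_le_ne_top hx (h ▸ le_self_add)
  lift x to NNReal using hx
  lift y to NNReal using hy
  lift c to NNReal using hc
  lift θ to NNReal using (hθ.trans ENNReal.one_lt_top).ne
  norm_cast at *
  apply NNReal.eq
  replace h := congrArg NNReal.toReal h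
  replace h' := congrArg NNReal.toReal h'
  have hθ' : (θ : ℝ) < 1 := by exact_mod_cast hθ
  push_cast at h h'
  have : (1 - (θ : ℝ)) * ((x : ℝ) - y) = 0 := by linear_combination h - h'
  rcases mul_eq_zero.1 this with h0 | h0 <;> linarith

/-- The bound does not involve `x`, so it survives the removal of a truncation introduced to make
`x` finite. -/
theorem le_div_of_le_affine {x c θ : ℝ≥0∞} (hθ : θ < 1) (hx : x ≠ ∞) (h : x ≤ c + θ * x) :
    x ≤ c / (1 - θ) := by
  have h1 : 1 - θ ≠ 0 := (tsub_pos_of_lt hθ).ne'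
  rw [ENNReal.le_div_iff_mul_le (.inl h1) (.inl (ENNReal.sub_ne_top ENNReal.one_ne_top)),
    ENNReal.mul_sub (fun _ _ => hx), mul_one, mul_comm x θ]
  exact tsub_le_iff_right.2 h

theorem eq_zero_of_le_mul {x θ : ℝ≥0∞} (hθ : θ < 1) (hx : x ≠ ∞) (h : x ≤ θ * x) : x = 0 := by
  have := le_div_of_le_affine (c := 0) hθ hx (by simpa using h)
  simpa using this

/-- Uniqueness of the finite solutions of `ρ = c + L ρ` for an additive contraction `L`. -/
theorem measure_eq_of_affine {X : Type*} [MeasurableSpace X] {L : Measure X → Measure X}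
    {θ : ℝ≥0∞} (hθ : θ < 1)
    (hadd : ∀ μ ν : Measure X, IsFiniteMeasure μ → IsFiniteMeasure ν → L (μ + ν) = L μ + L ν)
    (hmass : ∀ μ : Measure X, IsFiniteMeasure μ → L μ Set.univ ≤ θ * μ Set.univ)
    {c ρ σ : Measure X} (hρ : IsFiniteMeasure ρ) (hσ : IsFiniteMeasure σ)
    (h : ρ = c + L ρ) (h' : σ = c + L σ) : ρ = σ := by
  -- Substituting the equation into itself `n` times leaves a common part `a` and remainders of mass
  -- at most `θ ^ n` times the original mass.
  have key : ∀ n : ℕ, ∃ a e f : Measure X, ρ = a + e ∧ σ = a + f ∧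
      e Set.univ ≤ θ ^ n * ρ Set.univ ∧ f Set.univ ≤ θ ^ n * σ Set.univ := by
    intro n
    induction n with
    | zero => exact ⟨0, ρ, σ, by simp, by simp, by simp, by simp⟩
    | succ n ih =>
      obtain ⟨a, e, f, he, hf, he', hf'⟩ := ih
      have fa : IsFiniteMeasure a := isFiniteMeasure_of_le ρ (he ▸ Measure.le_add_right le_rfl)
      have fe : IsFiniteMeasure e := isFiniteMeasure_of_le ρ (he ▸ Measure.le_add_left le_rfl)
      have ff : IsFiniteMeasure f := isFiniteMeasure_of_le σ (hf ▸ Measure.le_add_left le_rfl)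
      refine ⟨c + L a, L e, L f, ?_, ?_, ?_, ?_⟩
      · conv_lhs => rw [h, he, hadd _ _ fa fe]
        rw [add_assoc]
      · conv_lhs => rw [h', hf, hadd _ _ fa ff]
        rw [add_assoc]
      · rw [pow_succ', mul_assoc]
        exact (hmass e fe).trans (by gcongr)
      · rw [pow_succ', mul_assoc]
        exact (hmass f ff).trans (by gcongr)
  have lim : ∀ C : ℝ≥0∞, C ≠ ∞ → Filter.Tendsto (fun n : ℕ => θ ^ n * C) Filter.atTop (nhds 0) := by
    intro C hC
    have := ENNReal.Tendsto.mul_const (b := C) (ENNReal.tendsto_pow_atTop_nhds_zero_of_lt_one hθ)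
      (.inr hC)
    simpa using this
  have le : ∀ {ρ σ : Measure X}, IsFiniteMeasure ρ → (∀ n : ℕ, ∃ a e f : Measure X, ρ = a + e ∧
      σ = a + f ∧ e Set.univ ≤ θ ^ n * ρ Set.univ) → ρ ≤ σ := by
    intro ρ σ hρ key
    refine Measure.le_iff.2 fun S _ => ?_
    refine le_of_tendsto_of_tendsto' tendsto_const_nhds
      (((lim _ (measure_ne_top ρ Set.univ)).const_add (σ S)).trans (by rw [add_zero])) fun n => ?_
    obtain ⟨a, e, f, he, hf, he'⟩ := key n
    conv_lhs => rw [he]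
    rw [hf, Measure.add_apply, Measure.add_apply]
    exact add_le_add le_self_add ((measure_mono (Set.subset_univ S)).trans he')
  refine le_antisymm (le hρ fun n => ?_) (le hσ fun n => ?_)
  · obtain ⟨a, e, f, h1, h2, h3, h4⟩ := key n
    exact ⟨a, e, f, h1, h2, h3⟩
  · obtain ⟨a, e, f, h1, h2, h3, h4⟩ := key n
    exact ⟨a, f, e, h2, h1, h4⟩

/-! ## Families of branch laws -/

noncomputable section

/-- The total rate of events in a branch of order `j`, relative to its termination rate. -/
def relRate (T : ℕ → ℝ) (j : ℕ) : ℝ := 1 + ∑ i ∈ Finset.Ico 1 j, T (j - i)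

/-- The probability that an event in a branch of order `j` is its termination. -/
def termProb (T : ℕ → ℝ) (j : ℕ) : ℝ≥0∞ := ENNReal.ofReal (1 / relRate T j)

/-- The probability that an event in a branch of order `j` is the birth of a branch of
order `i`. -/
def sideProb (T : ℕ → ℝ) (i j : ℕ) : ℝ≥0∞ := ENNReal.ofReal (T (j - i) / relRate T j)

/-- The probability that an event in a branch of order `j` is the birth of a side-branch. -/
def sideTotal (T : ℕ → ℝ) (j : ℕ) : ℝ≥0∞ := ∑ i ∈ Finset.Ico 1 j, sideProb T i j

/-! ### Probabilities of the first event in a branch -/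

section prob

variable {T : ℕ → ℝ} (hT : ∀ k, 1 ≤ k → 0 ≤ T k)
include hT

theorem one_le_relRate (j : ℕ) : 1 ≤ relRate T j := by
  have : 0 ≤ ∑ i ∈ Finset.Ico 1 j, T (j - i) :=
    Finset.sum_nonneg fun i hi => hT _ (by have := Finset.mem_Ico.1 hi; omega)
  unfold relRate
  linarith

theorem relRate_pos (j : ℕ) : 0 < relRate T j := one_pos.trans_le (one_le_relRate hT j)

theorem termProb_ne_zero (j : ℕ) : termProb T j ≠ 0 :=
  (ENNReal.ofReal_pos.2 (one_div_pos.2 (relRate_pos hT j))).ne'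

theorem termProb_add_sideTotal (j : ℕ) : termProb T j + sideTotal T j = 1 := by
  have h := relRate_pos hT j
  unfold sideTotal termProb sideProb
  rw [← ENNReal.ofReal_sum_of_nonneg, ← ENNReal.ofReal_add, ← Finset.sum_div, ← add_div]
  · change ENNReal.ofReal (relRate T j / relRate T j) = 1
    rw [div_self h.ne', ENNReal.ofReal_one]
  · positivity
  · exact Finset.sum_nonneg fun i hi =>
      div_nonneg (hT _ (by have := Finset.mem_Ico.1 hi; omega)) h.le
  · exact fun i hi => div_nonneg (hT _ (by have := Finset.mem_Ico.1 hi; omega)) h.le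

/-- Termination is possible at every event, which makes the first-event equations contractive. -/
theorem sideTotal_lt_one (j : ℕ) : sideTotal T j < 1 := by
  have h := termProb_add_sideTotal hT j
  have h0 := termProb_ne_zero hT j
  have h1 : sideTotal T j ≤ 1 := h ▸ le_add_self
  refine lt_of_le_of_ne h1 fun h2 => h0 ?_
  rw [h2] at h
  exact (ENNReal.add_left_inj ENNReal.one_ne_top).1 (h.trans (zero_add 1).symm)

theorem sideProb_eq_mul {i j : ℕ} (hij : i < j) :
    sideProb T i j = ENNReal.ofReal (T (j - i)) * termProb T j := by
  unfold sideProb termProb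
  rw [← ENNReal.ofReal_mul (hT _ (by omega)), mul_one_div]

end prob

theorem termProb_ne_top (T : ℕ → ℝ) (j : ℕ) : termProb T j ≠ ∞ := ENNReal.ofReal_ne_top

theorem sideProb_ne_top (T : ℕ → ℝ) (i j : ℕ) : sideProb T i j ≠ ∞ := ENNReal.ofReal_ne_top

variable {α β : Type} [MeasurableSpace α] [MeasurableSpace β]

/-- Put a random edge below a random pair of trees. -/
def graft (e : Measure α) (m : Measure (PlaneTree α × PlaneTree α)) : Measure (PlaneTree α) :=
  (e.prod m).map fun x => PlaneTree.node x.1 x.2.1 x.2.2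

/-- The laws `ν j` of the trees that start with a branch of order `j`, where `w j` is the law of
the label of an edge of order `j`. -/
structure BranchFamily (T : ℕ → ℝ) (w : ℕ → Measure α) (ν : ℕ → Measure (PlaneTree α)) : Prop where
  nonneg : ∀ k, 1 ≤ k → 0 ≤ T k
  prob_wait : ∀ j, 1 ≤ j → IsProbabilityMeasure (w j)
  finite : ∀ j, IsFiniteMeasure (ν j)
  prob : ∀ j, 1 ≤ j → IsProbabilityMeasure (ν j)
  one : ν 1 = (w 1).map PlaneTree.leaf
  step : ∀ j, 2 ≤ j → ν j = termProb T j • graft (w j) ((ν (j - 1)).prod (ν (j - 1)))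
    + ∑ i ∈ Finset.Ico 1 j, sideProb T i j • graft (w j) ((ν j).prod (ν i))

theorem lintegral_graft {e : Measure α} {l r : Measure (PlaneTree α)} [SFinite l] [SFinite r]
    {F : PlaneTree α → ℝ≥0∞} (hF : Measurable F) :
    ∫⁻ t, F t ∂(graft e (l.prod r)) = ∫⁻ a, ∫⁻ s, ∫⁻ t, F (.node a s t) ∂r ∂l ∂e := by
  have h : Measurable fun x : α × PlaneTree α × PlaneTree α => F (.node x.1 x.2.1 x.2.2) :=
    hF.comp PlaneTree.measurable_node
  rw [graft, lintegral_map hF PlaneTree.measurable_node, lintegral_prod _ h.aemeasurable]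
  refine lintegral_congr fun a => ?_
  rw [lintegral_prod]
  exact (h.comp (measurable_const.prodMk measurable_id)).aemeasurable

theorem graft_univ (e : Measure α) (m : Measure (PlaneTree α × PlaneTree α)) [SFinite m] :
    graft e m Set.univ = e Set.univ * m Set.univ := by
  rw [graft, Measure.map_apply PlaneTree.measurable_node .univ, Set.preimage_univ,
    ← Set.univ_prod_univ, Measure.prod_prod]

namespace BranchFamily

variable {T : ℕ → ℝ} {w : ℕ → Measure α} {ν : ℕ → Measure (PlaneTree α)}
  (h : BranchFamily T w ν)
include h

theorem lintegral_eq {j : ℕ} (hj : 2 ≤ j) {F : PlaneTree α → ℝ≥0∞} (hF : Measurable F) :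
    ∫⁻ t, F t ∂(ν j) =
      termProb T j * ∫⁻ a, ∫⁻ l, ∫⁻ r, F (.node a l r) ∂(ν (j - 1)) ∂(ν (j - 1)) ∂(w j)
      + ∑ i ∈ Finset.Ico 1 j,
        sideProb T i j * ∫⁻ a, ∫⁻ l, ∫⁻ r, F (.node a l r) ∂(ν i) ∂(ν j) ∂(w j) := by
  have := h.finite
  conv_lhs => rw [h.step j hj, lintegral_add_measure, lintegral_smul_measure,
    lintegral_finsetSum_measure, lintegral_graft hF, smul_eq_mul]
  simp only [lintegral_smul_measure, lintegral_graft hF, smul_eq_mul]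

theorem lintegral_one {F : PlaneTree α → ℝ≥0∞} (hF : Measurable F) :
    ∫⁻ t, F t ∂(ν 1) = ∫⁻ a, F (.leaf a) ∂(w 1) := by
  rw [h.one, lintegral_map hF PlaneTree.measurable_leaf]

/-- If a function at a node is at most the sum of contributions of the two subtrees, so are the
integrals. -/
theorem lintegral_le {j : ℕ} (hj : 2 ≤ j) {F : PlaneTree α → ℝ≥0∞} (hF : Measurable F)
    {f f' : PlaneTree α → ℝ≥0∞} {g g' : ℕ → PlaneTree α → ℝ≥0∞} (hf : Measurable f)
    (hg : ∀ i, Measurable (g i))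
    (h1 : ∀ a l r, F (.node a l r) ≤ f l + f' r)
    (h2 : ∀ i ∈ Finset.Ico 1 j, ∀ a l r, F (.node a l r) ≤ g i l + g' i r) :
    ∫⁻ t, F t ∂(ν j) ≤ termProb T j * (∫⁻ t, f t ∂(ν (j - 1)) + ∫⁻ t, f' t ∂(ν (j - 1)))
      + ∑ i ∈ Finset.Ico 1 j, sideProb T i j * (∫⁻ t, g i t ∂(ν j) + ∫⁻ t, g' i t ∂(ν i)) := by
  have := h.prob_wait j (by omega)
  have := h.prob j (by omega)
  have := h.prob (j - 1) (by omega)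
  have key : ∀ (n m : Measure (PlaneTree α)) [IsProbabilityMeasure n] [IsProbabilityMeasure m]
      (f f' : PlaneTree α → ℝ≥0∞), Measurable f → (∀ a l r, F (.node a l r) ≤ f l + f' r) →
      ∫⁻ a, ∫⁻ l, ∫⁻ r, F (.node a l r) ∂m ∂n ∂(w j) ≤ ∫⁻ t, f t ∂n + ∫⁻ t, f' t ∂m := by
    intro n m _ _ f f' hf hle
    calc ∫⁻ a, ∫⁻ l, ∫⁻ r, F (.node a l r) ∂m ∂n ∂(w j)
        ≤ ∫⁻ a, ∫⁻ l, ∫⁻ r, (f l + f' r) ∂m ∂n ∂(w j) :=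
          lintegral_mono fun a => lintegral_mono fun l => lintegral_mono fun r => hle a l r
      _ = _ := by
          simp only [lintegral_add_left measurable_const, lintegral_const, measure_univ, mul_one]
          rw [lintegral_add_left hf, lintegral_const, measure_univ, mul_one]
  rw [h.lintegral_eq hj hF]
  refine add_le_add (mul_le_mul_right (key _ _ f f' hf h1) _) (Finset.sum_le_sum fun i hi => ?_)
  have := h.prob i (Finset.mem_Ico.1 hi).1
  exact mul_le_mul_right (key _ _ _ _ (hg i) (h2 i hi)) _

/-- The tree that starts with a branch of order `j` has order `j`. -/
theorem ae_order {j : ℕ} (hj : 1 ≤ j) : ∀ᵐ t ∂(ν j), t.order = j := by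
  have hm : ∀ j, MeasurableSet {t : PlaneTree α | t.order ≠ j} := fun j =>
    PlaneTree.measurable_order (measurableSet_singleton j).compl
  have hI : ∀ j, Measurable ({t : PlaneTree α | t.order ≠ j}.indicator (1 : PlaneTree α → ℝ≥0∞)) :=
    fun j => measurable_one.indicator (hm j)
  have hr : ∀ i j, ∫⁻ t, {t : PlaneTree α | t.order ≠ i}.indicator 1 t ∂(ν j)
      = ν j {t | t.order ≠ i} := fun i j => lintegral_indicator_one (hm i)
  induction j using Nat.strong_induction_on with
  | _ j ih =>
    rw [ae_iff, ← hr]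
    rcases hj.eq_or_lt with rfl | hj'
    · rw [h.lintegral_one (hI 1)]
      simp [PlaneTree.order]
    · have := h.prob j hj
      -- The lower orders are correct almost surely by induction. Hence a wrong order can only be
      -- inherited from the continuing branch on the left, and its probability `x` satisfies `x ≤
      -- sideTotal T j * x`.
      refine eq_zero_of_le_mul (sideTotal_lt_one h.nonneg j) ?_ ?_
      · rw [hr]
        exact measure_ne_top _ _
      · refine (h.lintegral_le hj' (hI j)
          (f := {t : PlaneTree α | t.order ≠ j - 1}.indicator 1)
          (f' := {t : PlaneTree α | t.order ≠ j - 1}.indicator 1)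
          (g := fun _ => {t : PlaneTree α | t.order ≠ j}.indicator 1)
          (g' := fun i => {t : PlaneTree α | t.order ≠ i}.indicator 1) (hI _) (fun _ => hI _)
          ?_ ?_).trans ?_
        · intro a l r
          by_cases h1 : l.order = j - 1 <;> by_cases h2 : r.order = j - 1 <;>
            simp [Set.indicator, PlaneTree.order, h1, h2]
          · omega
          · split_ifs <;> simp
          · split_ifs <;> simp
          · split_ifs <;> norm_num
        · intro i hi a l r
          have hi := (Finset.mem_Ico.1 hi).2
          by_cases h1 : l.order = j <;> by_cases h2 : r.order = i <;>
            simp [Set.indicator, PlaneTree.order, h1, h2]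
          · split_ifs <;> omega
          · split_ifs <;> simp
          · split_ifs <;> simp
          · split_ifs <;> norm_num
        · have e1 : ν (j - 1) {t | t.order ≠ j - 1} = 0 := by
            simpa [ae_iff] using ih (j - 1) (by omega) (by omega)
          rw [hr, hr, e1, add_zero, mul_zero, zero_add, sideTotal, Finset.sum_mul]
          refine Finset.sum_le_sum fun i hi => ?_
          have hi := Finset.mem_Ico.1 hi
          have e2 : ν i {t | t.order ≠ i} = 0 := by
            simpa [ae_iff] using ih i hi.2 hi.1
          rw [hr, e2, add_zero]

/-- The form of the first-event equation for combinatorial functionals: the orders of the subtrees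
may be taken as known, and the label of the root edge integrates out. -/
theorem lintegral_step {j : ℕ} (hj : 2 ≤ j) {F : PlaneTree α → ℝ≥0∞} (hF : Measurable F)
    {G : PlaneTree α → PlaneTree α → ℝ≥0∞} {G' : ℕ → PlaneTree α → PlaneTree α → ℝ≥0∞}
    (h1 : ∀ a l r, l.order = j - 1 → r.order = j - 1 → F (.node a l r) = G l r)
    (h2 : ∀ i ∈ Finset.Ico 1 j, ∀ a l r, l.order = j → r.order = i →
      F (.node a l r) = G' i l r) :
    ∫⁻ t, F t ∂(ν j) = termProb T j * ∫⁻ l, ∫⁻ r, G l r ∂(ν (j - 1)) ∂(ν (j - 1))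
      + ∑ i ∈ Finset.Ico 1 j, sideProb T i j * ∫⁻ l, ∫⁻ r, G' i l r ∂(ν i) ∂(ν j) := by
  have := h.prob_wait j (by omega)
  rw [h.lintegral_eq hj hF]
  have key : ∀ (p q : ℕ) (_ : 1 ≤ p) (_ : 1 ≤ q) (G : PlaneTree α → PlaneTree α → ℝ≥0∞),
      (∀ a l r, l.order = p → r.order = q → F (.node a l r) = G l r) →
      ∫⁻ a, ∫⁻ l, ∫⁻ r, F (.node a l r) ∂(ν q) ∂(ν p) ∂(w j) =
      ∫⁻ l, ∫⁻ r, G l r ∂(ν q) ∂(ν p) := by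
    intro p q hp hq G hG
    have : ∀ a, ∫⁻ l, ∫⁻ r, F (.node a l r) ∂(ν q) ∂(ν p) = ∫⁻ l, ∫⁻ r, G l r ∂(ν q) ∂(ν p) :=
      fun a => lintegral_congr_ae ((h.ae_order hp).mono fun l hl =>
        lintegral_congr_ae ((h.ae_order hq).mono fun r hr => hG a l r hl hr))
    simp only [this, lintegral_const, measure_univ, mul_one]
  rw [key _ _ (by omega) (by omega) G h1]
  congr 1
  refine Finset.sum_congr rfl fun i hi => ?_
  rw [key _ _ (by omega) (Finset.mem_Ico.1 hi).1 (G' i) (h2 i hi)]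

/-- The expected number of edges is finite. -/
theorem lintegral_size_ne_top {j : ℕ} (hj : 1 ≤ j) : ∫⁻ t, (t.size : ℝ≥0∞) ∂(ν j) ≠ ∞ := by
  have hs : Measurable fun t : PlaneTree α => (t.size : ℝ≥0∞) :=
    (measurable_of_countable _).comp PlaneTree.measurable_size
  induction j using Nat.strong_induction_on with
  | _ j ih =>
    have := h.prob j hj
    rcases hj.eq_or_lt with rfl | hj'
    · have := h.prob_wait 1 le_rfl
      rw [h.lintegral_one hs]
      simp [PlaneTree.size]
    -- The edge below a node is charged to a subtree of lower order, so that `C` contains only means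
    -- that are finite by induction.
    · set C : ℝ≥0∞ := termProb T j * (∫⁻ t, (1 + t.size : ℝ≥0∞) ∂(ν (j - 1))
          + ∫⁻ t, (t.size : ℝ≥0∞) ∂(ν (j - 1)))
        + ∑ i ∈ Finset.Ico 1 j, sideProb T i j * ∫⁻ t, (1 + t.size : ℝ≥0∞) ∂(ν i) with hC
      have hfin : ∀ i, 1 ≤ i → i < j → ∫⁻ t, (1 + t.size : ℝ≥0∞) ∂(ν i) ≠ ∞ := by
        intro i hi hij
        have := h.prob i hi
        rw [lintegral_add_left measurable_const, lintegral_const, measure_univ, mul_one]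
        exact ENNReal.add_ne_top.2 ⟨ENNReal.one_ne_top, ih i hij hi⟩
      have hCt : C ≠ ∞ := by
        refine ENNReal.add_ne_top.2 ⟨ENNReal.mul_ne_top (termProb_ne_top T j)
          (ENNReal.add_ne_top.2 ⟨hfin _ (by omega) (by omega), ih _ (by omega) (by omega)⟩), ?_⟩
        refine ENNReal.sum_ne_top.2 fun i hi => ?_
        have hi := Finset.mem_Ico.1 hi
        exact ENNReal.mul_ne_top (sideProb_ne_top T i j) (hfin i hi.1 hi.2)
      -- The affine inequality is informative only for a finite unknown, hence the truncation at
      -- `n`; monotone convergence removes it.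
      have bound : ∀ n : ℕ, ∫⁻ t, min (t.size : ℝ≥0∞) n ∂(ν j) ≤ C / (1 - sideTotal T j) := by
        intro n
        refine le_div_of_le_affine (sideTotal_lt_one h.nonneg j) ?_ ?_
        · refine ne_top_of_le_ne_top (b := (n : ℝ≥0∞)) (ENNReal.natCast_ne_top n) ?_
          calc ∫⁻ t, min (t.size : ℝ≥0∞) n ∂(ν j) ≤ ∫⁻ t, (n : ℝ≥0∞) ∂(ν j) :=
                lintegral_mono fun t => min_le_right _ _
            _ = n := by simp
        · refine (h.lintegral_le hj' (hs.min measurable_const)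
            (f := fun t => 1 + t.size) (f' := fun t => t.size)
            (g := fun _ t => min (t.size : ℝ≥0∞) n) (g' := fun _ t => 1 + t.size)
            (measurable_const.add hs) (fun _ => hs.min measurable_const) ?_ ?_).trans ?_
          · intro a l r
            refine (min_le_left _ _).trans (le_of_eq ?_)
            simp only [PlaneTree.size]
            push_cast
            rfl
          · intro i _ a l r
            rcases le_total (l.size : ℝ≥0∞) n with h1 | h1
            · rw [min_eq_left h1]
              refine (min_le_left _ _).trans (le_of_eq ?_)
              simp only [PlaneTree.size]
              push_cast
              ring
            · rw [min_eq_right h1]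
              exact (min_le_right _ _).trans le_self_add
          · rw [hC, sideTotal, Finset.sum_mul, add_assoc, ← Finset.sum_add_distrib]
            gcongr
            rw [mul_add, add_comm]
      have hsup : ∀ t : PlaneTree α, (t.size : ℝ≥0∞) = ⨆ n : ℕ, min (t.size : ℝ≥0∞) n := by
        intro t
        refine le_antisymm ?_ (iSup_le fun n => min_le_left _ _)
        exact le_iSup_of_le t.size (by simp)
      rw [lintegral_congr hsup, lintegral_iSup (fun n => hs.min measurable_const)]
      · refine ne_top_of_le_ne_top (ENNReal.div_ne_top hCt ?_) (iSup_le bound)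
        exact (tsub_pos_of_lt (sideTotal_lt_one h.nonneg j)).ne'
      · intro n m hnm t
        exact min_le_min_left _ (by exact_mod_cast hnm)

end BranchFamily

end

/-! ## Mean numbers of branches and coordination -/

/-- Expresses the reciprocal of a branch count as a mixture of powers `z ^ n` with `z ≤ 1`, which
unlike the reciprocal factor over the two subtrees. -/
theorem lintegral_exp_neg_pow {n : ℕ} (hn : n ≠ 0) :
    ∫⁻ x in Set.Ici (0 : ℝ), ENNReal.ofReal (Real.exp (-x)) ^ n = (n : ℝ≥0∞)⁻¹ := by
  have hn' : (0 : ℝ) < n := by positivity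
  have h := lintegral_exponentialPDF_eq_one hn'
  have h1 : ∀ x : ℝ, exponentialPDF n x =
      (Set.Ici (0 : ℝ)).indicator (fun x => (n : ℝ≥0∞) * ENNReal.ofReal (Real.exp (-x)) ^ n) x := by
    intro x
    rw [exponentialPDF_eq, Set.indicator_apply]
    simp only [Set.mem_Ici]
    split_ifs
    · rw [ENNReal.ofReal_mul hn'.le, ENNReal.ofReal_natCast,
        ← ENNReal.ofReal_pow (Real.exp_pos _).le,
        ← Real.exp_nat_mul]
      congr 3
      ring
    · simp
  simp_rw [h1] at h
  rw [lintegral_indicator measurableSet_Ici, lintegral_const_mul _ (by fun_prop)] at h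
  exact ENNReal.eq_inv_of_mul_eq_one_left (by rwa [mul_comm])

/-- A product rule: at a node the weights multiply and the sums add. -/
theorem lintegral_lintegral_mul_add {X Y : Type*} [MeasurableSpace X] [MeasurableSpace Y]
    {μ : Measure X} {κ : Measure Y} {u s : X → ℝ≥0∞} {u' s' : Y → ℝ≥0∞} (hu : Measurable u)
    (hs : Measurable s) (hu' : Measurable u') (hs' : Measurable s') :
    ∫⁻ x, ∫⁻ y, u x * u' y * (s x + s' y) ∂κ ∂μ
      = (∫⁻ x, u x * s x ∂μ) * (∫⁻ y, u' y ∂κ) + (∫⁻ x, u x ∂μ) * ∫⁻ y, u' y * s' y ∂κ := by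
  have : ∀ x, ∫⁻ y, u x * u' y * (s x + s' y) ∂κ
      = u x * s x * (∫⁻ y, u' y ∂κ) + u x * ∫⁻ y, u' y * s' y ∂κ := by
    intro x
    rw [← lintegral_const_mul _ hu', ← lintegral_const_mul _ (show Measurable fun y => u' y * s' y from
      hu'.mul hs'), ← lintegral_add_left (hu'.const_mul _)]
    exact lintegral_congr fun y => by ring
  have hus : Measurable fun x => u x * s x := hu.mul hs
  simp_rw [this]
  rw [lintegral_add_left (hus.mul_const _), lintegral_mul_const _ hus, lintegral_mul_const _ hu]

noncomputable section

variable {α : Type} [MeasurableSpace α]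

namespace BranchFamily

open PlaneTree

variable {T : ℕ → ℝ} {w : ℕ → Measure α} {ν : ℕ → Measure (PlaneTree α)}
  (h : BranchFamily T w ν)
include h

theorem lintegral_lintegral_add {p q : ℕ} (hp : 1 ≤ p) (hq : 1 ≤ q) {f g : PlaneTree α → ℝ≥0∞}
    (hf : Measurable f) (hg : Measurable g) :
    ∫⁻ l, ∫⁻ r, (f l + g r) ∂(ν q) ∂(ν p) = ∫⁻ t, f t ∂(ν p) + ∫⁻ t, g t ∂(ν q) := by
  have := h.prob p hp
  have := h.prob q hq
  have := lintegral_lintegral_mul_add (μ := ν p) (κ := ν q) (measurable_one (α := ℝ≥0∞)) hf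
    measurable_one hg
  simpa only [Pi.one_apply, one_mul, MeasureTheory.lintegral_one, measure_univ, mul_one] using this

/-- The sum of a function over the complete subtrees of order `k`, weighted by a power of their
number. -/
theorem lintegral_pow_mul_sum {k : ℕ} (hk : 1 ≤ k) {g : PlaneTree α → ℝ≥0∞} (hg : Measurable g)
    (hg1 : ∀ t, g t ≤ 1) {z : ℝ≥0∞} (hz : z ≤ 1) {K : ℕ} (hK : 1 ≤ K) :
    ∫⁻ t, z ^ Multiset.card (t.completeSubtrees k 0) * ((t.completeSubtrees k 0).map g).sum ∂(ν K)
      = (∫⁻ t, g t ∂(ν k)) * ∫⁻ t, z ^ Multiset.card (t.completeSubtrees k 0)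
        * (Multiset.card (t.completeSubtrees k 0) : ℝ≥0∞) ∂(ν K) := by
  set N : PlaneTree α → ℕ := fun t => Multiset.card (t.completeSubtrees k 0) with hN
  set s : PlaneTree α → ℝ≥0∞ := fun t => ((t.completeSubtrees k 0).map g).sum with hs
  set Γ : ℝ≥0∞ := ∫⁻ t, g t ∂(ν k)
  have hNm : Measurable N := measurable_card_completeSubtrees k 0
  have hNm' : Measurable fun t => (N t : ℝ≥0∞) := (measurable_of_countable _).comp hNm
  have hu : Measurable fun t => z ^ N t := (measurable_of_countable fun n : ℕ => z ^ n).comp hNm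
  have hsm : Measurable s := measurable_sum_completeSubtrees hg k 0
  have hsN : ∀ t, s t ≤ N t := by
    intro t
    have := Multiset.sum_map_le_sum_map g (fun _ => (1 : ℝ≥0∞)) (fun x _ => hg1 x)
      (s := t.completeSubtrees k 0)
    simpa using this
  have hΓ : Γ ≠ ∞ := by
    have := h.prob k hk
    refine ne_top_of_le_ne_top ENNReal.one_ne_top
      ((lintegral_mono hg1).trans (le_of_eq ?_))
    simp
  have hfin : ∀ (f : PlaneTree α → ℝ≥0∞), (∀ t, f t ≤ N t) → ∀ i, 1 ≤ i →
      ∫⁻ t, z ^ N t * f t ∂(ν i) ≠ ∞ := by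
    intro f hf i hi
    refine ne_top_of_le_ne_top (h.lintegral_size_ne_top hi) (lintegral_mono fun t => ?_)
    calc z ^ N t * f t ≤ 1 * N t := mul_le_mul' (pow_le_one' hz _) (hf t)
      _ ≤ t.size := by
        rw [one_mul]
        exact_mod_cast card_completeSubtrees_le_size k 0 t
  have hnode : ∀ a l r, (node a l r).order ≠ k →
      N (node a l r) = N l + N r ∧ s (node a l r) = s l + s r := by
    intro a l r hne
    simp only [hN, hs, completeSubtrees_node hk hne, Multiset.card_add, Multiset.map_add,
      Multiset.sum_add, and_self]
  change ∫⁻ t, z ^ N t * s t ∂(ν K) = Γ * ∫⁻ t, z ^ N t * N t ∂(ν K)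
  induction K using Nat.strong_induction_on with
  | _ K ih =>
    rcases lt_trichotomy K k with hlt | rfl | hgt
    · have e1 : ∫⁻ t, z ^ N t * s t ∂(ν K) = ∫⁻ t, 0 ∂(ν K) :=
        lintegral_congr_ae ((h.ae_order hK).mono fun t ht => by
          simp [hs, completeSubtrees_of_lt (ht.trans_lt hlt)])
      have e2 : ∫⁻ t, z ^ N t * N t ∂(ν K) = ∫⁻ t, 0 ∂(ν K) :=
        lintegral_congr_ae ((h.ae_order hK).mono fun t ht => by
          simp [hN, completeSubtrees_of_lt (ht.trans_lt hlt)])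
      rw [e1, e2]
      simp
    · have := h.prob K hK
      have e1 : ∫⁻ t, z ^ N t * s t ∂(ν K) = ∫⁻ t, z * g t ∂(ν K) :=
        lintegral_congr_ae ((h.ae_order hK).mono fun t ht => by
          simp [hN, hs, completeSubtrees_of_eq ht (by omega : 0 ≠ K)])
      have e2 : ∫⁻ t, z ^ N t * N t ∂(ν K) = ∫⁻ t, z ∂(ν K) :=
        lintegral_congr_ae ((h.ae_order hK).mono fun t ht => by
          simp [hN, completeSubtrees_of_eq ht (by omega : 0 ≠ K)])
      rw [e1, e2, lintegral_const_mul _ hg]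
      simp [Γ, mul_comm]
    · have hj : 2 ≤ K := by omega
      -- For fixed `z` this equation is linear in `f` with coefficients that do not depend on `f`.
      -- It is applied to the sum `s` and to the count `N`; multiplying the latter by `Γ` gives the
      -- equation of the former.
      have hrec : ∀ (f : PlaneTree α → ℝ≥0∞), Measurable f →
          (∀ a l r, (node a l r).order ≠ k → f (node a l r) = f l + f r) →
          ∫⁻ t, z ^ N t * f t ∂(ν K) =
            (termProb T K * ((∫⁻ t, z ^ N t * f t ∂(ν (K - 1))) * (∫⁻ t, z ^ N t ∂(ν (K - 1)))
              + (∫⁻ t, z ^ N t ∂(ν (K - 1))) * ∫⁻ t, z ^ N t * f t ∂(ν (K - 1)))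
            + ∑ i ∈ Finset.Ico 1 K, sideProb T i K *
              ((∫⁻ t, z ^ N t ∂(ν K)) * ∫⁻ t, z ^ N t * f t ∂(ν i)))
            + (∑ i ∈ Finset.Ico 1 K, sideProb T i K * ∫⁻ t, z ^ N t ∂(ν i))
              * ∫⁻ t, z ^ N t * f t ∂(ν K) := by
        intro f hf hfn
        conv_lhs => rw [h.lintegral_step hj (show Measurable fun t => z ^ N t * f t from hu.mul hf)
          (G := fun l r => z ^ N l * z ^ N r * (f l + f r))
          (G' := fun _ l r => z ^ N l * z ^ N r * (f l + f r))
          (fun a l r hl hr => by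
            have : (node a l r).order ≠ k := by
              simp only [order, hl, hr, if_true]
              omega
            rw [(hnode a l r this).1, hfn a l r this, pow_add])
          (fun i hi a l r hl hr => by
            have := (Finset.mem_Ico.1 hi).2
            have : (node a l r).order ≠ k := by
              simp only [order, hl, hr]
              split_ifs <;> omega
            rw [(hnode a l r this).1, hfn a l r this, pow_add])]
        simp only [lintegral_lintegral_mul_add hu hf hu hf]
        rw [add_assoc, Finset.sum_mul, ← Finset.sum_add_distrib]
        congr 1
        exact Finset.sum_congr rfl fun i _ => by ring
      -- The weights `z ^ N` are at most one, so they can only improve the contraction factor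
      -- `sideTotal T K`.
      have hθ : ∑ i ∈ Finset.Ico 1 K, sideProb T i K * ∫⁻ t, z ^ N t ∂(ν i) < 1 := by
        refine lt_of_le_of_lt (Finset.sum_le_sum fun i hi => ?_) (sideTotal_lt_one h.nonneg K)
        have := h.prob i (Finset.mem_Ico.1 hi).1
        refine mul_le_of_le_one_right' ?_
        calc ∫⁻ t, z ^ N t ∂(ν i) ≤ ∫⁻ t, 1 ∂(ν i) := lintegral_mono fun t => pow_le_one' hz _
          _ = 1 := by simp
      refine eq_of_affine hθ (hfin s hsN K hK)
        (ENNReal.mul_ne_top hΓ (hfin _ (fun t => le_rfl) K hK))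
        (hrec s hsm fun a l r hne => (hnode a l r hne).2) ?_
      conv_lhs => rw [hrec (fun t => N t) hNm' fun a l r hne => by
        rw [(hnode a l r hne).1, Nat.cast_add]]
      rw [ih (K - 1) (by omega) (by omega), mul_add, mul_add, Finset.mul_sum]
      congr 1
      · congr 1
        · ring
        · refine Finset.sum_congr rfl fun i hi => ?_
          rw [ih i (Finset.mem_Ico.1 hi).2 (Finset.mem_Ico.1 hi).1]
          ring
      · ring

/-- A uniform complete subtree of order `k` of a tree of order `K` has the law of a tree of
order `k`. -/
theorem lintegral_uniform_completeSubtrees {k K : ℕ} (hk : 1 ≤ k) (hK : k ≤ K)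
    {g : PlaneTree α → ℝ≥0∞} (hg : Measurable g) (hg1 : ∀ t, g t ≤ 1) :
    ∫⁻ t, (Multiset.card (t.completeSubtrees k 0) : ℝ≥0∞)⁻¹
      * ((t.completeSubtrees k 0).map g).sum ∂(ν K) = ∫⁻ t, g t ∂(ν k) := by
  have := h.finite K
  -- The reciprocal of the count becomes an integral over `z = exp (-x)` and Tonelli exchanges the
  -- integrals. The count is almost surely positive because the order is `K ≥ k`.
  have key : ∀ g : PlaneTree α → ℝ≥0∞, Measurable g →
      ∫⁻ t, (Multiset.card (t.completeSubtrees k 0) : ℝ≥0∞)⁻¹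
        * ((t.completeSubtrees k 0).map g).sum ∂(ν K) =
      ∫⁻ x in Set.Ici (0 : ℝ), ∫⁻ t, ENNReal.ofReal (Real.exp (-x))
        ^ Multiset.card (t.completeSubtrees k 0) * ((t.completeSubtrees k 0).map g).sum ∂(ν K) := by
    intro g hg
    have hm : Measurable fun t : PlaneTree α => ((t.completeSubtrees k 0).map g).sum :=
      measurable_sum_completeSubtrees hg k 0
    have hp : Measurable fun x : ℝ × PlaneTree α =>
        ENNReal.ofReal (Real.exp (-x.1)) ^ Multiset.card (x.2.completeSubtrees k 0) := by
      have : Measurable fun x : ℝ × ℕ => ENNReal.ofReal (Real.exp (-x.1)) ^ x.2 :=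
        measurable_from_prod_countable_left fun n => by fun_prop
      exact this.comp (measurable_fst.prodMk
        ((measurable_card_completeSubtrees k 0).comp measurable_snd))
    rw [lintegral_lintegral_swap (hp.mul (hm.comp measurable_snd)).aemeasurable]
    refine lintegral_congr_ae ((h.ae_order (hk.trans hK)).mono fun t ht => ?_)
    change _ * _ = ∫⁻ x in Set.Ici (0 : ℝ), _
    rw [lintegral_mul_const _ (by fun_prop), lintegral_exp_neg_pow
      (card_completeSubtrees_pos hk (ht ▸ hK)).ne']
  have hK1 := hk.trans hK
  have := h.prob K hK1
  have e1 := key g hg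
  have e2 := key (fun _ => 1) measurable_const
  have hz : ∀ x ∈ Set.Ici (0 : ℝ), ENNReal.ofReal (Real.exp (-x)) ≤ 1 := by
    intro x hx
    rw [← ENNReal.ofReal_one]
    exact ENNReal.ofReal_le_ofReal (Real.exp_le_one_iff.2 (neg_nonpos.2 hx))
  have hΓ : ∫⁻ t, g t ∂(ν k) ≠ ∞ := by
    have := h.prob k hk
    refine ne_top_of_le_ne_top ENNReal.one_ne_top ((lintegral_mono hg1).trans (le_of_eq ?_))
    simp
  rw [e1, setLIntegral_congr_fun measurableSet_Ici fun x hx =>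
    h.lintegral_pow_mul_sum hk hg hg1 (hz x hx) hK1, lintegral_const_mul' _ _ hΓ]
  -- For `g = 1` the sum is the count itself, so the remaining factor is the expectation of `N⁻¹ *
  -- N`, which is one.
  simp only [Multiset.map_const', Multiset.sum_replicate, nsmul_eq_mul, mul_one] at e2
  rw [← e2]
  have e3 : ∫⁻ t, (Multiset.card (t.completeSubtrees k 0) : ℝ≥0∞)⁻¹
      * (Multiset.card (t.completeSubtrees k 0) : ℝ≥0∞) ∂(ν K) = ∫⁻ t, 1 ∂(ν K) :=
    lintegral_congr_ae ((h.ae_order hK1).mono fun t ht =>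
      ENNReal.inv_mul_cancel (by
        exact_mod_cast (card_completeSubtrees_pos hk (ht ▸ hK)).ne') (ENNReal.natCast_ne_top _))
  rw [e3]
  simp

theorem lintegral_card_ne_top (k : ℕ) {K : ℕ} (hK : 1 ≤ K) :
    ∫⁻ t, (Multiset.card (t.completeSubtrees k 0) : ℝ≥0∞) ∂(ν K) ≠ ∞ :=
  ne_top_of_le_ne_top (h.lintegral_size_ne_top hK) (lintegral_mono fun t =>
    Nat.cast_le.2 (card_completeSubtrees_le_size k 0 t))

theorem lintegral_card_ne_zero {k K : ℕ} (hk : 1 ≤ k) (hK : k ≤ K) :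
    ∫⁻ t, (Multiset.card (t.completeSubtrees k 0) : ℝ≥0∞) ∂(ν K) ≠ 0 := by
  have := h.prob K (hk.trans hK)
  have h1 : (1 : ℝ≥0∞) ≤ ∫⁻ t, (Multiset.card (t.completeSubtrees k 0) : ℝ≥0∞) ∂(ν K) := by
    calc (1 : ℝ≥0∞) = ∫⁻ t, 1 ∂(ν K) := by simp
      _ ≤ _ := lintegral_mono_ae ((h.ae_order (hk.trans hK)).mono fun t ht => by
        exact_mod_cast card_completeSubtrees_pos hk (ht ▸ hK))
  exact (one_pos.trans_le h1).ne'

/-- Every branch of order `j` carries `T (j - i)` side-branches of order `i` on average. -/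
theorem lintegral_sideBranchCount {i j : ℕ} (hi : 1 ≤ i) (hij : i < j) {K : ℕ} (hK : 1 ≤ K) :
    ∫⁻ t, (t.sideBranchCount i j : ℝ≥0∞) ∂(ν K) = ENNReal.ofReal (T (j - i)) *
      ∫⁻ t, (Multiset.card (t.completeSubtrees j 0) : ℝ≥0∞) ∂(ν K) := by
  have hS : Measurable fun t : PlaneTree α => (t.sideBranchCount i j : ℝ≥0∞) :=
    (measurable_of_countable _).comp (measurable_sideBranchCount i j)
  have hN : Measurable fun t : PlaneTree α => (Multiset.card (t.completeSubtrees j 0) : ℝ≥0∞) :=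
    (measurable_of_countable _).comp (measurable_card_completeSubtrees j 0)
  have hSfin : ∀ K, 1 ≤ K → ∫⁻ t, (t.sideBranchCount i j : ℝ≥0∞) ∂(ν K) ≠ ∞ := fun K hK =>
    ne_top_of_le_ne_top (h.lintegral_size_ne_top hK) (lintegral_mono fun t =>
      Nat.cast_le.2 (sideBranchCount_le_size i j t))
  have hzero : ∀ K, 1 ≤ K → K < j → ∫⁻ t, (t.sideBranchCount i j : ℝ≥0∞) ∂(ν K) = 0 := by
    intro K hK hlt
    have e1 : ∫⁻ t, (t.sideBranchCount i j : ℝ≥0∞) ∂(ν K) = ∫⁻ t, 0 ∂(ν K) :=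
      lintegral_congr_ae ((h.ae_order hK).mono fun t ht => by
        simp [sideBranchCount_of_lt (ht.trans_lt hlt)])
    simpa using e1
  induction K using Nat.strong_induction_on with
  | _ K ih =>
    rcases lt_trichotomy K j with hlt | rfl | hgt
    · have e2 : ∫⁻ t, (Multiset.card (t.completeSubtrees j 0) : ℝ≥0∞) ∂(ν K) = ∫⁻ t, 0 ∂(ν K) :=
        lintegral_congr_ae ((h.ae_order hK).mono fun t ht => by
          simp [completeSubtrees_of_lt (ht.trans_lt hlt)])
      rw [hzero K hK hlt, e2]
      simp
    · have := h.prob K hK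
      have e2 : ∫⁻ t, (Multiset.card (t.completeSubtrees K 0) : ℝ≥0∞) ∂(ν K) = ∫⁻ t, 1 ∂(ν K) :=
        lintegral_congr_ae ((h.ae_order hK).mono fun t ht => by
          simp [completeSubtrees_of_eq ht (by omega : 0 ≠ K)])
      have e3 : ∫⁻ t, (1 : ℝ≥0∞) ∂(ν K) = 1 := by simp
      rw [e2, e3, mul_one]
      -- In the root branch a birth of order `i` adds one to the count and the branch then starts
      -- afresh; trees of order below `K` contribute nothing. That `T (K - i)` solves the same
      -- equation is `sideProb_eq_mul` with `termProb + sideTotal = 1`.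
      refine eq_of_affine (c := sideProb T i K) (sideTotal_lt_one h.nonneg K) (hSfin K hK)
        ENNReal.ofReal_ne_top ?_ ?_
      · conv_lhs => rw [h.lintegral_step (by omega) hS
          (G := fun l r => (l.sideBranchCount i K : ℝ≥0∞) + r.sideBranchCount i K)
          (G' := fun i' l r => ((if i' = i then 1 else 0) + (l.sideBranchCount i K : ℝ≥0∞))
            + r.sideBranchCount i K)
          (fun a l r hl hr => by
            simp only [sideBranchCount, hl, hr]
            rw [if_neg (by omega)]
            push_cast
            ring)
          (fun i' hi' a l r hl hr => by
            have := (Finset.mem_Ico.1 hi').2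
            simp only [sideBranchCount, hl, hr]
            by_cases hii : i' = i
            · subst hii
              simp
            · rw [if_neg (by omega), if_neg hii]
              push_cast
              ring)]
        rw [h.lintegral_lintegral_add (by omega) (by omega) hS hS, hzero (K - 1) (by omega)
          (by omega), add_zero, mul_zero, zero_add]
        have e4 : ∀ i' ∈ Finset.Ico 1 K, sideProb T i' K * ∫⁻ l, ∫⁻ r,
            (((if i' = i then 1 else 0) + (l.sideBranchCount i K : ℝ≥0∞)) + r.sideBranchCount i K)
              ∂(ν i') ∂(ν K) = (if i' = i then sideProb T i' K else 0)
            + sideProb T i' K * ∫⁻ t, (t.sideBranchCount i K : ℝ≥0∞) ∂(ν K) := by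
          intro i' hi'
          have hi' := Finset.mem_Ico.1 hi'
          rw [h.lintegral_lintegral_add hK hi'.1 (show Measurable fun t : PlaneTree α =>
            (if i' = i then 1 else 0) + (t.sideBranchCount i K : ℝ≥0∞) from
              measurable_const.add hS) hS, hzero i' hi'.1 hi'.2,
            add_zero, lintegral_add_left measurable_const, lintegral_const, measure_univ, mul_one,
            mul_add]
          split_ifs <;> simp
        rw [Finset.sum_congr rfl e4, Finset.sum_add_distrib, Finset.sum_ite_eq',
          if_pos (Finset.mem_Ico.2 ⟨hi, hij⟩), ← Finset.sum_mul]
        rfl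
      · rw [sideProb_eq_mul h.nonneg hij, mul_comm (sideTotal T K), ← mul_add,
          termProb_add_sideTotal h.nonneg, mul_one]
    -- For `K > j` the root node is neither a merger of orders `i` and `j` nor the start of a branch
    -- of order `j`, so both counts are additive and satisfy the same linear equation.
    · have hrec : ∀ (f : PlaneTree α → ℝ≥0∞), Measurable f →
          (∀ a l r, (node a l r).order = K → (l.order = r.order ∨ l.order = K ∧ r.order < K) →
            f (node a l r) = f l + f r) →
          ∫⁻ t, f t ∂(ν K) =
            (termProb T K * ((∫⁻ t, f t ∂(ν (K - 1))) + ∫⁻ t, f t ∂(ν (K - 1)))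
            + ∑ i ∈ Finset.Ico 1 K, sideProb T i K * ∫⁻ t, f t ∂(ν i))
            + sideTotal T K * ∫⁻ t, f t ∂(ν K) := by
        intro f hf hfn
        conv_lhs => rw [h.lintegral_step (by omega) hf
          (G := fun l r => f l + f r) (G' := fun _ l r => f l + f r)
          (fun a l r hl hr => by
            refine hfn a l r ?_ (.inl (hl.trans hr.symm))
            simp only [order, hl, hr, if_true]
            omega)
          (fun i hi a l r hl hr => by
            have := (Finset.mem_Ico.1 hi).2
            refine hfn a l r ?_ (.inr ⟨hl, by omega⟩)
            simp only [order, hl, hr]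
            split_ifs <;> omega)]
        rw [h.lintegral_lintegral_add (by omega) (by omega) hf hf, add_assoc, sideTotal,
          Finset.sum_mul, ← Finset.sum_add_distrib]
        congr 1
        refine Finset.sum_congr rfl fun i hi => ?_
        rw [h.lintegral_lintegral_add hK (Finset.mem_Ico.1 hi).1 hf hf]
        ring
      refine eq_of_affine (sideTotal_lt_one h.nonneg K) (hSfin K hK)
        (ENNReal.mul_ne_top ENNReal.ofReal_ne_top (h.lintegral_card_ne_top j hK))
        (hrec _ hS ?_) ?_
      · intro a l r _ hlr
        simp only [sideBranchCount]
        rw [if_neg (by omega)]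
        push_cast
        ring
      · conv_lhs => rw [hrec _ hN fun a l r hK _ => by
          rw [completeSubtrees_node (by omega) (by omega), Multiset.card_add, Nat.cast_add]]
        rw [ih (K - 1) (by omega) (by omega), mul_add, mul_add, Finset.mul_sum]
        congr 1
        · congr 1
          · ring
          · refine Finset.sum_congr rfl fun i' hi' => ?_
            rw [ih i' (Finset.mem_Ico.1 hi').2 (Finset.mem_Ico.1 hi').1]
            ring
        · ring

end BranchFamily

end

/-! ## Uniqueness, relabelling and pruning of families of branch laws -/

noncomputable section

variable {α β : Type} [MeasurableSpace α] [MeasurableSpace β]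

instance (e : Measure α) (m : Measure (PlaneTree α × PlaneTree α)) [SFinite e] [SFinite m] :
    SFinite (graft e m) := by
  unfold graft
  infer_instance

instance (e : Measure α) (m : Measure (PlaneTree α × PlaneTree α)) [IsFiniteMeasure e]
    [IsFiniteMeasure m] : IsFiniteMeasure (graft e m) := by
  unfold graft
  infer_instance

theorem graft_add_prod (e : Measure α) (l l' r : Measure (PlaneTree α)) [SFinite e] [SFinite l]
    [SFinite l'] [SFinite r] :
    graft e ((l + l').prod r) = graft e (l.prod r) + graft e (l'.prod r) := by
  rw [graft, Measure.add_prod, Measure.prod_add, Measure.map_add _ _ PlaneTree.measurable_node]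
  rfl

theorem map_graft (e : Measure α) (l r : Measure (PlaneTree α)) [SFinite e] [SFinite l] [SFinite r]
    {f : α → β} (hf : Measurable f) :
    (graft e (l.prod r)).map (PlaneTree.map f) =
      graft (e.map f) ((l.map (PlaneTree.map f)).prod (r.map (PlaneTree.map f))) := by
  have hm := PlaneTree.measurable_map hf
  rw [graft, graft, Measure.map_prod_map _ _ hm hm, Measure.map_prod_map _ _ hf (hm.prodMap hm),
    Measure.map_map hm PlaneTree.measurable_node,
    Measure.map_map PlaneTree.measurable_node (hf.prodMap (hm.prodMap hm))]
  rfl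

namespace BranchFamily

variable {T : ℕ → ℝ} {w w' : ℕ → Measure α} {ν ν' : ℕ → Measure (PlaneTree α)}

/-- A family of branch laws is determined by the laws of the labels. -/
theorem eq (h : BranchFamily T w ν) (h' : BranchFamily T w' ν') (hw : ∀ j, 1 ≤ j → w j = w' j)
    {j : ℕ} (hj : 1 ≤ j) : ν j = ν' j := by
  have := h.finite
  induction j using Nat.strong_induction_on with
  | _ j ih =>
    rcases hj.eq_or_lt with rfl | hj'
    · rw [h.one, h'.one, hw 1 le_rfl]
    · have := h.prob_wait j hj
      refine measure_eq_of_affine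
        -- Only the continuing branch is unknown: it enters `L` linearly, while the side-branches
        -- have lower order and are fixed by induction.
        (L := fun ρ => ∑ i ∈ Finset.Ico 1 j, sideProb T i j • graft (w j) (ρ.prod (ν i)))
        (sideTotal_lt_one h.nonneg j) ?_ ?_ (h.finite j) (h'.finite j) (h.step j hj') ?_
      · intro ρ σ _ _
        simp only [graft_add_prod, smul_add, Finset.sum_add_distrib]
      · intro ρ _
        rw [Measure.coe_finsetSum, Finset.sum_apply, sideTotal, Finset.sum_mul]
        refine Finset.sum_le_sum fun i hi => ?_
        have := h.prob i (Finset.mem_Ico.1 hi).1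
        rw [Measure.smul_apply, graft_univ, ← Set.univ_prod_univ, Measure.prod_prod]
        simp
      · conv_lhs => rw [h'.step j hj']
        rw [hw j hj, ih (j - 1) (by omega) (by omega)]
        congr 1
        refine Finset.sum_congr rfl fun i hi => ?_
        rw [ih i (Finset.mem_Ico.1 hi).2 (Finset.mem_Ico.1 hi).1]

/-- Used twice: a constant relabelling forgets the lengths, and multiplication by a constant
rescales them. -/
theorem map (h : BranchFamily T w ν) {f : α → β} (hf : Measurable f) :
    BranchFamily T (fun j => (w j).map f) (fun j => (ν j).map (PlaneTree.map f)) where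
  nonneg := h.nonneg
  prob_wait j hj := by
    have := h.prob_wait j hj
    exact Measure.isProbabilityMeasure_map hf.aemeasurable
  finite j := by
    have := h.finite j
    infer_instance
  prob j hj := by
    have := h.prob j hj
    exact Measure.isProbabilityMeasure_map (PlaneTree.measurable_map hf).aemeasurable
  one := by
    rw [h.one, Measure.map_map (PlaneTree.measurable_map hf) PlaneTree.measurable_leaf,
      Measure.map_map PlaneTree.measurable_leaf hf]
    rfl
  step j hj := by
    have := h.finite
    have := h.prob_wait j (by omega)
    have hm := PlaneTree.measurable_map hf
    conv_lhs => rw [h.step j hj, Measure.map_add _ _ hm, Measure.map_smul,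
      Measure.map_finset_sum hm.aemeasurable, map_graft _ _ _ hf]
    congr 1
    refine Finset.sum_congr rfl fun i _ => ?_
    rw [Measure.map_smul, map_graft _ _ _ hf]

end BranchFamily

/-! ### Pruning -/

theorem ae_graft_children (e : Measure α) {l r : Measure (PlaneTree α)} [SFinite r]
    {P Q : PlaneTree α → Prop} (hP : ∀ᵐ t ∂l, P t) (hQ : ∀ᵐ t ∂r, Q t) :
    ∀ᵐ x ∂(e.prod (l.prod r)), P x.2.1 ∧ Q x.2.2 := by
  have h1 : ∀ᵐ y ∂(l.prod r), P y.1 := Measure.quasiMeasurePreserving_fst.ae hP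
  have h2 : ∀ᵐ y ∂(l.prod r), Q y.2 := Measure.quasiMeasurePreserving_snd.ae hQ
  exact Measure.quasiMeasurePreserving_snd.ae (h1.and h2)

section prune

variable [Add α] [MeasurableAdd₂ α]

/-- Prolong the edge next to the root by an independent random edge. -/
def prolong (e : Measure α) (ρ : Measure (PlaneTree α)) : Measure (PlaneTree α) :=
  (e.prod ρ).map fun x => x.2.addRoot x.1

theorem prolong_add (e : Measure α) (ρ σ : Measure (PlaneTree α)) [SFinite e] [SFinite ρ]
    [SFinite σ] : prolong e (ρ + σ) = prolong e ρ + prolong e σ := by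
  rw [prolong, Measure.prod_add, Measure.map_add _ _ PlaneTree.measurable_addRoot]
  rfl

omit [MeasurableAdd₂ α] in
theorem prolong_smul (e : Measure α) (c : ℝ≥0∞) (ρ : Measure (PlaneTree α)) [SFinite ρ] :
    prolong e (c • ρ) = c • prolong e ρ := by
  rw [prolong, Measure.prod_smul_right, Measure.map_smul]
  rfl

theorem prolong_finsetSum {ι : Type*} (e : Measure α) [SFinite e] (s : Finset ι) (c : ι → ℝ≥0∞)
    (ρ : ι → Measure (PlaneTree α)) [∀ i, SFinite (ρ i)] :
    prolong e (∑ i ∈ s, c i • ρ i) = ∑ i ∈ s, c i • prolong e (ρ i) := by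
  classical
  have key : SFinite (∑ i ∈ s, c i • ρ i) ∧
      prolong e (∑ i ∈ s, c i • ρ i) = ∑ i ∈ s, c i • prolong e (ρ i) := by
    induction s using Finset.induction with
    | empty =>
      refine ⟨by rw [Finset.sum_empty]; infer_instance, ?_⟩
      simp [prolong]
    | insert i s hi ih =>
      have := ih.1
      rw [Finset.sum_insert hi, Finset.sum_insert hi, prolong_add, prolong_smul, ih.2]
      exact ⟨inferInstance, rfl⟩
  exact key.2

theorem prolong_univ (e : Measure α) (ρ : Measure (PlaneTree α)) [SFinite ρ] :
    prolong e ρ Set.univ = e Set.univ * ρ Set.univ := by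
  rw [prolong, Measure.map_apply PlaneTree.measurable_addRoot .univ, Set.preimage_univ,
    ← Set.univ_prod_univ, Measure.prod_prod]

/-- Lengthening the root edge of a grafted tree is the same as grafting below it an edge with the
summed label, so an equation for the edge law passes to trees. -/
theorem graft_eq_of_wait_eq {e e' : Measure α} [SFinite e] [SFinite e'] {b c : ℝ≥0∞}
    (he : e' = b • e + c • (e.prod e').map fun x => x.1 + x.2)
    (m : Measure (PlaneTree α × PlaneTree α)) [SFinite m] :
    graft e' m = b • graft e m + c • prolong e (graft e' m) := by
  have hadd : Measurable fun x : α × α => x.1 + x.2 := measurable_add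
  have h1 : graft ((e.prod e').map fun x => x.1 + x.2) m = prolong e (graft e' m) := by
    have e1 : ((e.prod e').map fun x => x.1 + x.2).prod m
        = (((e.prod e').prod m).map (Prod.map (fun x => x.1 + x.2) id)) := by
      rw [← Measure.map_prod_map _ _ hadd measurable_id, Measure.map_id]
    have e2 : e.prod ((e'.prod m).map fun x => PlaneTree.node x.1 x.2.1 x.2.2)
        = (e.prod (e'.prod m)).map
          (Prod.map id fun x => PlaneTree.node x.1 x.2.1 x.2.2) := by
      rw [← Measure.map_prod_map _ _ measurable_id PlaneTree.measurable_node, Measure.map_id]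
    have e3 : ((e.prod e').prod m).map MeasurableEquiv.prodAssoc = e.prod (e'.prod m) :=
      Measure.prodAssoc_prod
    rw [graft, prolong, graft, e1, e2, ← e3,
      Measure.map_map PlaneTree.measurable_node (hadd.prodMap measurable_id),
      Measure.map_map (measurable_id.prodMap PlaneTree.measurable_node)
        MeasurableEquiv.prodAssoc.measurable,
      Measure.map_map PlaneTree.measurable_addRoot
        ((measurable_id.prodMap PlaneTree.measurable_node).comp
          MeasurableEquiv.prodAssoc.measurable)]
    rfl
  conv_lhs => rw [he]
  rw [graft, Measure.add_prod, Measure.map_add _ _ PlaneTree.measurable_node,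
    Measure.prod_smul_left, Measure.prod_smul_left, Measure.map_smul, Measure.map_smul]
  change b • graft e m + c • graft _ m = _
  rw [h1]

theorem map_leaf_eq_of_wait_eq {e e' : Measure α} [SFinite e] [SFinite e'] {b c : ℝ≥0∞}
    (he : e' = b • e + c • (e.prod e').map fun x => x.1 + x.2) :
    e'.map PlaneTree.leaf = b • e.map PlaneTree.leaf + c • prolong e (e'.map PlaneTree.leaf) := by
  have hadd : Measurable fun x : α × α => x.1 + x.2 := measurable_add
  have hl : Measurable (PlaneTree.leaf : α → PlaneTree α) := PlaneTree.measurable_leaf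
  have h1 : ((e.prod e').map fun x => x.1 + x.2).map PlaneTree.leaf
      = prolong e (e'.map PlaneTree.leaf) := by
    have e2 : e.prod (e'.map PlaneTree.leaf) = (e.prod e').map (Prod.map id PlaneTree.leaf) := by
      rw [← Measure.map_prod_map _ _ measurable_id hl, Measure.map_id]
    rw [prolong, e2, Measure.map_map hl hadd,
      Measure.map_map PlaneTree.measurable_addRoot (measurable_id.prodMap hl)]
    rfl
  conv_lhs => rw [he]
  rw [Measure.map_add _ _ hl, Measure.map_smul, Measure.map_smul, h1]

section pruned

variable (e : Measure α) {l r : Measure (PlaneTree α)} [SFinite e] [SFinite l] [SFinite r]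

/-- This and the next two lemmas are the three cases of pruning at the root vertex: it survives, it
becomes a vertex of degree two and is suppressed, or it becomes a leaf. -/
theorem map_pruned_graft (hl : ∀ᵐ t ∂l, 2 ≤ t.order) (hr : ∀ᵐ t ∂r, 2 ≤ t.order) :
    (graft e (l.prod r)).map PlaneTree.pruned
      = graft e ((l.map PlaneTree.pruned).prod (r.map PlaneTree.pruned)) := by
  have hp : Measurable (PlaneTree.pruned : PlaneTree α → PlaneTree α) := PlaneTree.measurable_pruned
  have e1 : e.prod ((l.map PlaneTree.pruned).prod (r.map PlaneTree.pruned))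
      = (e.prod (l.prod r)).map (Prod.map id (Prod.map PlaneTree.pruned PlaneTree.pruned)) := by
    rw [← Measure.map_prod_map _ _ measurable_id (hp.prodMap hp), Measure.map_id,
      Measure.map_prod_map _ _ hp hp]
  rw [graft, graft, e1, Measure.map_map hp PlaneTree.measurable_node,
    Measure.map_map PlaneTree.measurable_node (measurable_id.prodMap (hp.prodMap hp))]
  exact Measure.map_congr ((ae_graft_children e hl hr).mono fun x hx =>
    PlaneTree.pruned_node x.1 hx.1 hx.2)

theorem map_pruned_graft_left (hl : ∀ᵐ t ∂l, 2 ≤ t.order) (hr : ∀ᵐ t ∂r, t.order = 1)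
    [IsProbabilityMeasure r] :
    (graft e (l.prod r)).map PlaneTree.pruned = prolong e (l.map PlaneTree.pruned) := by
  have hp : Measurable (PlaneTree.pruned : PlaneTree α → PlaneTree α) := PlaneTree.measurable_pruned
  have e0 : l = (l.prod r).map Prod.fst := by
    rw [Measure.map_fst_prod, measure_univ, one_smul]
  have e1 : e.prod (l.map PlaneTree.pruned)
      = (e.prod (l.prod r)).map (Prod.map id (PlaneTree.pruned ∘ Prod.fst)) := by
    conv_lhs => rw [e0]
    rw [← Measure.map_prod_map _ _ measurable_id (hp.comp measurable_fst), Measure.map_id,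
      Measure.map_map hp measurable_fst]
  rw [graft, prolong, e1, Measure.map_map hp PlaneTree.measurable_node,
    Measure.map_map PlaneTree.measurable_addRoot
      (measurable_id.prodMap (hp.comp measurable_fst))]
  exact Measure.map_congr ((ae_graft_children e hl hr).mono fun x hx =>
    PlaneTree.pruned_node_left x.1 hx.1 hx.2)

omit [SFinite e] in
theorem map_pruned_graft_one (hl : ∀ᵐ t ∂l, t.order = 1) (hr : ∀ᵐ t ∂r, t.order = 1)
    [IsProbabilityMeasure l] [IsProbabilityMeasure r] :
    (graft e (l.prod r)).map PlaneTree.pruned = e.map PlaneTree.leaf := by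
  have hp : Measurable (PlaneTree.pruned : PlaneTree α → PlaneTree α) := PlaneTree.measurable_pruned
  have e0 : e = (e.prod (l.prod r)).map Prod.fst := by
    rw [Measure.map_fst_prod, measure_univ, one_smul]
  conv_rhs => rw [e0, Measure.map_map PlaneTree.measurable_leaf measurable_fst]
  rw [graft, Measure.map_map hp PlaneTree.measurable_node]
  exact Measure.map_congr ((ae_graft_children e hl hr).mono fun x hx =>
    PlaneTree.pruned_node_one_one x.1 hx.1 hx.2)

end pruned

/-- Separates the side-branches of order one, which pruning deletes, from the others, whose order
drops by one. -/
theorem sum_Ico_succ {M : Type*} [AddCommMonoid M] (f : ℕ → M) {j : ℕ} (hj : 1 ≤ j) :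
    ∑ i ∈ Finset.Ico 1 (j + 1), f i = ∑ i ∈ Finset.Ico 1 j, f (i + 1) + f 1 := by
  rw [Finset.sum_eq_sum_Ico_succ_bot (by omega), add_comm, Finset.sum_Ico_add']

/-- The hypothesis `hw` describes an edge after pruning: it ends at the current event unless that
event is the birth of an order-one branch, in which case an independent edge of the same law is
appended. Both sides are then fixed points of one affine map. -/
theorem BranchFamily.map_pruned {T : ℕ → ℝ} {w w' : ℕ → Measure α}
    {ν ν' : ℕ → Measure (PlaneTree α)} (h : BranchFamily T w ν) (h' : BranchFamily T w' ν')
    (hw : ∀ j, 1 ≤ j → w' j = ENNReal.ofReal (relRate T j / relRate T (j + 1)) • w (j + 1)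
      + ENNReal.ofReal (T j / relRate T (j + 1)) • ((w (j + 1)).prod (w' j)).map fun x => x.1 + x.2)
    {j : ℕ} (hj : 1 ≤ j) : (ν (j + 1)).map PlaneTree.pruned = ν' j := by
  have := h.finite
  have := h'.finite
  have hp : Measurable (PlaneTree.pruned : PlaneTree α → PlaneTree α) := PlaneTree.measurable_pruned
  have h2 : ∀ i, 1 ≤ i → ∀ᵐ t ∂(ν (i + 1)), 2 ≤ t.order := fun i hi =>
    (h.ae_order (by omega : 1 ≤ i + 1)).mono fun t ht => by omega
  induction j using Nat.strong_induction_on with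
  | _ j ih =>
    have := h.prob_wait (j + 1) (by omega)
    have := h'.prob_wait j hj
    have := h.prob 1 le_rfl
    have hr := relRate_pos h.nonneg j
    have hr' := relRate_pos h.nonneg (j + 1)
    -- An event at order `j + 1` is the first event at order `j`, conditioned on not being the birth
    -- of an order-one branch; `relRate T j / relRate T (j + 1)` is the probability of that
    -- condition.
    have hb : ∀ x : ℝ, ENNReal.ofReal (relRate T j / relRate T (j + 1))
        * ENNReal.ofReal (x / relRate T j) = ENNReal.ofReal (x / relRate T (j + 1)) := by
      intro x
      rw [← ENNReal.ofReal_mul (by positivity)]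
      congr 1
      field_simp
    have hterm : ENNReal.ofReal (relRate T j / relRate T (j + 1)) * termProb T j
        = termProb T (j + 1) := hb 1
    have hside : ∀ i, ENNReal.ofReal (relRate T j / relRate T (j + 1)) * sideProb T i j
        = sideProb T (i + 1) (j + 1) := by
      intro i
      rw [sideProb, hb, sideProb, Nat.add_sub_add_right]
    set L : Measure (PlaneTree α) → Measure (PlaneTree α) := fun ρ =>
      ∑ i ∈ Finset.Ico 1 j, sideProb T (i + 1) (j + 1) • graft (w (j + 1)) (ρ.prod (ν' i))
        + sideProb T 1 (j + 1) • prolong (w (j + 1)) ρ with hL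
    -- A terminating branch of order two has two offspring of order one; pruning deletes them and
    -- leaves a single edge.
    set c : Measure (PlaneTree α) := termProb T (j + 1) • (if j = 1 then
      (w (j + 1)).map PlaneTree.leaf else graft (w (j + 1)) ((ν' (j - 1)).prod (ν' (j - 1)))) with hc
    refine measure_eq_of_affine (L := L) (c := c) (sideTotal_lt_one h.nonneg (j + 1)) ?_ ?_
      inferInstance (h'.finite j) ?_ ?_
    · intro ρ σ _ _
      simp only [hL, graft_add_prod, Finset.sum_add_distrib, prolong_add, smul_add]
      exact add_add_add_comm _ _ _ _
    · intro ρ _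
      rw [hL, Measure.add_apply, Measure.coe_finsetSum, Finset.sum_apply, Measure.smul_apply,
        prolong_univ, measure_univ, one_mul, sideTotal, sum_Ico_succ _ hj, add_mul, Finset.sum_mul]
      refine add_le_add (Finset.sum_le_sum fun i hi => ?_) le_rfl
      have := h'.prob i (Finset.mem_Ico.1 hi).1
      rw [Measure.smul_apply, graft_univ, ← Set.univ_prod_univ, Measure.prod_prod]
      simp
    · conv_lhs => rw [h.step (j + 1) (by omega), Measure.map_add _ _ hp, Measure.map_smul,
        Measure.map_finset_sum hp.aemeasurable, sum_Ico_succ _ hj, Nat.add_sub_cancel]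
      congr 1
      · rw [hc]
        congr 1
        split_ifs with hj1
        · subst hj1
          exact map_pruned_graft_one _ (h.ae_order le_rfl) (h.ae_order le_rfl)
        · obtain ⟨k, rfl⟩ : ∃ k, j = k + 1 := ⟨j - 1, by omega⟩
          rw [map_pruned_graft _ (h2 k (by omega)) (h2 k (by omega)), ih k (by omega) (by omega),
            Nat.add_sub_cancel]
      · rw [hL]
        congr 1
        · refine Finset.sum_congr rfl fun i hi => ?_
          have hi := Finset.mem_Ico.1 hi
          rw [Measure.map_smul, map_pruned_graft _ (h2 j hj) (h2 i hi.1), ih i hi.2 hi.1]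
        · rw [Measure.map_smul, map_pruned_graft_left _ (h2 j hj) (h.ae_order le_rfl)]
    · have hκ : sideProb T 1 (j + 1) = ENNReal.ofReal (T j / relRate T (j + 1)) := by
        rw [sideProb, Nat.add_sub_cancel]
      rw [hL, hc, hκ]
      rcases hj.eq_or_lt with rfl | hj'
      · have ht : termProb T 1 = 1 := by simp [termProb, relRate]
        rw [ht, mul_one] at hterm
        rw [h'.one, if_pos rfl, ← hterm]
        simpa using map_leaf_eq_of_wait_eq (hw 1 le_rfl)
      · have hg : ∀ m : Measure (PlaneTree α × PlaneTree α), SFinite m → graft (w' j) m = _ :=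
          fun m _ => graft_eq_of_wait_eq (hw j hj) m
        have hpr : prolong (w (j + 1)) (ν' j) =
            termProb T j • prolong (w (j + 1)) (graft (w' j) ((ν' (j - 1)).prod (ν' (j - 1))))
            + ∑ i ∈ Finset.Ico 1 j, sideProb T i j •
              prolong (w (j + 1)) (graft (w' j) ((ν' j).prod (ν' i))) := by
          conv_lhs => rw [h'.step j hj']
          have hsf : SFinite (∑ i ∈ Finset.Ico 1 j,
              sideProb T i j • graft (w' j) ((ν' j).prod (ν' i))) := by
            have hle : ∑ i ∈ Finset.Ico 1 j,
                sideProb T i j • graft (w' j) ((ν' j).prod (ν' i)) ≤ ν' j := by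
              conv_rhs => rw [h'.step j hj']
              exact Measure.le_add_left le_rfl
            have := isFiniteMeasure_of_le _ hle
            infer_instance
          rw [prolong_add, prolong_smul, prolong_finsetSum]
        beta_reduce
        rw [if_neg (by omega), hpr]
        conv_lhs => rw [h'.step j hj', hg _ inferInstance,
          Finset.sum_congr rfl fun i _ => by rw [hg ((ν' j).prod (ν' i)) inferInstance]]
        simp only [smul_add, Finset.sum_add_distrib, Finset.smul_sum, smul_smul, ← hterm, ← hside,
          mul_comm (termProb T j), mul_comm (sideProb T _ j)]
        abel

end prune

end

/-! ## Exponential waiting times -/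

noncomputable section

theorem lintegral_exp_neg_expMeasure {r s : ℝ} (hr : 0 < r) (hs : 0 < s) :
    ∫⁻ x, ENNReal.ofReal (Real.exp (-(s * x))) ∂(expMeasure r) = ENNReal.ofReal (r / (r + s)) := by
  have hm : Measurable (exponentialPDF r) := (measurable_exponentialPDFReal r).ennreal_ofReal
  have hm' : Measurable (exponentialPDF (r + s)) :=
    (measurable_exponentialPDFReal (r + s)).ennreal_ofReal
  change ∫⁻ x, _ ∂(volume.withDensity (exponentialPDF r)) = _
  rw [lintegral_withDensity_eq_lintegral_mul _ hm (by fun_prop)]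
  have h1 : ∀ x, (exponentialPDF r * fun x => ENNReal.ofReal (Real.exp (-(s * x)))) x
      = ENNReal.ofReal (r / (r + s)) * exponentialPDF (r + s) x := by
    intro x
    rw [Pi.mul_apply, exponentialPDF_eq, exponentialPDF_eq]
    split_ifs
    · rw [← ENNReal.ofReal_mul (by positivity), ← ENNReal.ofReal_mul (by positivity), mul_assoc,
        ← Real.exp_add]
      congr 1
      rw [← mul_assoc, div_mul_cancel₀ _ (by positivity)]
      congr 2
      ring
    · simp
  rw [lintegral_congr h1, lintegral_const_mul _ hm',
    lintegral_exponentialPDF_eq_one (by positivity),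
    mul_one]

theorem charFun_expMeasure {r : ℝ} (hr : 0 < r) (t : ℝ) :
    charFun (expMeasure r) t = r / (r - t * Complex.I) := by
  have hm : Measurable (exponentialPDF r) := (measurable_exponentialPDFReal r).ennreal_ofReal
  rw [charFun_apply_real]
  change ∫ x, _ ∂(volume.withDensity (exponentialPDF r)) = _
  rw [integral_withDensity_eq_integral_toReal_smul hm
    (Filter.Eventually.of_forall fun x => ENNReal.ofReal_lt_top)]
  have h1 : ∀ x : ℝ, (exponentialPDF r x).toReal • Complex.exp (t * x * Complex.I)
      = (Set.Ici (0 : ℝ)).indicator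
        (fun x : ℝ => (r : ℂ) * Complex.exp ((-r + t * Complex.I) * x)) x := by
    intro x
    rw [exponentialPDF_eq, Set.indicator_apply]
    simp only [Set.mem_Ici]
    split_ifs
    · rw [ENNReal.toReal_ofReal (by positivity), Complex.real_smul]
      push_cast
      rw [mul_assoc, ← Complex.exp_add]
      congr 2
      ring
    · simp
  simp_rw [h1]
  have hre : (-(r : ℂ) + t * Complex.I).re < 0 := by simp [hr]
  have hne : (r : ℂ) - t * Complex.I ≠ 0 := by
    intro h0
    have := congrArg Complex.re h0
    simp at this
    exact hr.ne' this
  have hne' : -(r : ℂ) + t * Complex.I ≠ 0 := by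
    intro h0
    rw [h0] at hre
    simp at hre
  rw [integral_indicator measurableSet_Ici, integral_Ici_eq_integral_Ioi,
    integral_const_mul, integral_exp_mul_complex_Ioi hre]
  simp
  field_simp
  ring

theorem expMeasure_map_mul {r c : ℝ} (hr : 0 < r) (hc : 0 < c) :
    (expMeasure r).map (c * ·) = expMeasure (r / c) := by
  have := isProbabilityMeasure_expMeasure hr
  have := isProbabilityMeasure_expMeasure (div_pos hr hc)
  refine Measure.ext_of_charFun (funext fun t => ?_)
  rw [charFun_map_mul, charFun_expMeasure hr, charFun_expMeasure (div_pos hr hc)]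
  have : (c : ℂ) ≠ 0 := by exact_mod_cast hc.ne'
  push_cast
  rw [show (r : ℂ) - c * t * Complex.I = c * (r / c - t * Complex.I) by field_simp, ← div_div]

/-- A geometric sum of exponential variables is exponential. -/
theorem expMeasure_eq_geometric {q r : ℝ} (hq : 0 < q) (hqr : q ≤ r) :
    expMeasure q = ENNReal.ofReal (q / r) • expMeasure r + ENNReal.ofReal ((r - q) / r) •
      ((expMeasure r).prod (expMeasure q)).map fun x => x.1 + x.2 := by
  have hr : 0 < r := hq.trans_le hqr
  have := isProbabilityMeasure_expMeasure hr
  have := isProbabilityMeasure_expMeasure hq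
  change _ = _ + ENNReal.ofReal ((r - q) / r) • (expMeasure r ∗ expMeasure q)
  have hf : IsFiniteMeasure (ENNReal.ofReal (q / r) • expMeasure r) :=
    Measure.smul_finite _ ENNReal.ofReal_ne_top
  have hf' : IsFiniteMeasure (ENNReal.ofReal ((r - q) / r) • (expMeasure r ∗ expMeasure q)) :=
    Measure.smul_finite _ ENNReal.ofReal_ne_top
  refine Measure.ext_of_charFun (funext fun t => ?_)
  have hb : ∀ (μ : Measure ℝ) [IsFiniteMeasure μ],
      Integrable (fun x : ℝ => Complex.exp (t * x * Complex.I)) μ := by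
    intro μ _
    refine Integrable.of_bound (by fun_prop) 1 (Filter.Eventually.of_forall fun x => ?_)
    rw [← Complex.ofReal_mul, Complex.norm_exp_ofReal_mul_I]
  have hadd : charFun (ENNReal.ofReal (q / r) • expMeasure r +
      ENNReal.ofReal ((r - q) / r) • (expMeasure r ∗ expMeasure q)) t
      = (q / r : ℝ) * charFun (expMeasure r) t
        + ((r - q) / r : ℝ) * charFun (expMeasure r ∗ expMeasure q) t := by
    simp only [charFun_apply_real]
    rw [integral_add_measure (hb _) (hb _), integral_smul_measure, integral_smul_measure,
      ENNReal.toReal_ofReal (by positivity),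
      ENNReal.toReal_ofReal (div_nonneg (by linarith) hr.le), Complex.real_smul, Complex.real_smul]
  have hne : ∀ {r : ℝ}, 0 < r → (r : ℂ) - t * Complex.I ≠ 0 := by
    intro r hr h0
    have := congrArg Complex.re h0
    simp at this
    exact hr.ne' this
  rw [hadd, charFun_conv, charFun_expMeasure hr, charFun_expMeasure hq]
  have h1 := hne hr
  have h2 := hne hq
  have h3 : (r : ℂ) ≠ 0 := by exact_mod_cast hr.ne'
  push_cast
  field_simp
  ring

theorem measurableEmbedding_coe : MeasurableEmbedding ((↑) : EdgeLength → ℝ) :=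
  MeasurableEmbedding.subtype_coe measurableSet_Ioi

/-- The exponential law gives no mass to `(-∞, 0]`, so nothing is lost by pulling it back to
positive lengths. -/
theorem map_coe_comap_expMeasure {r : ℝ} (hr : 0 < r) :
    ((expMeasure r).comap ((↑) : EdgeLength → ℝ)).map (↑) = expMeasure r := by
  have := isProbabilityMeasure_expMeasure hr
  rw [measurableEmbedding_coe.map_comap, Measure.restrict_eq_self_of_ae_mem]
  have h1 : (expMeasure r) (Set.Iic 0) = 0 := by
    change (volume.withDensity (exponentialPDF r)) _ = 0
    rw [withDensity_apply _ measurableSet_Iic, lintegral_exponentialPDF_eq_antiDeriv hr]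
    simp
  rw [ae_iff]
  convert h1 using 2
  ext x
  simp

theorem eq_of_map_coe_eq {μ ν : Measure EdgeLength}
    (h : μ.map ((↑) : EdgeLength → ℝ) = ν.map (↑)) : μ = ν := by
  rw [← measurableEmbedding_coe.comap_map μ, h, measurableEmbedding_coe.comap_map]

/-! ### Waiting times of the process -/

section wait

variable {T lam : ℕ → ℝ}

/-- The termination rate factors out, so it cancels from all event probabilities and affects only
lengths. -/
theorem totalRate_eq (T lam : ℕ → ℝ) (j : ℕ) : totalRate T lam j = lam j * relRate T j := by
  rw [totalRate, relRate, mul_add, mul_one, Finset.mul_sum]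

theorem totalRate_pos (hT : ∀ k, 1 ≤ k → 0 ≤ T k) {j : ℕ} (hj : 0 < lam j) :
    0 < totalRate T lam j := by
  rw [totalRate_eq]
  exact mul_pos hj (relRate_pos hT j)

theorem map_coe_waitLaw (hT : ∀ k, 1 ≤ k → 0 ≤ T k) {j : ℕ} (hj : 0 < lam j) :
    (waitLaw T lam j).map (↑) = expMeasure (totalRate T lam j) :=
  map_coe_comap_expMeasure (totalRate_pos hT hj)

theorem isProbabilityMeasure_waitLaw (hT : ∀ k, 1 ≤ k → 0 ≤ T k) {j : ℕ} (hj : 0 < lam j) :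
    IsProbabilityMeasure (waitLaw T lam j) := by
  constructor
  have h1 := isProbabilityMeasure_expMeasure (totalRate_pos hT hj)
  have h2 := congrArg (fun m : Measure ℝ => m Set.univ) (map_coe_waitLaw hT hj)
  rw [Measure.map_apply measurable_subtype_coe .univ, measure_univ] at h2
  exact h2

theorem lintegral_exp_neg_waitLaw (hT : ∀ k, 1 ≤ k → 0 ≤ T k) {j : ℕ} (hj : 0 < lam j) {s : ℝ}
    (hs : 0 < s) : ∫⁻ x : EdgeLength, ENNReal.ofReal (Real.exp (-(s * x))) ∂(waitLaw T lam j)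
      = ENNReal.ofReal (totalRate T lam j / (totalRate T lam j + s)) := by
  rw [← lintegral_exp_neg_expMeasure (totalRate_pos hT hj) hs, ← map_coe_waitLaw hT hj,
    lintegral_map (by fun_prop) measurable_subtype_coe]

theorem measurable_edgeLength_mul (c : EdgeLength) : Measurable fun a : EdgeLength => c * a := by
  refine Measurable.subtype_mk (f := fun a : EdgeLength => (c : ℝ) * (a : ℝ)) ?_
  fun_prop

theorem waitLaw_map_mul {lam' : ℕ → ℝ} (hT : ∀ k, 1 ≤ k → 0 ≤ T k) {j : ℕ} (hj : 0 < lam j)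
    (c : EdgeLength) (hc : lam' j = lam j / c) :
    (waitLaw T lam j).map (fun a => c * a) = waitLaw T lam' j := by
  have hc0 : (0 : ℝ) < c := c.2
  refine eq_of_map_coe_eq ?_
  rw [map_coe_waitLaw hT (by rw [hc]; exact div_pos hj hc0), totalRate_eq, hc, div_mul_eq_mul_div,
    ← totalRate_eq, ← expMeasure_map_mul (totalRate_pos hT hj) hc0, ← map_coe_waitLaw hT hj,
    Measure.map_map measurable_subtype_coe (measurable_edgeLength_mul c),
    Measure.map_map (by fun_prop) measurable_subtype_coe]
  rfl

theorem relRate_succ (T : ℕ → ℝ) {j : ℕ} (hj : 1 ≤ j) : relRate T (j + 1) = relRate T j + T j := by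
  rw [relRate, relRate, sum_Ico_succ _ hj, Nat.add_sub_cancel, ← add_assoc]
  simp

/-- Of the total rate `lam (j + 1) * relRate T (j + 1)`, the part `lam (j + 1) * T j` belongs to
order-one births. What remains is `lam (j + 1) * relRate T j`, the total rate at order `j` with
termination rate `lam (j + 1)`. -/
theorem waitLaw_succ (hT : ∀ k, 1 ≤ k → 0 ≤ T k) {j : ℕ} (hj : 1 ≤ j) (hl : 0 < lam (j + 1))
    {lam' : ℕ → ℝ} (hlam' : lam' j = lam (j + 1)) :
    waitLaw T lam' j =
      ENNReal.ofReal (relRate T j / relRate T (j + 1)) • waitLaw T lam (j + 1)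
      + ENNReal.ofReal (T j / relRate T (j + 1)) • ((waitLaw T lam (j + 1)).prod
        (waitLaw T lam' j)).map fun x => x.1 + x.2 := by
  have hl' : 0 < lam' j := by rwa [hlam']
  have hr := relRate_pos hT j
  have hr' := relRate_pos hT (j + 1)
  have := isProbabilityMeasure_waitLaw hT hl
  have := isProbabilityMeasure_waitLaw hT hl'
  have hadd : Measurable fun x : EdgeLength × EdgeLength => x.1 + x.2 := measurable_add
  have hv : Measurable ((↑) : EdgeLength → ℝ) := measurable_subtype_coe
  refine eq_of_map_coe_eq ?_
  have h1 : ((waitLaw T lam (j + 1)).prod (waitLaw T lam' j)).map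
      (((↑) : EdgeLength → ℝ) ∘ fun x => x.1 + x.2)
      = ((expMeasure (totalRate T lam (j + 1))).prod
        (expMeasure (totalRate T lam' j))).map fun x => x.1 + x.2 := by
    rw [← map_coe_waitLaw hT hl, ← map_coe_waitLaw hT hl', Measure.map_prod_map _ _ hv hv,
      Measure.map_map measurable_add (hv.prodMap hv)]
    rfl
  rw [Measure.map_add _ _ hv, Measure.map_smul, Measure.map_smul, Measure.map_map hv hadd, h1,
    map_coe_waitLaw hT hl, map_coe_waitLaw hT hl']
  have e := expMeasure_eq_geometric (q := totalRate T lam' j)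
    (r := totalRate T lam (j + 1)) (totalRate_pos hT hl') (by
      rw [totalRate_eq, totalRate_eq, hlam', relRate_succ T hj]
      exact mul_le_mul_of_nonneg_left (by linarith [hT j hj]) hl.le)
  have e1 : totalRate T lam' j / totalRate T lam (j + 1)
      = relRate T j / relRate T (j + 1) := by
    rw [totalRate_eq, totalRate_eq, hlam']
    field_simp
  have e2 : (totalRate T lam (j + 1) - totalRate T lam' j)
      / totalRate T lam (j + 1) = T j / relRate T (j + 1) := by
    rw [totalRate_eq, totalRate_eq, hlam']
    have := relRate_succ T hj
    field_simp
    linarith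
  rwa [e1, e2] at e

end wait

end

/-! ## The laws of the trees of the hierarchical branching process -/

noncomputable section

open PlaneTree

/-- A shape is a leaf or consists of two subtrees. -/
def shapeEquiv : Unit ⊕ (PlaneTree Unit × PlaneTree Unit) ≃ PlaneTree Unit where
  toFun x := x.elim (fun _ => leaf ()) (fun p => node () p.1 p.2)
  invFun
    | leaf _ => .inl ()
    | node _ l r => .inr (l, r)
  left_inv x := by rcases x with _ | ⟨l, r⟩ <;> rfl
  right_inv t := by cases t <;> rfl

theorem tsum_shape (f : PlaneTree Unit → ℝ≥0∞) :
    ∑' s, f s = f (leaf ()) + ∑' l, ∑' r, f (node () l r) := by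
  rw [← shapeEquiv.tsum_eq f, Summable.tsum_sum ENNReal.summable ENNReal.summable,
    ENNReal.tsum_prod']
  simp [shapeEquiv]

theorem branchLaw_one (T lam : ℕ → ℝ) : branchLaw T lam 1 = (waitLaw T lam 1).map leaf := by
  refine Measure.ext fun B hB => ?_
  rw [branchLaw, Measure.sum_apply _ hB, tsum_shape]
  simp [historyLaw]

section

variable {T lam : ℕ → ℝ} (hT : ∀ k, 1 ≤ k → 0 ≤ T k) (hlam : ∀ j, 1 ≤ j → 0 < lam j)
include hT hlam

theorem ofReal_term {j : ℕ} (hj : 1 ≤ j) :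
    ENNReal.ofReal (lam j / totalRate T lam j) = termProb T j := by
  have := hlam j hj
  have := relRate_pos hT j
  rw [termProb, totalRate_eq]
  congr 1
  field_simp

theorem ofReal_side {j : ℕ} (hj : 1 ≤ j) (i : ℕ) :
    ENNReal.ofReal (lam j * T (j - i) / totalRate T lam j) = sideProb T i j := by
  have := hlam j hj
  have := relRate_pos hT j
  rw [sideProb, totalRate_eq]
  congr 1
  field_simp

theorem historyLaw_node (u : Unit) (l r : PlaneTree Unit) {j : ℕ} (hj : 2 ≤ j) :
    historyLaw T lam (node u l r) j =
      termProb T j • graft (waitLaw T lam j)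
        ((historyLaw T lam l (j - 1)).prod (historyLaw T lam r (j - 1)))
      + ∑ i ∈ Finset.Ico 1 j, sideProb T i j • graft (waitLaw T lam j)
        ((historyLaw T lam l j).prod (historyLaw T lam r i)) := by
  rw [historyLaw, if_pos hj, ofReal_term hT hlam (by omega)]
  simp only [ofReal_side hT hlam (by omega : 1 ≤ j)]
  rfl

theorem isFiniteMeasure_historyLaw (s : PlaneTree Unit) (j : ℕ) :
    IsFiniteMeasure (historyLaw T lam s j) := by
  induction s generalizing j with
  | leaf u =>
    rw [historyLaw]
    split_ifs
    · have := isProbabilityMeasure_waitLaw hT (hlam 1 le_rfl)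
      infer_instance
    · infer_instance
  | node u l r hl hr =>
    by_cases hj : 2 ≤ j
    · rw [historyLaw_node hT hlam u l r hj]
      have := isProbabilityMeasure_waitLaw hT (hlam j (by omega))
      constructor
      rw [Measure.add_apply, Measure.coe_finsetSum, Finset.sum_apply]
      refine ENNReal.add_lt_top.2 ⟨?_, ENNReal.sum_lt_top.2 fun i _ => ?_⟩
      · exact ENNReal.mul_lt_top ENNReal.ofReal_lt_top (measure_lt_top _ _)
      · exact ENNReal.mul_lt_top ENNReal.ofReal_lt_top (measure_lt_top _ _)
    · rw [historyLaw, if_neg hj]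
      infer_instance

theorem historyLaw_node_univ (u : Unit) (l r : PlaneTree Unit) {j : ℕ} (hj : 2 ≤ j) :
    historyLaw T lam (node u l r) j Set.univ =
      termProb T j * (historyLaw T lam l (j - 1) Set.univ * historyLaw T lam r (j - 1) Set.univ)
      + ∑ i ∈ Finset.Ico 1 j, sideProb T i j *
        (historyLaw T lam l j Set.univ * historyLaw T lam r i Set.univ) := by
  have := isFiniteMeasure_historyLaw hT hlam
  have := isProbabilityMeasure_waitLaw hT (hlam j (by omega))
  rw [historyLaw_node hT hlam u l r hj, Measure.add_apply, Measure.coe_finsetSum, Finset.sum_apply]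
  simp only [Measure.smul_apply, graft_univ, measure_univ, one_mul, smul_eq_mul,
    ← Set.univ_prod_univ, Measure.prod_prod]

/-- The left subtree may have the same order as the tree, so the induction runs on the number of
edges: both subtrees of a tree with at most `n + 1` edges have at most `n`. -/
theorem tsum_truncated_le_one (n j : ℕ) :
    ∑' s : PlaneTree Unit, (if s.size ≤ n then historyLaw T lam s j Set.univ else 0) ≤ 1 := by
  induction n generalizing j with
  | zero =>
    have h : ∀ s : PlaneTree Unit, ¬ s.size ≤ 0 := by
      intro s
      cases s <;> simp [size]
    simp [h]
  | succ n ih =>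
    rw [tsum_shape]
    by_cases hj : 2 ≤ j
    · have hle : ∀ l r : PlaneTree Unit, (if (node () l r).size ≤ n + 1 then
          historyLaw T lam (node () l r) j Set.univ else 0) ≤
          termProb T j * ((if l.size ≤ n then historyLaw T lam l (j - 1) Set.univ else 0)
            * (if r.size ≤ n then historyLaw T lam r (j - 1) Set.univ else 0))
          + ∑ i ∈ Finset.Ico 1 j, sideProb T i j *
            ((if l.size ≤ n then historyLaw T lam l j Set.univ else 0)
            * (if r.size ≤ n then historyLaw T lam r i Set.univ else 0)) := by
        intro l r
        split_ifs with h1 h2 h3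
        · exact (historyLaw_node_univ hT hlam () l r hj).le
        · simp only [size] at h1
          omega
        · simp only [size] at h1
          omega
        · simp only [size] at h1
          omega
        all_goals simp
      have h0 : historyLaw T lam (leaf ()) j = 0 := by
        rw [historyLaw, if_neg (by omega)]
      rw [h0]
      calc _ ≤ 0 + ∑' l : PlaneTree Unit, ∑' r : PlaneTree Unit,
            (termProb T j * ((if l.size ≤ n then historyLaw T lam l (j - 1) Set.univ else 0)
            * (if r.size ≤ n then historyLaw T lam r (j - 1) Set.univ else 0))
          + ∑ i ∈ Finset.Ico 1 j, sideProb T i j *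
            ((if l.size ≤ n then historyLaw T lam l j Set.univ else 0)
            * (if r.size ≤ n then historyLaw T lam r i Set.univ else 0))) := by
            refine add_le_add (by simp) ?_
            exact ENNReal.tsum_le_tsum fun l => ENNReal.tsum_le_tsum fun r => hle l r
        _ = termProb T j * ((∑' l : PlaneTree Unit,
              if l.size ≤ n then historyLaw T lam l (j - 1) Set.univ else 0)
            * (∑' r : PlaneTree Unit,
              if r.size ≤ n then historyLaw T lam r (j - 1) Set.univ else 0))
          + ∑ i ∈ Finset.Ico 1 j, sideProb T i j *
            ((∑' l : PlaneTree Unit, if l.size ≤ n then historyLaw T lam l j Set.univ else 0)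
            * (∑' r : PlaneTree Unit,
              if r.size ≤ n then historyLaw T lam r i Set.univ else 0)) := by
            simp only [ENNReal.tsum_add, ENNReal.tsum_mul_left, ENNReal.tsum_mul_right,
              Summable.tsum_finsetSum fun _ _ => ENNReal.summable, zero_add]
        _ ≤ termProb T j * (1 * 1) + ∑ i ∈ Finset.Ico 1 j, sideProb T i j * (1 * 1) := by
            gcongr <;> exact ih _
        _ = 1 := by
            simp only [mul_one]
            exact termProb_add_sideTotal hT j
    · have h1 : ∀ l r, historyLaw T lam (node () l r) j = 0 := by
        intro l r
        rw [historyLaw, if_neg hj]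
      have h2 : historyLaw T lam (leaf ()) j Set.univ ≤ 1 := by
        rw [historyLaw]
        split_ifs
        · have := isProbabilityMeasure_waitLaw hT (hlam 1 le_rfl)
          have : IsProbabilityMeasure ((waitLaw T lam 1).map leaf) :=
            Measure.isProbabilityMeasure_map measurable_leaf.aemeasurable
          exact measure_univ.le
        · simp
      simp only [h1]
      simp only [Measure.coe_zero, Pi.zero_apply, ite_self, tsum_zero, add_zero]
      split_ifs
      · exact h2
      · simp

theorem branchLaw_univ_le_one (j : ℕ) : branchLaw T lam j Set.univ ≤ 1 := by
  rw [branchLaw, Measure.sum_apply _ .univ, ENNReal.tsum_eq_iSup_sum]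
  refine iSup_le fun A => ?_
  -- All shapes in the finite set `A` have size at most `A.sup size`, so this truncation discards
  -- none of them.
  refine le_trans ?_ (tsum_truncated_le_one hT hlam (A.sup size) j)
  refine le_trans (Finset.sum_le_sum fun s hs => ?_) (ENNReal.sum_le_tsum A)
  rw [if_pos (Finset.le_sup hs)]

theorem branchLaw_step {j : ℕ} (hj : 2 ≤ j) :
    branchLaw T lam j = termProb T j • graft (waitLaw T lam j)
        ((branchLaw T lam (j - 1)).prod (branchLaw T lam (j - 1)))
      + ∑ i ∈ Finset.Ico 1 j, sideProb T i j • graft (waitLaw T lam j)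
        ((branchLaw T lam j).prod (branchLaw T lam i)) := by
  have := isFiniteMeasure_historyLaw hT hlam
  have := isProbabilityMeasure_waitLaw hT (hlam j (by omega))
  have hg : ∀ p q : ℕ, ∀ B : Set (PlaneTree EdgeLength), MeasurableSet B →
      graft (waitLaw T lam j) ((branchLaw T lam p).prod (branchLaw T lam q)) B =
      ∑' l, ∑' r, graft (waitLaw T lam j)
        ((historyLaw T lam l p).prod (historyLaw T lam r q)) B := by
    intro p q B hB
    rw [graft, branchLaw, branchLaw, Measure.prod_sum, Measure.prod_sum_right,
      Measure.map_sum measurable_node.aemeasurable, Measure.sum_apply _ hB, ENNReal.tsum_prod']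
    rfl
  have h0 : historyLaw T lam (leaf ()) j = 0 := by
    rw [historyLaw, if_neg (by omega)]
  refine Measure.ext fun B hB => ?_
  conv_lhs => rw [branchLaw, Measure.sum_apply _ hB, tsum_shape, h0]
  simp only [historyLaw_node hT hlam () _ _ hj, Measure.add_apply, Measure.coe_finsetSum,
    Finset.sum_apply, Measure.smul_apply, smul_eq_mul, hg _ _ B hB, ENNReal.tsum_add,
    ENNReal.tsum_mul_left, Summable.tsum_finsetSum fun _ _ => ENNReal.summable, Measure.coe_zero,
    Pi.zero_apply, zero_add]

/-- The process generates a finite tree almost surely: its total mass is at most one, hence finite,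
and solves `x = termProb + sideTotal * x`, as does one. -/
theorem branchFamily : BranchFamily T (waitLaw T lam) (branchLaw T lam) := by
  have hfin : ∀ j, IsFiniteMeasure (branchLaw T lam j) := fun j =>
    ⟨(branchLaw_univ_le_one hT hlam j).trans_lt ENNReal.one_lt_top⟩
  refine ⟨hT, fun j hj => isProbabilityMeasure_waitLaw hT (hlam j hj), hfin, fun j hj => ⟨?_⟩,
    branchLaw_one T lam, fun j hj => branchLaw_step hT hlam hj⟩
  induction j using Nat.strong_induction_on with
  | _ j ih =>
    rcases hj.eq_or_lt with rfl | hj'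
    · have := isProbabilityMeasure_waitLaw hT (hlam 1 le_rfl)
      have : IsProbabilityMeasure ((waitLaw T lam 1).map leaf) :=
        Measure.isProbabilityMeasure_map measurable_leaf.aemeasurable
      rw [branchLaw_one T lam, measure_univ]
    · have := isProbabilityMeasure_waitLaw hT (hlam j hj)
      refine eq_of_affine (c := termProb T j) (sideTotal_lt_one hT j) (measure_ne_top _ _)
        ENNReal.one_ne_top ?_ ?_
      · conv_lhs => rw [branchLaw_step hT hlam hj', Measure.add_apply, Measure.coe_finsetSum,
          Finset.sum_apply]
        simp only [Measure.smul_apply, graft_univ, measure_univ, one_mul, smul_eq_mul,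
          ← Set.univ_prod_univ, Measure.prod_prod]
        rw [ih (j - 1) (by omega) (by omega), mul_one, mul_one, sideTotal, Finset.sum_mul]
        congr 1
        refine Finset.sum_congr rfl fun i hi => ?_
        rw [ih i (Finset.mem_Ico.1 hi).2 (Finset.mem_Ico.1 hi).1, mul_one]
      · rw [mul_one, termProb_add_sideTotal hT]

end

end

/-! ## Mixtures of branch laws over the order -/

noncomputable section

open PlaneTree

theorem cond_eq_of_restrict_eq {X : Type*} [MeasurableSpace X] {μ ν : Measure X} {c : ℝ≥0∞}
    (hc : c ≠ 0) (hc' : c ≠ ∞) {B : Set X}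
    (h : μ.restrict B = c • ν.restrict B) : μ[|B] = ν[|B] := by
  have h1 : μ B = c * ν B := by
    have := congrArg (fun m : Measure X => m Set.univ) h
    simpa using this
  rw [ProbabilityTheory.cond, ProbabilityTheory.cond, h, h1, smul_smul,
    ENNReal.mul_inv (.inl hc) (.inl hc'), mul_right_comm, ENNReal.inv_mul_cancel hc hc', one_mul]

variable {α : Type} [MeasurableSpace α]

/-- The law of the tree without embedding whose initial branch has order `K` with
probability `p K`. -/
def mixLaw (p : ℕ → ℝ) (ν : ℕ → Measure (PlaneTree α)) : Measure (BinTree α) :=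
  Measure.sum fun K : ℕ => ENNReal.ofReal (p (K + 1)) • (ν (K + 1)).map BinTree.ofPlane

theorem mixLaw_apply (p : ℕ → ℝ) (ν : ℕ → Measure (PlaneTree α)) {B : Set (BinTree α)}
    (hB : MeasurableSet B) :
    mixLaw p ν B = ∑' K, ENNReal.ofReal (p (K + 1)) * ν (K + 1) (BinTree.ofPlane ⁻¹' B) := by
  rw [mixLaw, Measure.sum_apply _ hB]
  simp only [Measure.smul_apply, Measure.map_apply BinTree.measurable_ofPlane hB, smul_eq_mul]

theorem mixLaw_map_shape (p : ℕ → ℝ) (ν : ℕ → Measure (PlaneTree α)) :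
    (mixLaw p ν).map BinTree.shape = mixLaw p fun j => (ν j).map (PlaneTree.map fun _ => ()) := by
  rw [mixLaw, mixLaw, Measure.map_sum BinTree.measurable_shape.aemeasurable]
  congr 1
  funext K
  rw [Measure.map_smul, Measure.map_map BinTree.measurable_shape BinTree.measurable_ofPlane,
    Measure.map_map BinTree.measurable_ofPlane (PlaneTree.measurable_map measurable_const)]
  rfl

/-! ### Conditioning, subtrees and pruning of a mixture -/

section ofFamily

variable {T : ℕ → ℝ} {w w' : ℕ → Measure α} {ν ν' : ℕ → Measure (PlaneTree α)} {p : ℕ → ℝ}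
  (h : BranchFamily T w ν) {K : ℕ} (hK : 1 ≤ K)
include h

theorem BranchFamily.isProbabilityMeasure_map_ofPlane (hK : 1 ≤ K) :
    IsProbabilityMeasure ((ν K).map BinTree.ofPlane) := by
  have := h.prob K hK
  exact Measure.isProbabilityMeasure_map BinTree.measurable_ofPlane.aemeasurable

theorem BranchFamily.ae_order_ofPlane (hK : 1 ≤ K) :
    ∀ᵐ t ∂((ν K).map BinTree.ofPlane), t.order = K :=
  (ae_map_iff BinTree.measurable_ofPlane.aemeasurable (BinTree.measurableSet_ordEq K)).2
    (h.ae_order hK)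

theorem BranchFamily.map_ofPlane_restrict (hK : 1 ≤ K) :
    ((ν K).map BinTree.ofPlane).restrict (ordEq α K) = (ν K).map BinTree.ofPlane :=
  Measure.restrict_eq_self_of_ae_mem (h.ae_order_ofPlane hK)

theorem BranchFamily.map_ofPlane_ordEq (hK : 1 ≤ K) :
    (ν K).map BinTree.ofPlane (ordEq α K) = 1 := by
  have := h.isProbabilityMeasure_map_ofPlane hK
  rw [← Measure.restrict_apply_univ, h.map_ofPlane_restrict hK, measure_univ]

include hK

theorem mixLaw_restrict :
    (mixLaw p ν).restrict (ordEq α K) = ENNReal.ofReal (p K) • (ν K).map BinTree.ofPlane := by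
  refine Measure.ext fun B hB => ?_
  have hO := BinTree.measurableSet_ordEq (α := α) K
  -- Almost surely the tree has the order of its initial branch, so one term survives; the summation
  -- index `K - 1` stands for order `K`.
  rw [Measure.restrict_apply hB, mixLaw_apply _ _ (hB.inter hO), tsum_eq_single (K - 1),
    Nat.sub_add_cancel hK]
  · conv_rhs => rw [← h.map_ofPlane_restrict hK]
    rw [Measure.smul_apply, Measure.restrict_apply hB,
      Measure.map_apply BinTree.measurable_ofPlane (hB.inter hO), smul_eq_mul]
  · intro k hk
    have h1 : ν (k + 1) (BinTree.ofPlane ⁻¹' (B ∩ ordEq α K)) = 0 := by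
      refine measure_mono_null ?_ (ae_iff.1 (h.ae_order (by omega : 1 ≤ k + 1)))
      rintro t ⟨_, ht⟩ h'
      have ht : t.order = K := ht
      omega
    rw [h1, mul_zero]

theorem mixLaw_restrict_of_subset {B : Set (BinTree α)} (hB : MeasurableSet B)
    (hBK : B ⊆ ordEq α K) :
    (mixLaw p ν).restrict B = ENNReal.ofReal (p K) • ((ν K).map BinTree.ofPlane).restrict B := by
  rw [← Measure.restrict_smul, ← mixLaw_restrict h hK, Measure.restrict_restrict hB,
    Set.inter_eq_left.2 hBK]

theorem mixLaw_ordEq : mixLaw p ν (ordEq α K) = ENNReal.ofReal (p K) := by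
  have := h.isProbabilityMeasure_map_ofPlane hK
  have h1 := congrArg (fun m : Measure (BinTree α) => m Set.univ) (mixLaw_restrict (p := p) h hK)
  simpa using h1

theorem cond_mixLaw (hp : 0 < p K) {B : Set (BinTree α)} (hB : MeasurableSet B)
    (hBK : B ⊆ ordEq α K) : (mixLaw p ν)[|B] = ((ν K).map BinTree.ofPlane)[|B] :=
  cond_eq_of_restrict_eq (ENNReal.ofReal_pos.2 hp).ne' ENNReal.ofReal_ne_top
    (mixLaw_restrict_of_subset h hK hB hBK)

theorem condOrder_mixLaw (hp : 0 < p K) :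
    condOrder (mixLaw p ν) K = (ν K).map BinTree.ofPlane := by
  rw [condOrder, cond_mixLaw h hK hp (BinTree.measurableSet_ordEq K) subset_rfl,
    ProbabilityTheory.cond, h.map_ofPlane_ordEq hK, inv_one, one_smul, h.map_ofPlane_restrict hK]

theorem pos_of_mixLaw_ordEq_ne_zero (h0 : mixLaw p ν (ordEq α K) ≠ 0) : 0 < p K := by
  rw [mixLaw_ordEq h hK] at h0
  exact ENNReal.ofReal_pos.1 (pos_iff_ne_zero.2 h0)

/-- Coordination. -/
theorem subtreeLaw_mixLaw {H : ℕ} (hKH : K ≤ H) (hpH : 0 < p H) :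
    subtreeLaw (mixLaw p ν) K H = (ν K).map BinTree.ofPlane := by
  refine Measure.ext fun B hB => ?_
  have hU := BinTree.measurable_uniformOn_completeSubtrees (α := α) K
  rw [subtreeLaw, Measure.bind_apply hB hU.aemeasurable, condOrder_mixLaw h (hK.trans hKH) hpH,
    lintegral_map (show Measurable fun t : BinTree α => uniformOn (t.completeSubtrees K) B from
      (Measure.measurable_coe hB).comp hU) BinTree.measurable_ofPlane,
    Measure.map_apply BinTree.measurable_ofPlane hB]
  have hi : Measurable ((BinTree.ofPlane ⁻¹' B).indicator (1 : PlaneTree α → ℝ≥0∞)) :=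
    measurable_one.indicator (BinTree.measurable_ofPlane hB)
  rw [← lintegral_indicator_one (BinTree.measurable_ofPlane hB),
    ← h.lintegral_uniform_completeSubtrees hK hKH hi (Set.indicator_le_self' fun _ _ => zero_le)]
  refine lintegral_congr fun t => ?_
  rw [BinTree.uniformOn_apply _ hB, BinTree.completeSubtrees_ofPlane, Multiset.card_map,
    Multiset.map_map]
  rfl

/-- Pruning shifts the orders. -/
theorem mixLaw_map_prune_restrict [Add α] [MeasurableAdd₂ α] (h' : BranchFamily T w' ν')
    (hpr : (ν (K + 1)).map pruned = ν' K) :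
    ((mixLaw p ν).map BinTree.prune).restrict (ordEq α K)
      = ENNReal.ofReal (p (K + 1)) • (ν' K).map BinTree.ofPlane := by
  have hO := BinTree.measurableSet_ordEq (α := α) K
  refine Measure.ext fun B hB => ?_
  have hP : MeasurableSet (BinTree.prune ⁻¹' (B ∩ ordEq α K)) :=
    BinTree.measurable_prune (hB.inter hO)
  -- As `K ≥ 1`, the truncated subtraction in `order_prune` loses nothing: the original tree has
  -- order `K + 1`.
  have hsub : BinTree.prune ⁻¹' (B ∩ ordEq α K) ⊆ ordEq α (K + 1) := by
    rintro t ⟨_, ht⟩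
    have ht : t.prune.order = K := ht
    rw [BinTree.order_prune] at ht
    change t.order = K + 1
    omega
  have h1 := congrArg (fun m : Measure (BinTree α) => m (BinTree.prune ⁻¹' (B ∩ ordEq α K)))
    (mixLaw_restrict (p := p) h (by omega : 1 ≤ K + 1))
  simp only [Measure.restrict_apply hP, Set.inter_eq_left.2 hsub, Measure.smul_apply] at h1
  rw [Measure.restrict_apply hB, Measure.map_apply BinTree.measurable_prune (hB.inter hO), h1,
    ← h'.map_ofPlane_restrict hK, Measure.smul_apply, Measure.restrict_apply hB,
    Measure.map_apply BinTree.measurable_ofPlane hP,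
    Measure.map_apply BinTree.measurable_ofPlane (hB.inter hO), ← hpr,
    Measure.map_apply PlaneTree.measurable_pruned (BinTree.measurable_ofPlane (hB.inter hO))]
  congr 1
  refine measure_congr ((h.ae_order (by omega : 1 ≤ K + 1)).mono fun t ht => ?_)
  change ((BinTree.ofPlane t).prune ∈ B ∩ ordEq α K) = (BinTree.ofPlane t.pruned ∈ B ∩ ordEq α K)
  rw [BinTree.prune_ofPlane_of_two_le (by omega)]

omit hK

theorem isProbabilityMeasure_mixLaw (hp : ∀ K, 1 ≤ K → 0 ≤ p K)
    (hp_sum : HasSum (fun K : ℕ => p (K + 1)) 1) : IsProbabilityMeasure (mixLaw p ν) := by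
  constructor
  rw [mixLaw_apply _ _ .univ]
  have : ∀ K, ENNReal.ofReal (p (K + 1)) * ν (K + 1) (BinTree.ofPlane ⁻¹' Set.univ)
      = ENNReal.ofReal (p (K + 1)) := by
    intro K
    have := h.prob (K + 1) (by omega)
    rw [Set.preimage_univ, measure_univ, mul_one]
  simp only [this]
  rw [← ENNReal.ofReal_tsum_of_nonneg (fun K => hp _ (by omega)) hp_sum.summable, hp_sum.tsum_eq,
    ENNReal.ofReal_one]

omit h

theorem mixLaw_empty (p : ℕ → ℝ) (ν : ℕ → Measure (PlaneTree α)) :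
    mixLaw p ν {BinTree.empty} = 0 := by
  rw [mixLaw_apply _ _ BinTree.measurableSet_empty]
  have : (BinTree.ofPlane ⁻¹' {BinTree.empty} : Set (PlaneTree α)) = ∅ := by
    ext t
    exact ⟨fun h => (BinTree.ofPlane_ne_empty t h).elim, fun h => h.elim⟩
  simp [this]

end ofFamily

/-! ## Combinatorial trees -/

section shapes

/-- Reduces the edge equation required by `BranchFamily.map_pruned` to a comparison of total masses
when edges carry no length. -/
theorem measure_unit_eq {μ ν : Measure Unit} (h : μ Set.univ = ν Set.univ) : μ = ν := by
  refine Measure.ext fun B _ => ?_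
  rcases B.eq_empty_or_nonempty with rfl | hB
  · simp
  · rwa [Subsingleton.eq_univ_of_nonempty hB]

theorem meanBranch_ofPlane (m : Measure (PlaneTree Unit)) (j : ℕ) :
    meanBranch (m.map BinTree.ofPlane) j
      = ∫⁻ t, (Multiset.card (t.completeSubtrees j 0) : ℝ≥0∞) ∂m := by
  rw [meanBranch, lintegral_map (measurable_of_countable _) BinTree.measurable_ofPlane]
  refine lintegral_congr fun t => ?_
  rw [BinTree.branchCount, BinTree.completeSubtrees_ofPlane, Multiset.card_map]

variable {T : ℕ → ℝ} {w : ℕ → Measure Unit} {ν : ℕ → Measure (PlaneTree Unit)} {p : ℕ → ℝ}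
  (h : BranchFamily T w ν) {K : ℕ} (hK : 1 ≤ K)
include h hK

/-- The combinatorial branch laws are invariant under pruning. -/
theorem map_pruned_shape : (ν (K + 1)).map pruned = ν K := by
  refine h.map_pruned h (fun j hj => measure_unit_eq ?_) hK
  have := h.prob_wait j hj
  have := h.prob_wait (j + 1) (by omega)
  have hr := relRate_pos h.nonneg j
  have hr' := relRate_pos h.nonneg (j + 1)
  have hT := h.nonneg j hj
  have hm : Measurable fun x : Unit × Unit => x.1 + x.2 := measurable_of_countable _
  rw [Measure.add_apply, Measure.smul_apply, Measure.smul_apply, Measure.map_apply hm .univ,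
    Set.preimage_univ, measure_univ, measure_univ, measure_univ, smul_eq_mul, smul_eq_mul, mul_one,
    mul_one, ← ENNReal.ofReal_add (by positivity) (by positivity), ← add_div, ← relRate_succ T hj,
    div_self hr'.ne', ENNReal.ofReal_one]

theorem tokunaga_ofPlane {i j : ℕ} (hi : 1 ≤ i) (hij : i < j) (hj : j ≤ K) :
    tokunaga ((ν K).map BinTree.ofPlane) i j = ENNReal.ofReal (T (j - i)) := by
  have h1 : meanSideBranch ((ν K).map BinTree.ofPlane) i j
      = ∫⁻ t, (t.sideBranchCount i j : ℝ≥0∞) ∂(ν K) := by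
    rw [meanSideBranch, lintegral_map (measurable_of_countable _) BinTree.measurable_ofPlane]
    rfl
  rw [tokunaga, h1, meanBranch_ofPlane, h.lintegral_sideBranchCount hi hij hK,
    ENNReal.mul_div_cancel_right (h.lintegral_card_ne_zero (by omega) hj)
      (h.lintegral_card_ne_top j hK)]

theorem condOrder_map_prune (hp : 0 < p (K + 1)) :
    (condOrder (mixLaw p ν) (K + 1)).map BinTree.prune = (ν K).map BinTree.ofPlane := by
  rw [condOrder_mixLaw h (by omega) hp, ← map_pruned_shape h hK,
    Measure.map_map (measurable_of_countable _) BinTree.measurable_ofPlane,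
    Measure.map_map BinTree.measurable_ofPlane PlaneTree.measurable_pruned]
  exact Measure.map_congr ((h.ae_order (by omega : 1 ≤ K + 1)).mono fun t ht =>
    BinTree.prune_ofPlane_of_two_le (by omega))

omit hK

theorem hasTokunagaCoefficients_mixLaw : HasTokunagaCoefficients (mixLaw p ν) T := by
  intro K hK h0 i j hi hij hj
  have hK1 : 1 ≤ K := by omega
  rw [condOrder_mixLaw h hK1 (pos_of_mixLaw_ordEq_ne_zero h hK1 h0),
    tokunaga_ofPlane h hK1 hi hij hj]

theorem isMeanSelfSimilar_mixLaw (hp : ∀ K, 1 ≤ K → 0 ≤ p K)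
    (hp_sum : HasSum (fun K : ℕ => p (K + 1)) 1) : IsMeanSelfSimilar (mixLaw p ν) := by
  have hTok := hasTokunagaCoefficients_mixLaw (p := p) h
  refine ⟨isProbabilityMeasure_mixLaw h hp hp_sum, mixLaw_empty p ν, ?_, ?_, ?_, ?_⟩
  · intro K hK h0 j _ _
    rw [condOrder_mixLaw h hK (pos_of_mixLaw_ordEq_ne_zero h hK h0), meanBranch_ofPlane]
    exact h.lintegral_card_ne_top j hK
  · exact ⟨fun i j => ENNReal.ofReal (T (j - i)), fun K hK h0 i j hi hij hj =>
      hTok K hK h0 i j hi hij hj⟩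
  · exact fun K hK h0 => ⟨fun k => ENNReal.ofReal (T k), fun i j hi hij hj =>
      hTok K hK h0 i j hi hij hj⟩
  · intro K hK h0 h1 i j hi hij hj
    rw [hTok K hK h0 i j hi hij hj, condOrder_map_prune h (by omega)
      (pos_of_mixLaw_ordEq_ne_zero h (by omega) h1), tokunaga_ofPlane h (by omega) hi hij hj]

theorem mixLaw_map_prune_ne_empty (hp : ∀ K, 1 ≤ K → 0 ≤ p K)
    (hp_sum : HasSum (fun K : ℕ => p (K + 1)) 1) :
    (mixLaw p ν).map BinTree.prune {BinTree.empty}ᶜ = ENNReal.ofReal (1 - p 1) := by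
  have := isProbabilityMeasure_mixLaw h hp hp_sum
  have hs : (BinTree.prune ⁻¹' {BinTree.empty} : Set Shape)
      = ordEq Unit 1 ∪ {BinTree.empty} := by
    ext t
    change t.prune = _ ↔ t.order = 1 ∨ t = BinTree.empty
    rw [← BinTree.order_eq_zero, ← BinTree.order_eq_zero, BinTree.order_prune]
    omega
  rw [Measure.map_apply (measurable_of_countable _) .of_discrete, Set.preimage_compl, hs,
    prob_compl_eq_one_sub .of_discrete,
    measure_congr (union_ae_eq_left_of_ae_eq_empty (ae_eq_empty.2 (mixLaw_empty p ν))),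
    mixLaw_ordEq h le_rfl, ENNReal.ofReal_sub _ (hp 1 le_rfl), ENNReal.ofReal_one]

theorem cond_mixLaw_map_prune (hK : 1 ≤ K) (hp : ∀ K, 1 ≤ K → 0 ≤ p K)
    (hp_sum : HasSum (fun K : ℕ => p (K + 1)) 1) {B : Set Shape} (hB : B ⊆ ordEq Unit K) :
    ((mixLaw p ν).map BinTree.prune)[|{BinTree.empty}ᶜ] B
      = (ENNReal.ofReal (1 - p 1))⁻¹ * (ENNReal.ofReal (p (K + 1))
        * (ν K).map BinTree.ofPlane B) := by
  have h1 := congrArg (fun m : Measure Shape => m B)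
    (mixLaw_map_prune_restrict (p := p) h hK h (map_pruned_shape h hK))
  simp only [Measure.restrict_apply (MeasurableSet.of_discrete (s := B)),
    Set.inter_eq_left.2 hB, Measure.smul_apply, smul_eq_mul] at h1
  have h2 : {BinTree.empty}ᶜ ∩ B = B := by
    refine Set.inter_eq_right.2 fun t ht h0 => ?_
    have ht : t.order = K := hB ht
    have h0 : t = BinTree.empty := h0
    rw [← BinTree.order_eq_zero] at h0
    omega
  rw [cond_apply .of_discrete, h2, h1, mixLaw_map_prune_ne_empty h hp hp_sum]

/-- Pruning moves the weight of order `K + 1` to order `K` and conditioning divides by `1 - p 1`;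
invariance of the order alone gives `p (K + 1) = (1 - p 1) * p K`. -/
theorem geometric_of_pruneInvariant (hp : ∀ K, 1 ≤ K → 0 ≤ p K)
    (hp_sum : HasSum (fun K : ℕ => p (K + 1)) 1) (hinv : PruneInvariant (mixLaw p ν)) :
    ∃ p₀ : ℝ, 0 < p₀ ∧ p₀ < 1 ∧ ∀ K, 1 ≤ K → p K = p₀ * (1 - p₀) ^ (K - 1) := by
  have heq := Measure.ext_of_singleton hinv
  have hrec : ∀ K, 1 ≤ K → (ENNReal.ofReal (1 - p 1))⁻¹ * ENNReal.ofReal (p (K + 1))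
      = ENNReal.ofReal (p K) := by
    intro K hK
    have h2 := cond_mixLaw_map_prune h hK hp hp_sum (subset_refl (ordEq Unit K))
    rwa [heq, h.map_ofPlane_ordEq hK, mul_one, mixLaw_ordEq h hK, eq_comm] at h2
  have hsum2 : p 1 + p 2 ≤ 1 := by
    have := sum_le_hasSum (Finset.range 2) (fun K _ => hp (K + 1) (by omega)) hp_sum
    simpa [Finset.sum_range_succ] using this
  have h1' := hp 1 le_rfl
  have h2' := hp 2 (by omega)
  have hlt : p 1 < 1 := by
    by_contra hge
    have e1 : p 1 = 1 := by linarith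
    have e2 : p 2 = 0 := by linarith
    -- With `p 1 = 1` the left side reads `∞ * 0`, which is `0`, while the right side is `1`.
    have := hrec 1 le_rfl
    simp [e1, e2] at this
  have hstep : ∀ K, 1 ≤ K → p (K + 1) = (1 - p 1) * p K := by
    intro K hK
    have h3 := hrec K hK
    have h4 : 0 < 1 - p 1 := by linarith
    rw [← ENNReal.ofReal_inv_of_pos h4, ← ENNReal.ofReal_mul (by positivity),
      ENNReal.ofReal_eq_ofReal_iff (mul_nonneg (by positivity) (hp _ (by omega))) (hp K hK)] at h3
    rw [← h3]
    field_simp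
  have hform : ∀ K, p (K + 1) = p 1 * (1 - p 1) ^ K := by
    intro K
    induction K with
    | zero => simp
    | succ K ih => rw [hstep (K + 1) (by omega), ih, pow_succ]; ring
  -- If `p 1` were zero the recursion would make every weight zero, contradicting total mass one.
  refine ⟨p 1, lt_of_le_of_ne h1' fun h0 => ?_, hlt, fun K hK => ?_⟩
  · have h5 : (fun K => p (K + 1)) = fun _ => (0 : ℝ) := by
      funext K
      rw [hform, ← h0, zero_mul]
    rw [h5] at hp_sum
    exact zero_ne_one (hasSum_zero.unique hp_sum)
  · obtain ⟨k, rfl⟩ : ∃ k, K = k + 1 := ⟨K - 1, by omega⟩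
    exact hform k

theorem pruneInvariant_of_geometric (hp : ∀ K, 1 ≤ K → 0 ≤ p K)
    (hp_sum : HasSum (fun K : ℕ => p (K + 1)) 1) {p₀ : ℝ} (h1 : p₀ < 1)
    (hgeo : ∀ K, 1 ≤ K → p K = p₀ * (1 - p₀) ^ (K - 1)) : PruneInvariant (mixLaw p ν) := by
  intro τ
  by_cases hτ : τ = BinTree.empty
  · rw [hτ, mixLaw_empty, cond_apply .of_discrete, Set.compl_inter_self, measure_empty, mul_zero]
  · have hK : 1 ≤ τ.order := by
      by_contra hlt
      exact hτ ((BinTree.order_eq_zero τ).1 (by omega))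
    have hsub : {τ} ⊆ ordEq Unit τ.order := by
      rintro t rfl
      rfl
    have h2 := mixLaw_restrict_of_subset (p := p) h hK .of_discrete hsub
    have h3 := congrArg (fun m : Measure Shape => m Set.univ) h2
    simp only [Measure.restrict_apply_univ, Measure.smul_apply, smul_eq_mul] at h3
    rw [cond_mixLaw_map_prune h hK hp hp_sum hsub, h3, ← mul_assoc]
    congr 1
    have e1 : p 1 = p₀ := by simpa using hgeo 1 le_rfl
    have h4 : 0 < 1 - p₀ := by linarith
    rw [e1, ← ENNReal.ofReal_inv_of_pos h4, ← ENNReal.ofReal_mul (by positivity)]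
    congr 1
    obtain ⟨k, hk⟩ : ∃ k, τ.order = k + 1 := ⟨τ.order - 1, by omega⟩
    rw [hk, hgeo _ (by omega), hgeo _ (by omega), Nat.add_sub_cancel, Nat.add_sub_cancel, pow_succ]
    field_simp

theorem coordinated_mixLaw : Coordinated (mixLaw p ν) := by
  intro K H hK hKH h0 h0' τ _
  rw [subtreeLaw_mixLaw h hK hKH (pos_of_mixLaw_ordEq_ne_zero h (hK.trans hKH) h0'),
    condOrder_mixLaw h hK (pos_of_mixLaw_ordEq_ne_zero h hK h0)]

end shapes

end

/-! ## Trees with edge lengths -/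

noncomputable section

open PlaneTree

theorem lengthLaw_congr {η η' : Measure LTree} {τ : Shape} (h : condShape η τ = condShape η' τ) :
    lengthLaw η τ = lengthLaw η' τ := by
  unfold lengthLaw
  congr 1

theorem relativeLaw_congr {η η' : Measure LTree} {τ : Shape} (h : condShape η τ = condShape η' τ) :
    relativeLaw η τ = relativeLaw η' τ := by
  rw [relativeLaw, relativeLaw, h]

/-- Multiplication of all edge lengths by a constant. -/
def LTree.scale (c : EdgeLength) (t : LTree) : LTree := t.map fun a => c * a

theorem LTree.measurable_scale (c : EdgeLength) : Measurable (LTree.scale c) :=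
  BinTree.measurable_map (measurable_edgeLength_mul c)

theorem edgeLength_mul_add (c a b : EdgeLength) : c * (a + b) = c * a + c * b :=
  Subtype.ext (mul_add (c : ℝ) a b)

theorem LTree.shape_scale (c : EdgeLength) (t : LTree) : (t.scale c).shape = t.shape := by
  by_cases h : t = BinTree.empty
  · subst h
    rfl
  · obtain ⟨s, rfl⟩ := BinTree.ofPlane_surjective h
    change BinTree.ofPlane ((s.map _).map _) = BinTree.ofPlane (s.map _)
    rw [PlaneTree.map_map]

theorem LTree.length_scale (c : EdgeLength) (t : LTree) : (t.scale c).length = c * t.length := by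
  by_cases h : t = BinTree.empty
  · subst h
    exact (mul_zero _).symm
  · obtain ⟨s, rfl⟩ := BinTree.ofPlane_surjective h
    change (((s.map fun a => c * a).length : EdgeLength) : ℝ) = c * (s.length : EdgeLength)
    rw [PlaneTree.length_map _ (edgeLength_mul_add c)]
    rfl

theorem LTree.relative_scale (c : EdgeLength) (t : LTree) : (t.scale c).relative = t.relative := by
  by_cases h : t = BinTree.empty
  · subst h
    rfl
  · obtain ⟨s, rfl⟩ := BinTree.ofPlane_surjective h
    change BinTree.ofPlane ((s.map fun a => c * a).map
      fun a => a * ((s.map fun a => c * a).length)⁻¹) = BinTree.ofPlane (s.map _)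
    rw [PlaneTree.map_map, PlaneTree.length_map _ (edgeLength_mul_add c)]
    congr 2
    funext a
    simp only [Function.comp]
    apply Subtype.ext
    have hc : (c : ℝ) ≠ 0 := c.2.ne'
    have hs : (s.length : ℝ) ≠ 0 := s.length.2.ne'
    change (c : ℝ) * a * (c * (s.length : ℝ))⁻¹ = a * (s.length : ℝ)⁻¹
    field_simp

theorem condShape_map_scale (η : Measure LTree) (c : EdgeLength) (τ : Shape) :
    condShape (η.map (LTree.scale c)) τ = (condShape η τ).map (LTree.scale c) := by
  have hs := LTree.measurable_scale c
  have hB : MeasurableSet (BinTree.shape ⁻¹' {τ} : Set LTree) :=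
    BinTree.measurable_shape .of_discrete
  have hpre : LTree.scale c ⁻¹' (BinTree.shape ⁻¹' {τ}) = BinTree.shape ⁻¹' {τ} := by
    ext t
    change (t.scale c).shape = τ ↔ t.shape = τ
    rw [LTree.shape_scale]
  rw [condShape, condShape, ProbabilityTheory.cond, ProbabilityTheory.cond,
    Measure.restrict_map hs hB, Measure.map_apply hs hB, hpre, Measure.map_smul]

theorem relativeLaw_map_scale (η : Measure LTree) (c : EdgeLength) (τ : Shape) :
    relativeLaw (η.map (LTree.scale c)) τ = relativeLaw η τ := by
  rw [relativeLaw, condShape_map_scale,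
    Measure.map_map LTree.measurable_relative (LTree.measurable_scale c)]
  congr 1
  funext t
  exact LTree.relative_scale c t

/-- Scaling fixes the relative lengths and multiplies the total length, so it acts on the second
argument of the conditional law only. Conditional laws are determined almost everywhere, whence the
form of the statement. -/
theorem lengthLaw_map_scale (η : Measure LTree) (c : EdgeLength) (τ : Shape) :
    ∀ᵐ x ∂(relativeLaw η τ),
      lengthLaw (η.map (LTree.scale c)) τ x = (lengthLaw η τ x).map (fun l : ℝ => (c : ℝ) * l) := by
  have hs := LTree.measurable_scale c
  have hmul : Measurable fun l : ℝ => (c : ℝ) * l := by fun_prop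
  have hrel : LTree.relative ∘ LTree.scale c = LTree.relative :=
    funext (LTree.relative_scale c)
  have hlen : LTree.length ∘ LTree.scale c = (fun l : ℝ => (c : ℝ) * l) ∘ LTree.length :=
    funext (LTree.length_scale c)
  have h1 : lengthLaw (η.map (LTree.scale c)) τ
      = condDistrib LTree.length LTree.relative ((condShape η τ).map (LTree.scale c)) := by
    unfold lengthLaw
    congr 1
    exact condShape_map_scale η c τ
  have h2 := condDistrib_map (ν := condShape η τ) (f := LTree.scale c)
    LTree.measurable_relative.aemeasurable LTree.measurable_length.aemeasurable hs.aemeasurable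
  rw [hrel, hlen] at h2
  have h3 := condDistrib_comp (mβ := BinTree.instMeasurableSpace) (μ := condShape η τ)
    LTree.relative
    LTree.measurable_length.aemeasurable hmul
  filter_upwards [h2, h3] with x hx2 hx3
  rw [h1, hx2, hx3, Kernel.map_apply _ hmul]
  rfl

/-- The law of the total length is determined by the law of the relative edge lengths and the
conditional law of the total length. -/
theorem map_length_eq {η η' : Measure LTree} {τ : Shape} {ζ : ℝ}
    (h1 : relativeLaw η' τ = relativeLaw η τ)
    (h2 : ∀ᵐ x ∂(relativeLaw η τ), lengthLaw η' τ x = (lengthLaw η τ x).map (fun l => ζ * l)) :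
    (condShape η' τ).map LTree.length
      = ((condShape η τ).map LTree.length).map (fun l => ζ * l) := by
  have hmul : Measurable fun l : ℝ => ζ * l := by fun_prop
  have e : ∀ η : Measure LTree,
      (relativeLaw η τ).bind (lengthLaw η τ) = (condShape η τ).map LTree.length := fun η =>
    condDistrib_comp_map LTree.measurable_relative.aemeasurable
      LTree.measurable_length.aemeasurable
  rw [← e, ← e, h1, Measure.map_comp _ _ hmul]
  refine Measure.bind_congr_right (h2.mono fun x hx => ?_)
  rw [hx, Kernel.map_apply _ hmul]

/-! ### Perfect binary trees -/

section perfect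

/-- The perfect binary tree of order `n + 1`. -/
def perfect : ℕ → PlaneTree Unit
  | 0 => leaf ()
  | n + 1 => node () (perfect n) (perfect n)

theorem order_perfect (n : ℕ) : (perfect n).order = n + 1 := by
  induction n with
  | zero => rfl
  | succ n ih => simp [perfect, order, ih]

/-- Perfect trees have a single embedding, so conditioning on such a shape without embedding is
conditioning on one planar shape. -/
theorem eq_perfect_of_iso {n : ℕ} {s t : PlaneTree Unit} (h : Iso s t) (ht : t = perfect n) :
    s = perfect n := by
  induction h generalizing n with
  | leaf a => exact ht
  | node a _ _ h1 h2 =>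
    cases n with
    | zero => cases ht
    | succ n =>
      simp only [perfect, PlaneTree.node.injEq] at ht
      rw [h1 ht.2.1, h2 ht.2.2]
      rfl
  | swap a _ _ h1 h2 =>
    cases n with
    | zero => cases ht
    | succ n =>
      simp only [perfect, PlaneTree.node.injEq] at ht
      rw [h1 ht.2.2, h2 ht.2.1]
      rfl

theorem shape_ofPlane_eq_perfect {α : Type} {t : PlaneTree α} {n : ℕ} :
    (BinTree.ofPlane t).shape = BinTree.ofPlane (perfect n) ↔ t.skeleton = perfect n := by
  refine ⟨fun h => ?_, fun h => ?_⟩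
  · have h' : Quotient.mk (PlaneTree.isoSetoid Unit) t.skeleton = Quotient.mk _ (perfect n) :=
      Option.some.inj h
    exact eq_perfect_of_iso (Quotient.exact h') rfl
  · change BinTree.ofPlane t.skeleton = _
    rw [h]

variable {α : Type}

/-- On the trees of perfect binary shape of order `n + 1`, the product of the weights of the
edges; zero on all other trees. -/
def perfectWeight (e : α → ℝ≥0∞) : ℕ → PlaneTree α → ℝ≥0∞
  | 0, leaf a => e a
  | 0, node _ _ _ => 0
  | _ + 1, leaf _ => 0
  | n + 1, node a l r => e a * (perfectWeight e n l * perfectWeight e n r)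

theorem perfectWeight_eq_zero (e : α → ℝ≥0∞) {n : ℕ} {t : PlaneTree α} (h : t.order ≠ n + 1) :
    perfectWeight e n t = 0 := by
  induction t generalizing n with
  | leaf a =>
    cases n with
    | zero => exact absurd rfl h
    | succ n => rfl
  | node a l r hl hr =>
    cases n with
    | zero => rfl
    | succ n =>
      rw [perfectWeight]
      by_cases h1 : l.order = n + 1
      · by_cases h2 : r.order = n + 1
        · simp [order, h1, h2] at h
        · rw [hr h2, mul_zero, mul_zero]
      · rw [hl h1, zero_mul, mul_zero]

theorem skeleton_node_eq_perfect {a : α} {l r : PlaneTree α} {n : ℕ} :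
    (node a l r).skeleton = perfect (n + 1) ↔ l.skeleton = perfect n ∧ r.skeleton = perfect n := by
  change node () l.skeleton r.skeleton = node () (perfect n) (perfect n) ↔ _
  simp

theorem skeleton_node_ne_leaf {a : α} {l r : PlaneTree α} :
    (node a l r).skeleton ≠ perfect 0 := nofun

theorem skeleton_leaf_ne_node {a : α} {n : ℕ} : (leaf a).skeleton ≠ perfect (n + 1) := nofun

open Classical in
/-- If `e` turns addition into multiplication, then so does the product of the weights. -/
theorem perfectWeight_eq_ite {e : α → ℝ≥0∞} {f : PlaneTree α → ℝ≥0∞} (hl : ∀ a, f (leaf a) = e a)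
    (hn : ∀ a l r, f (node a l r) = e a * (f l * f r)) (n : ℕ) (t : PlaneTree α) :
    perfectWeight e n t = if t.skeleton = perfect n then f t else 0 := by
  induction t generalizing n with
  | leaf a =>
    cases n with
    | zero => exact (hl a).symm.trans (if_pos rfl).symm
    | succ n => exact (if_neg skeleton_leaf_ne_node).symm
  | node a l r ihl ihr =>
    cases n with
    | zero => exact (if_neg skeleton_node_ne_leaf).symm
    | succ n =>
      simp only [perfectWeight, ihl, ihr, hn, skeleton_node_eq_perfect]
      by_cases h1 : l.skeleton = perfect n <;> by_cases h2 : r.skeleton = perfect n <;>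
        simp [h1, h2]

theorem perfectWeight_one (n : ℕ) (t : PlaneTree α) :
    perfectWeight 1 n t = {t : PlaneTree α | t.skeleton = perfect n}.indicator 1 t := by
  classical
  rw [perfectWeight_eq_ite (e := 1) (f := 1) (fun _ => rfl) fun _ _ _ => by simp,
    Set.indicator_apply]
  rfl

theorem perfectWeight_exp (s : ℝ) (n : ℕ) (t : PlaneTree EdgeLength) :
    perfectWeight (fun a : EdgeLength => ENNReal.ofReal (Real.exp (-(s * a)))) n t =
      {t : PlaneTree EdgeLength | t.skeleton = perfect n}.indicator
        (fun t => ENNReal.ofReal (Real.exp (-(s * (t.length : EdgeLength))))) t := by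
  classical
  rw [perfectWeight_eq_ite (e := fun a : EdgeLength => ENNReal.ofReal (Real.exp (-(s * a))))
    (f := fun t => ENNReal.ofReal (Real.exp (-(s * (t.length : EdgeLength))))) (fun _ => rfl),
    Set.indicator_apply]
  · rfl
  · intro a l r
    have hlen : ((node a l r).length : ℝ) = a + ((l.length : ℝ) + (r.length : ℝ)) := rfl
    rw [← ENNReal.ofReal_mul (Real.exp_pos _).le, ← ENNReal.ofReal_mul (Real.exp_pos _).le,
      ← Real.exp_add, ← Real.exp_add, hlen]
    congr 2
    ring

variable [MeasurableSpace α]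

theorem measurable_perfectWeight {e : α → ℝ≥0∞} (he : Measurable e) (n : ℕ) :
    Measurable (perfectWeight e n) := by
  induction n with
  | zero => exact measurable_of_leaf_of_node he measurable_const
  | succ n ih =>
    refine measurable_of_leaf_of_node measurable_const ?_
    exact (he.comp measurable_fst).mul ((ih.comp (measurable_fst.comp measurable_snd)).mul
      (ih.comp (measurable_snd.comp measurable_snd)))

namespace BranchFamily

variable {T : ℕ → ℝ} {w : ℕ → Measure α} {ν : ℕ → Measure (PlaneTree α)}
  (h : BranchFamily T w ν)
include h

theorem lintegral_perfectWeight_zero {e : α → ℝ≥0∞} (he : Measurable e) :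
    ∫⁻ t, perfectWeight e 0 t ∂(ν 1) = ∫⁻ a, e a ∂(w 1) :=
  h.lintegral_one (measurable_perfectWeight he 0)

/-- A side-branch at the first event would leave a left subtree of order `n + 2`, whereas that of
the perfect tree has order `n + 1`. Only termination contributes, and the integral factors. -/
theorem lintegral_perfectWeight_succ {e : α → ℝ≥0∞} (he : Measurable e) (n : ℕ) :
    ∫⁻ t, perfectWeight e (n + 1) t ∂(ν (n + 2)) = termProb T (n + 2) *
      ((∫⁻ a, e a ∂(w (n + 2))) * ((∫⁻ t, perfectWeight e n t ∂(ν (n + 1)))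
        * ∫⁻ t, perfectWeight e n t ∂(ν (n + 1)))) := by
  have hm := measurable_perfectWeight he n
  have key : ∀ p q : ℕ, ∫⁻ a, ∫⁻ l, ∫⁻ r, perfectWeight e (n + 1) (.node a l r) ∂(ν q) ∂(ν p)
      ∂(w (n + 2)) = (∫⁻ a, e a ∂(w (n + 2))) * ((∫⁻ t, perfectWeight e n t ∂(ν p))
        * ∫⁻ t, perfectWeight e n t ∂(ν q)) := by
    intro p q
    simp only [perfectWeight]
    have : ∀ a, ∫⁻ l, ∫⁻ r, e a * (perfectWeight e n l * perfectWeight e n r) ∂(ν q) ∂(ν p)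
        = e a * ((∫⁻ t, perfectWeight e n t ∂(ν p)) * ∫⁻ t, perfectWeight e n t ∂(ν q)) := by
      intro a
      have h1 : ∀ l, ∫⁻ r, e a * (perfectWeight e n l * perfectWeight e n r) ∂(ν q)
          = e a * (perfectWeight e n l * ∫⁻ r, perfectWeight e n r ∂(ν q)) := by
        intro l
        rw [lintegral_const_mul _ (hm.const_mul _), lintegral_const_mul _ hm]
      simp only [h1]
      rw [lintegral_const_mul _ (hm.mul_const _), lintegral_mul_const _ hm]
    simp only [this]
    rw [lintegral_mul_const _ he]
  have h0 : ∫⁻ t, perfectWeight e n t ∂(ν (n + 2)) = 0 := by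
    have : ∫⁻ t, perfectWeight e n t ∂(ν (n + 2)) = ∫⁻ t, 0 ∂(ν (n + 2)) :=
      lintegral_congr_ae ((h.ae_order (by omega : 1 ≤ n + 2)).mono fun t ht =>
        perfectWeight_eq_zero e (by omega))
    simpa using this
  rw [h.lintegral_eq (by omega) (measurable_perfectWeight he (n + 1)), key]
  simp only [key, h0, zero_mul, mul_zero, Finset.sum_const_zero, add_zero]
  rfl

end BranchFamily

end perfect

end

noncomputable section

open PlaneTree

/-! ### Mixtures conditioned on the shape -/

theorem preimage_shape_subset {α : Type} (τ : Shape) :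
    (BinTree.shape ⁻¹' {τ} : Set (BinTree α)) ⊆ ordEq α τ.order := by
  rintro t rfl
  exact (BinTree.order_shape t).symm

theorem measurableSet_preimage_shape {α : Type} [MeasurableSpace α] (τ : Shape) :
    MeasurableSet (BinTree.shape ⁻¹' {τ} : Set (BinTree α)) :=
  BinTree.measurable_shape .of_discrete

theorem one_le_order {τ : Shape} (hτ : τ ≠ BinTree.empty) : 1 ≤ τ.order :=
  Nat.one_le_iff_ne_zero.2 fun h => hτ ((BinTree.order_eq_zero τ).1 h)

section ofFamily

variable {T : ℕ → ℝ} {w w' : ℕ → Measure EdgeLength} {ν ν' : ℕ → Measure (PlaneTree EdgeLength)}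
  {p : ℕ → ℝ} (h : BranchFamily T w ν) {τ : Shape}
include h

theorem condShape_mixLaw (hτ : 1 ≤ τ.order) (hp : 0 < p τ.order) :
    condShape (mixLaw p ν) τ = condShape ((ν τ.order).map BinTree.ofPlane) τ :=
  cond_mixLaw h hτ hp (measurableSet_preimage_shape τ) (preimage_shape_subset τ)

theorem condShape_mixLaw_map_prune (h' : BranchFamily T w' ν') (hτ : 1 ≤ τ.order)
    (hpr : (ν (τ.order + 1)).map pruned = ν' τ.order) (hp : 0 < p (τ.order + 1)) :
    condShape ((mixLaw p ν).map BinTree.prune) τ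
      = condShape ((ν' τ.order).map BinTree.ofPlane) τ := by
  have h1 := congrArg (fun m : Measure LTree => m.restrict (BinTree.shape ⁻¹' {τ}))
    (mixLaw_map_prune_restrict (p := p) h hτ h' hpr)
  simp only [Measure.restrict_restrict (measurableSet_preimage_shape τ),
    Set.inter_eq_left.2 (preimage_shape_subset τ), Measure.restrict_smul] at h1
  exact cond_eq_of_restrict_eq (ENNReal.ofReal_pos.2 hp).ne' ENNReal.ofReal_ne_top h1

omit τ in
theorem coordinatedInShapes_mixLaw : CoordinatedInShapes (mixLaw p ν) := by
  intro K H hK hKH h0 h0' τ _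
  rw [subtreeLaw_mixLaw h hK hKH (pos_of_mixLaw_ordEq_ne_zero h (hK.trans hKH) h0'),
    condOrder_mixLaw h hK (pos_of_mixLaw_ordEq_ne_zero h hK h0)]

omit τ in
theorem coordinatedInLengths_mixLaw : CoordinatedInLengths (mixLaw p ν) := by
  intro K H hK hKH h0 h0' τ hτ _
  subst hτ
  have e : condShape (subtreeLaw (mixLaw p ν) τ.order H) τ = condShape (mixLaw p ν) τ := by
    rw [subtreeLaw_mixLaw h hK hKH (pos_of_mixLaw_ordEq_ne_zero h (hK.trans hKH) h0'),
      condShape_mixLaw h hK (pos_of_mixLaw_ordEq_ne_zero h hK h0)]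
  exact ⟨relativeLaw_congr e, .of_forall fun x => by rw [lengthLaw_congr e]⟩

theorem lintegral_perfectWeight_one_zero : ∫⁻ t, perfectWeight 1 0 t ∂(ν 1) = 1 := by
  have := h.prob_wait 1 le_rfl
  rw [h.lintegral_perfectWeight_zero measurable_one]
  simp

theorem lintegral_perfectWeight_one_succ (n : ℕ) :
    ∫⁻ t, perfectWeight 1 (n + 1) t ∂(ν (n + 2)) = termProb T (n + 2) *
      ((∫⁻ t, perfectWeight 1 n t ∂(ν (n + 1))) * ∫⁻ t, perfectWeight 1 n t ∂(ν (n + 1))) := by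
  have := h.prob_wait (n + 2) (by omega)
  rw [h.lintegral_perfectWeight_succ measurable_one]
  simp

/-- The probability of a perfect shape is a product of termination probabilities, which depend on
`T` alone. This lets the normalising constants cancel when laws with different rates are compared.
-/
theorem lintegral_perfectWeight_one_congr (h' : BranchFamily T w' ν') (n : ℕ) :
    ∫⁻ t, perfectWeight 1 n t ∂(ν (n + 1)) = ∫⁻ t, perfectWeight 1 n t ∂(ν' (n + 1)) := by
  induction n with
  | zero =>
    rw [zero_add, lintegral_perfectWeight_one_zero h, lintegral_perfectWeight_one_zero h']
  | succ n ih =>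
    rw [lintegral_perfectWeight_one_succ h, lintegral_perfectWeight_one_succ h', ih]

theorem lintegral_perfectWeight_one_ne_zero (n : ℕ) :
    ∫⁻ t, perfectWeight 1 n t ∂(ν (n + 1)) ≠ 0 := by
  induction n with
  | zero =>
    rw [zero_add, lintegral_perfectWeight_one_zero h]
    exact one_ne_zero
  | succ n ih =>
    rw [lintegral_perfectWeight_one_succ h]
    exact mul_ne_zero (termProb_ne_zero h.nonneg _) (mul_ne_zero ih ih)

theorem lintegral_perfectWeight_one_ne_top (n : ℕ) :
    ∫⁻ t, perfectWeight 1 n t ∂(ν (n + 1)) ≠ ∞ := by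
  induction n with
  | zero =>
    rw [zero_add, lintegral_perfectWeight_one_zero h]
    exact ENNReal.one_ne_top
  | succ n ih =>
    rw [lintegral_perfectWeight_one_succ h]
    exact ENNReal.mul_ne_top (termProb_ne_top _ _) (ENNReal.mul_ne_top ih ih)

end ofFamily

theorem map_ofPlane_preimage_perfect {α : Type} [MeasurableSpace α] (ρ : Measure (PlaneTree α))
    (n : ℕ) : ρ.map BinTree.ofPlane (BinTree.shape ⁻¹' {BinTree.ofPlane (perfect n)})
      = ∫⁻ t, perfectWeight 1 n t ∂ρ := by
  have hs : (BinTree.ofPlane ⁻¹' (BinTree.shape ⁻¹' {BinTree.ofPlane (perfect n)}) :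
      Set (PlaneTree α)) = {t | t.skeleton = perfect n} :=
    Set.ext fun t => shape_ofPlane_eq_perfect
  rw [Measure.map_apply BinTree.measurable_ofPlane (measurableSet_preimage_shape _)]
  have hm := BinTree.measurable_ofPlane
    (measurableSet_preimage_shape (α := α) (BinTree.ofPlane (perfect n)))
  rw [hs] at hm ⊢
  rw [← lintegral_indicator_one hm]
  exact lintegral_congr fun t => (perfectWeight_one n t).symm

/-- The Laplace transform of the total length of a tree of perfect shape. -/
theorem lintegral_length_perfect (ρ : Measure (PlaneTree EdgeLength)) (n : ℕ) (s : ℝ) :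
    ∫⁻ t, ENNReal.ofReal (Real.exp (-(s * t.length)))
        ∂(condShape (ρ.map BinTree.ofPlane) (BinTree.ofPlane (perfect n)))
      = (∫⁻ t, perfectWeight 1 n t ∂ρ)⁻¹ * ∫⁻ t, perfectWeight
        (fun a : EdgeLength => ENNReal.ofReal (Real.exp (-(s * a)))) n t ∂ρ := by
  have hB := measurableSet_preimage_shape (α := EdgeLength) (BinTree.ofPlane (perfect n))
  have hs : (BinTree.ofPlane ⁻¹' (BinTree.shape ⁻¹' {BinTree.ofPlane (perfect n)}) :
      Set (PlaneTree EdgeLength)) = {t | t.skeleton = perfect n} :=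
    Set.ext fun t => shape_ofPlane_eq_perfect
  have hm := BinTree.measurable_ofPlane hB
  have hl : Measurable fun t : LTree => ENNReal.ofReal (Real.exp (-(s * t.length))) := by
    have := LTree.measurable_length
    fun_prop
  rw [condShape, ProbabilityTheory.cond, lintegral_smul_measure, map_ofPlane_preimage_perfect,
    smul_eq_mul, Measure.restrict_map BinTree.measurable_ofPlane hB,
    lintegral_map hl BinTree.measurable_ofPlane, ← lintegral_indicator hm, hs]
  congr 1
  exact lintegral_congr fun t => (perfectWeight_exp s n t).symm

/-! ### The hierarchical branching process -/

section process

variable {T lam p : ℕ → ℝ} (hT : ∀ k, 1 ≤ k → 0 ≤ T k) (hlam : ∀ j, 1 ≤ j → 0 < lam j)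
include hT hlam

/-- Pruning shifts the termination rates. -/
theorem branchLaw_map_pruned {j : ℕ} (hj : 1 ≤ j) :
    (branchLaw T lam (j + 1)).map pruned = branchLaw T (fun i => lam (i + 1)) j :=
  (branchFamily hT hlam).map_pruned (branchFamily hT fun i _ => hlam (i + 1) (by omega))
    (fun i hi => waitLaw_succ hT hi (hlam (i + 1) (by omega)) rfl) hj

/-- Multiplication of the edge lengths divides the termination rates. -/
theorem branchLaw_map_mul {lam' : ℕ → ℝ} (c : EdgeLength)
    (hlam' : ∀ j, 1 ≤ j → lam' j = lam j / c) {j : ℕ} (hj : 1 ≤ j) :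
    (branchLaw T lam j).map (PlaneTree.map fun a => c * a) = branchLaw T lam' j :=
  ((branchFamily hT hlam).map (measurable_edgeLength_mul c)).eq
    (branchFamily hT fun i hi => by
      rw [hlam' i hi]
      exact div_pos (hlam i hi) c.2)
    (fun i hi => waitLaw_map_mul hT (hlam i hi) c (hlam' i hi)) hj

theorem branchFamily_shape : BranchFamily T (fun j => (waitLaw T lam j).map fun _ => ())
    (fun j => (branchLaw T lam j).map (PlaneTree.map fun _ => ())) :=
  (branchFamily hT hlam).map measurable_const

omit hT hlam in
theorem hbpShapeLaw_eq (T lam p : ℕ → ℝ) : hbpShapeLaw T lam p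
    = mixLaw p fun j => (branchLaw T lam j).map (PlaneTree.map fun _ => ()) :=
  mixLaw_map_shape p (branchLaw T lam)

/-- Pruning shifts the rates and scaling by `ζ` divides them by `ζ`; under `hrate` these produce the
same branch laws, so pruning acts as scaling once the shape is fixed. -/
theorem pruneInvariantInLengths {ζ : ℝ} (hζ : 0 < ζ) (hp : ∀ K, 1 ≤ K → 0 < p K)
    (hrate : ∀ j, 1 ≤ j → lam (j + 1) = lam j / ζ) :
    PruneInvariantInLengths (hbpLaw T lam p) ζ := by
  intro τ hτ _
  have hK := one_le_order hτ
  have h := branchFamily hT hlam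
  have e1 : condShape (hbpLaw T lam p) τ
      = condShape ((branchLaw T lam τ.order).map BinTree.ofPlane) τ :=
    condShape_mixLaw h hK (hp _ hK)
  have e2 : condShape ((hbpLaw T lam p).map BinTree.prune) τ
      = condShape (((branchLaw T lam τ.order).map BinTree.ofPlane).map
        (LTree.scale ⟨ζ, hζ⟩)) τ := by
    refine (condShape_mixLaw_map_prune h (branchFamily hT fun i _ => hlam (i + 1) (by omega)) hK
      (branchLaw_map_pruned hT hlam hK) (hp _ (by omega))).trans ?_
    rw [← branchLaw_map_mul hT hlam ⟨ζ, hζ⟩ hrate hK,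
      Measure.map_map (LTree.measurable_scale _) BinTree.measurable_ofPlane,
      Measure.map_map BinTree.measurable_ofPlane
        (PlaneTree.measurable_map (measurable_edgeLength_mul _))]
    rfl
  rw [relativeLaw_congr e1, relativeLaw_congr e2, lengthLaw_congr e1, lengthLaw_congr e2]
  exact ⟨relativeLaw_map_scale _ _ _, lengthLaw_map_scale _ _ _⟩

theorem lintegral_perfectWeight_exp_ne_zero {s : ℝ} (hs : 0 < s) (n : ℕ) :
    ∫⁻ t, perfectWeight (fun a : EdgeLength => ENNReal.ofReal (Real.exp (-(s * a)))) n t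
      ∂(branchLaw T lam (n + 1)) ≠ 0 := by
  have h := branchFamily hT hlam
  have he : Measurable fun a : EdgeLength => ENNReal.ofReal (Real.exp (-(s * a))) := by fun_prop
  have hw : ∀ j, 1 ≤ j →
      ∫⁻ a : EdgeLength, ENNReal.ofReal (Real.exp (-(s * a))) ∂(waitLaw T lam j) ≠ 0 := by
    intro j hj
    have := totalRate_pos hT (hlam j hj)
    rw [lintegral_exp_neg_waitLaw hT (hlam j hj) hs]
    exact (ENNReal.ofReal_pos.2 (by positivity)).ne'
  induction n with
  | zero =>
    rw [zero_add, h.lintegral_perfectWeight_zero he]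
    exact hw 1 le_rfl
  | succ n ih =>
    rw [h.lintegral_perfectWeight_succ he]
    exact mul_ne_zero (termProb_ne_zero hT _) (mul_ne_zero (hw _ (by omega)) (mul_ne_zero ih ih))

theorem lintegral_perfectWeight_exp_ne_top {s : ℝ} (hs : 0 < s) (n : ℕ) :
    ∫⁻ t, perfectWeight (fun a : EdgeLength => ENNReal.ofReal (Real.exp (-(s * a)))) n t
      ∂(branchLaw T lam (n + 1)) ≠ ∞ := by
  have h := branchFamily hT hlam
  have he : Measurable fun a : EdgeLength => ENNReal.ofReal (Real.exp (-(s * a))) := by fun_prop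
  have hw : ∀ j, 1 ≤ j →
      ∫⁻ a : EdgeLength, ENNReal.ofReal (Real.exp (-(s * a))) ∂(waitLaw T lam j) ≠ ∞ := by
    intro j hj
    rw [lintegral_exp_neg_waitLaw hT (hlam j hj) hs]
    exact ENNReal.ofReal_ne_top
  induction n with
  | zero =>
    rw [zero_add, h.lintegral_perfectWeight_zero he]
    exact hw 1 le_rfl
  | succ n ih =>
    rw [h.lintegral_perfectWeight_succ he]
    exact ENNReal.mul_ne_top (termProb_ne_top _ _)
      (ENNReal.mul_ne_top (hw _ (by omega)) (ENNReal.mul_ne_top ih ih))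

/-- The lengths of trees of perfect shape determine how pruning changes the rates. -/
theorem rate_succ_of_pruneInvariantInLengths {ζ : ℝ} (hζ : 0 < ζ) (hp : ∀ K, 1 ≤ K → 0 < p K)
    (hinv : PruneInvariantInLengths (hbpLaw T lam p) ζ) {j : ℕ} (hj : 1 ≤ j) :
    lam (j + 1) = lam j / ζ := by
  have h := branchFamily hT hlam
  have hlam' : ∀ i, 1 ≤ i → 0 < (fun i => lam (i + 1)) i := fun i _ => hlam (i + 1) (by omega)
  have h' := branchFamily hT hlam'
  have he : ∀ s : ℝ, Measurable fun a : EdgeLength => ENNReal.ofReal (Real.exp (-(s * a))) :=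
    fun s => by fun_prop
  -- The total length of a pruned perfect tree has the law of `ζ` times that of an unpruned one, so
  -- its Laplace transform at `1` is the other one at `ζ`.
  have key : ∀ n, ∫⁻ t, perfectWeight
        (fun a : EdgeLength => ENNReal.ofReal (Real.exp (-(1 * a)))) n t
        ∂(branchLaw T (fun i => lam (i + 1)) (n + 1))
      = ∫⁻ t, perfectWeight (fun a : EdgeLength => ENNReal.ofReal (Real.exp (-(ζ * a)))) n t
        ∂(branchLaw T lam (n + 1)) := by
    intro n
    have hord : (BinTree.ofPlane (perfect n) : Shape).order = n + 1 := order_perfect n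
    have h0 : (hbpLaw T lam p).map BinTree.shape {BinTree.ofPlane (perfect n)} ≠ 0 := by
      have hr := congrArg (fun m : Measure LTree => m Set.univ)
        (mixLaw_restrict_of_subset (p := p) h (K := n + 1) (by omega)
          (measurableSet_preimage_shape (BinTree.ofPlane (perfect n)))
          (by
            have := preimage_shape_subset (α := EdgeLength) (BinTree.ofPlane (perfect n))
            rwa [hord] at this))
      simp only [Measure.restrict_apply_univ, Measure.smul_apply,
        map_ofPlane_preimage_perfect, smul_eq_mul] at hr
      rw [Measure.map_apply BinTree.measurable_shape .of_discrete]
      refine hr.trans_ne (mul_ne_zero (ENNReal.ofReal_pos.2 (hp _ (by omega))).ne' ?_)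
      exact lintegral_perfectWeight_one_ne_zero h n
    obtain ⟨i1, i2⟩ := hinv _ (BinTree.ofPlane_ne_empty _) h0
    have hlen := map_length_eq i1 i2
    have e1 : condShape (hbpLaw T lam p) (BinTree.ofPlane (perfect n))
        = condShape ((branchLaw T lam (n + 1)).map BinTree.ofPlane)
          (BinTree.ofPlane (perfect n)) := by
      have := condShape_mixLaw (p := p) h (τ := BinTree.ofPlane (perfect n)) (by omega)
        (hp _ (by omega))
      rwa [hord] at this
    have e2 : condShape ((hbpLaw T lam p).map BinTree.prune) (BinTree.ofPlane (perfect n))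
        = condShape ((branchLaw T (fun i => lam (i + 1)) (n + 1)).map BinTree.ofPlane)
          (BinTree.ofPlane (perfect n)) := by
      have := condShape_mixLaw_map_prune (p := p) h h' (τ := BinTree.ofPlane (perfect n))
        (by omega) (branchLaw_map_pruned hT hlam (by omega)) (hp _ (by omega))
      rwa [hord] at this
    rw [e1, e2] at hlen
    have hf : Measurable fun x : ℝ => ENNReal.ofReal (Real.exp (-(1 * x))) := by fun_prop
    have hmul : Measurable fun x : ℝ => ζ * x := by fun_prop
    have hlap := congrArg
      (fun m : Measure ℝ => ∫⁻ x, ENNReal.ofReal (Real.exp (-(1 * x))) ∂m) hlen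
    simp only [lintegral_map hf LTree.measurable_length, lintegral_map hf hmul] at hlap
    rw [lintegral_map (by fun_prop) LTree.measurable_length, lintegral_length_perfect] at hlap
    simp only [one_mul (ζ * _)] at hlap
    rw [lintegral_length_perfect, lintegral_perfectWeight_one_congr h' h] at hlap
    exact (ENNReal.mul_right_inj
      (ENNReal.inv_ne_zero.2 (lintegral_perfectWeight_one_ne_top h n))
      (ENNReal.inv_ne_top.2 (lintegral_perfectWeight_one_ne_zero h n))).1 hlap
  -- The transform at order `j ≥ 2` is the termination probability times the transform of one edge
  -- times the square of the transform at order `j - 1`. Cancelling the common factors by `key` at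
  -- both orders leaves the edge.
  have hwait : ∫⁻ a : EdgeLength, ENNReal.ofReal (Real.exp (-(1 * a)))
        ∂(waitLaw T (fun i => lam (i + 1)) j)
      = ∫⁻ a : EdgeLength, ENNReal.ofReal (Real.exp (-(ζ * a))) ∂(waitLaw T lam j) := by
    rcases hj.eq_or_lt with rfl | hj'
    · have := key 0
      rwa [zero_add, h.lintegral_perfectWeight_zero (he _),
        h'.lintegral_perfectWeight_zero (he _)] at this
    · obtain ⟨n, rfl⟩ : ∃ n, j = n + 2 := ⟨j - 2, by omega⟩
      have := key (n + 1)
      rw [h.lintegral_perfectWeight_succ (he _), h'.lintegral_perfectWeight_succ (he _), key n,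
        ENNReal.mul_right_inj (termProb_ne_zero hT _) (termProb_ne_top _ _)] at this
      have hQ := lintegral_perfectWeight_exp_ne_zero hT hlam hζ n
      have hQ' := lintegral_perfectWeight_exp_ne_top hT hlam hζ n
      exact (ENNReal.mul_left_inj (mul_ne_zero hQ hQ) (ENNReal.mul_ne_top hQ' hQ')).1 this
  have hr := relRate_pos hT j
  have hl := hlam j hj
  have hl' := hlam (j + 1) (by omega)
  rw [lintegral_exp_neg_waitLaw (lam := fun i => lam (i + 1)) hT (hlam' j hj) one_pos,
    lintegral_exp_neg_waitLaw hT hl hζ, totalRate_eq, totalRate_eq] at hwait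
  -- With total rates `a'` after and `a` before pruning, the equation is `a' / (a' + 1) = a / (a +
  -- ζ)`, which amounts to `a' * ζ = a`; here `a' = lam (j + 1) * relRate T j` and `a = lam j *
  -- relRate T j`.
  rw [ENNReal.ofReal_eq_ofReal_iff (by positivity) (by positivity),
    div_eq_div_iff (by positivity) (by positivity)] at hwait
  rw [eq_div_iff hζ.ne']
  have : relRate T j * (lam (j + 1) * ζ) = relRate T j * lam j := by linear_combination hwait
  exact mul_left_cancel₀ hr.ne' this

theorem isSelfSimilar_hbpLaw_iff (hp : ∀ K, 1 ≤ K → 0 ≤ p K)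
    (hp_sum : HasSum (fun K : ℕ => p (K + 1)) 1) {ζ : ℝ} (hζ : 0 < ζ) :
    IsSelfSimilar (hbpLaw T lam p) ζ ↔
      (∃ p₀ : ℝ, 0 < p₀ ∧ p₀ < 1 ∧ ∀ K, 1 ≤ K → p K = p₀ * (1 - p₀) ^ (K - 1)) ∧
        ∃ γ : ℝ, 0 < γ ∧ ∀ j, 1 ≤ j → lam j = γ * ζ⁻¹ ^ j := by
  have h := branchFamily hT hlam
  have hs := branchFamily_shape hT hlam
  have hpos : (∃ p₀ : ℝ, 0 < p₀ ∧ p₀ < 1 ∧ ∀ K, 1 ≤ K → p K = p₀ * (1 - p₀) ^ (K - 1)) →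
      ∀ K, 1 ≤ K → 0 < p K := by
    rintro ⟨p₀, h0, h1, hgeo⟩ K hK
    rw [hgeo K hK]
    have : 0 < 1 - p₀ := by linarith
    positivity
  constructor
  · rintro ⟨-, -, -, -, hinv, -, hlen⟩
    have hgeo := geometric_of_pruneInvariant hs hp hp_sum (by
      rw [← hbpShapeLaw_eq]
      exact hinv)
    -- The constant is forced by `lam 1 = γ * ζ⁻¹`.
    refine ⟨hgeo, lam 1 * ζ, mul_pos (hlam 1 le_rfl) hζ, fun j hj => ?_⟩
    induction j, hj using Nat.le_induction with
    | base => field_simp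
    | succ j hj ih =>
      rw [rate_succ_of_pruneInvariantInLengths hT hlam hζ (hpos hgeo) hlen hj, ih, pow_succ]
      ring
  · rintro ⟨hgeo, γ, -, hrate⟩
    refine ⟨isProbabilityMeasure_mixLaw h hp hp_sum, mixLaw_empty p _,
      coordinatedInShapes_mixLaw h, coordinatedInLengths_mixLaw h, ?_, hζ,
      pruneInvariantInLengths hT hlam hζ (hpos hgeo) fun j hj => ?_⟩
    · obtain ⟨p₀, -, h1, hform⟩ := hgeo
      change PruneInvariant (hbpShapeLaw T lam p)
      rw [hbpShapeLaw_eq]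
      exact pruneInvariant_of_geometric hs hp hp_sum h1 hform
    · rw [hrate j hj, hrate (j + 1) (by omega), pow_succ]
      ring

end process

end

end RandomTree

theorem theorem4 (T lam p : ℕ → ℝ) (hT : ∀ k, 1 ≤ k → 0 ≤ T k) (hlam : ∀ j, 1 ≤ j → 0 < lam j)
    (hp : ∀ K, 1 ≤ K → 0 ≤ p K) (hp_sum : HasSum (fun K : ℕ => p (K + 1)) 1) :
    (RandomTree.IsMeanSelfSimilar (RandomTree.hbpShapeLaw T lam p) ∧
      RandomTree.HasTokunagaCoefficients (RandomTree.hbpShapeLaw T lam p) T) ∧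
    ((RandomTree.IsCombSelfSimilar (RandomTree.hbpShapeLaw T lam p) ∧
        RandomTree.HasTokunagaCoefficients (RandomTree.hbpShapeLaw T lam p) T) ↔
      ∃ p₀ : ℝ, 0 < p₀ ∧ p₀ < 1 ∧ ∀ K, 1 ≤ K → p K = p₀ * (1 - p₀) ^ (K - 1)) ∧
    (∀ ζ : ℝ, 0 < ζ →
      (RandomTree.IsSelfSimilar (RandomTree.hbpLaw T lam p) ζ ↔
        (∃ p₀ : ℝ, 0 < p₀ ∧ p₀ < 1 ∧ ∀ K, 1 ≤ K → p K = p₀ * (1 - p₀) ^ (K - 1)) ∧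
        ∃ γ : ℝ, 0 < γ ∧ ∀ j, 1 ≤ j → lam j = γ * ζ⁻¹ ^ j)) := by
  have hs := RandomTree.branchFamily_shape hT hlam
  refine ⟨?_, ?_, fun ζ hζ => RandomTree.isSelfSimilar_hbpLaw_iff hT hlam hp hp_sum hζ⟩
  · rw [RandomTree.hbpShapeLaw_eq]
    exact ⟨RandomTree.isMeanSelfSimilar_mixLaw hs hp hp_sum,
      RandomTree.hasTokunagaCoefficients_mixLaw hs⟩
  · rw [RandomTree.hbpShapeLaw_eq]
    refine ⟨fun h => RandomTree.geometric_of_pruneInvariant hs hp hp_sum h.1.2.2.2, ?_⟩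
    rintro ⟨p₀, -, h1, hgeo⟩
    exact ⟨⟨RandomTree.isProbabilityMeasure_mixLaw hs hp hp_sum, RandomTree.mixLaw_empty p _,
      RandomTree.coordinated_mixLaw hs,
      RandomTree.pruneInvariant_of_geometric hs hp hp_sum h1 hgeo⟩,
      RandomTree.hasTokunagaCoefficients_mixLaw hs⟩
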